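/- Let $S$ be a compact surface, with or without boundary (a compact Hausdorff topological $2$-manifold, possibly with boundary), triangulated by a complete graph $K_{n+1}$; that is, $S$ is given a homeomorphism with the geometric realization of a simplicial complex of dimension at most $2$ with vertices $0,\dots,n$ whose $1$-skeleton is the complete graph on these $n+1$ vertices. If $\partial S\neq\emptyset$, assume moreover that $K_{n+1}$ is properly embedded in $S$, i.e. that all the vertices of the triangulation lie on $\partial S$. Then $S$ admits a substantial polyhedral tight embedding $\varphi:S\to\mathbb R^n$. Here a topological embedding $\varphi$ is called substantial if its image is contained in no affine hyperplane (equivalently, its image affinely spans $\mathbb R^n$); polyhedral if its image is the underlying space of a finite geometric simplicial complex in $\mathbb R^n$; and tight if for every $p\ge 0$ and every open affine half-space $E\subset\mathbb R^n$ the homomorphism $H_p(\varphi(S)\cap E;\mathbb Z/2)\to H_p(\varphi(S);\mathbb Z/2)$ induced by the inclusion is injective. Moreover $\varphi$ can be chosen so that, for some $n$-simplex in $\mathbb R^n$ with vertices $v_0,\dots,v_n$, each face of the triangulation with vertex set $s$ (vertex, edge or triangle) is mapped by $\varphi$ onto the face of the simplex spanned by $\{v_i: i\in s\}$; in particular the triangles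 are mapped onto $2$-faces of the simplex. -/

import Mathlib

open scoped Manifold

namespace TightSurface

noncomputable section

/-- The 1-skeleton of an abstract simplicial complex, as a graph on its vertices. -/
def oneSkeleton {V : Type*} [DecidableEq V] (K : AbstractSimplicialComplex V) :
    SimpleGraph V where
  Adj i j := i ≠ j ∧ {i, j} ∈ K.faces
  symm := ⟨fun i j h => ⟨h.1.symm, by rw [Finset.pair_comm]; exact h.2⟩⟩
  loopless := ⟨fun _ h => h.1 rfl⟩

/-- The set of vertices at which the barycentric coordinates `x` do not vanish. -/
def supp {V : Type*} [Fintype V] (x : V → ℝ) : Finset V :=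
  letI := Classical.decPred fun i => x i ≠ 0
  Finset.univ.filter fun i => x i ≠ 0

/-- The geometric realization of a finite abstract simplicial complex: the points of the standard
simplex (in barycentric coordinates) that are carried by a face. -/
def realization {V : Type*} [Fintype V] (K : AbstractSimplicialComplex V) : Set (V → ℝ) :=
  {x | x ∈ stdSimplex ℝ V ∧ supp x ∈ K.faces}

/-- A vertex of the complex, as a point of the geometric realization. -/
def realizationVertex {V : Type*} [Fintype V] [DecidableEq V] (K : AbstractSimplicialComplex V)
    (i : V) : realization K :=
  ⟨Pi.single i 1, single_mem_stdSimplex ℝ i, by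
    have h : supp (Pi.single i (1 : ℝ) : V → ℝ) = {i} := by
      ext j
      simp [supp, Pi.single_apply]
    rw [h]
    exact K.singleton_mem i⟩

/-- A triangulation of `S` with vertex set `V` (by vertices, edges and triangles): an abstract
simplicial complex of dimension at most two, all of whose vertices are the elements of `V`, with a
homeomorphism from its geometric realization onto `S`. -/
structure Triangulation (V : Type*) [Fintype V] (S : Type*) [TopologicalSpace S] where
  complex : AbstractSimplicialComplex V
  card_le_three : ∀ s ∈ complex.faces, s.card ≤ 3
  homeo : realization complex ≃ₜ S

/-- The point of `S` that is the vertex `i` of the triangulation. -/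
def Triangulation.vertex {V S : Type*} [Fintype V] [DecidableEq V] [TopologicalSpace S]
    (T : Triangulation V S) (i : V) : S :=
  T.homeo (realizationVertex T.complex i)

/-- The closed cell (vertex, edge or triangle) of `S` with set of vertices `s`. -/
def Triangulation.cell {V S : Type*} [Fintype V] [TopologicalSpace S]
    (T : Triangulation V S) (s : Finset V) : Set S :=
  T.homeo '' {x | supp x.1 ⊆ s}

/-- The map is *substantial*: its image lies in no affine hyperplane, that is, the image affinely
spans the whole space. -/
def IsSubstantial {n : ℕ} {X : Type*} (φ : X → EuclideanSpace ℝ (Fin n)) : Prop :=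
  affineSpan ℝ (Set.range φ) = ⊤

/-- The map is *polyhedral*: its image is a compact polyhedron, the underlying space of a finite
simplicial complex in `ℝⁿ`. -/
def IsPolyhedral {n : ℕ} {X : Type*} (φ : X → EuclideanSpace ℝ (Fin n)) : Prop :=
  ∃ K : Geometry.SimplicialComplex ℝ (EuclideanSpace ℝ (Fin n)),
    K.faces.Finite ∧ Set.range φ = K.space

/-- The open half-spaces of `ℝⁿ`. -/
def IsOpenHalfSpace {n : ℕ} (E : Set (EuclideanSpace ℝ (Fin n))) : Prop :=
  ∃ (u : EuclideanSpace ℝ (Fin n)) (c : ℝ), u ≠ 0 ∧ E = {x | c < inner ℝ u x}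

/-- The `p`-th singular homology functor with coefficients in `ℤ/2`. -/
abbrev homologyZ2 (p : ℕ) : CategoryTheory.Functor TopCat.{0} (ModuleCat.{0} (ZMod 2)) :=
  (AlgebraicTopology.singularHomologyFunctor (ModuleCat.{0} (ZMod 2)) p).obj
    (ModuleCat.of (ZMod 2) (ZMod 2))

/-- The inclusion of a smaller subspace into a larger one, as a morphism of topological spaces. -/
def inclusionHom {X : Type} [TopologicalSpace X] {A B : Set X} (h : A ⊆ B) :
    TopCat.of A ⟶ TopCat.of B :=
  TopCat.ofHom ⟨Set.inclusion h, continuous_inclusion h⟩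

/-- `φ` is *`p`-tight*: for every open half-space `E`, the map
`H_p(φ(X) ∩ E; ℤ/2) → H_p(φ(X); ℤ/2)` induced by the inclusion is injective. -/
def IsPTight {n : ℕ} {X : Type*} (p : ℕ) (φ : X → EuclideanSpace ℝ (Fin n)) : Prop :=
  ∀ E : Set (EuclideanSpace ℝ (Fin n)), IsOpenHalfSpace E →
    Function.Injective
      ((homologyZ2 p).map
        (inclusionHom (Set.inter_subset_left : Set.range φ ∩ E ⊆ Set.range φ)))

/-- `φ` is *tight*: it is `p`-tight for every `p`. -/
def IsTight {n : ℕ} {X : Type*} (φ : X → EuclideanSpace ℝ (Fin n)) : Prop :=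
  ∀ p : ℕ, IsPTight p φ

end

end TightSurface

/-!
The map `φ` sends a point of the surface with barycentric coordinates `x` to `∑ i, x i • b i`, where
the `b i` are affinely independent points of `ℝⁿ`. All properties but tightness are immediate: the
image is the subcomplex `M` of the simplex that has the given faces.

For tightness let `l` be an affine function, let `M'` be the subcomplex induced on the vertices with
`l > c`, and let `z` be a singular cycle in the part of `M` above the level `c` that bounds in `M`.
A point above the level has a vertex above the level in its support. So, after subdivision, `z` has
a simplicial approximation whose vertices all lie above the level; it is a cycle `f` of `M'`, and it
is homologous to `z` above the level, where the segments from the points to their approximations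
stay. Approximating a chain bounded by `z` shows that `f` bounds simplicially in `M`
(`exists_sbd_eq_of_carrierAbove`). So it suffices that a simplicial cycle of `M'`, of dimension `p`,
that bounds in `M` bounds in `M'` (`simp_injective`).

* For `p = 0` this holds since the graph is complete, so that `M'` is connected.
* For `p ≥ 2` there is nothing to show, since there are no faces with four vertices.
* For `p = 1` let `f` be a cycle of `M'` and `f = ∂g` with a chain `g` of triangles. For a vertex `v`
  below the level, the edges opposite to `v` in the triangles of `g` around `v` form a cycle of the
  link of `v`. If the vertices lie on the boundary, links contain no nonzero cycles, so that `g` uses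
  no triangle at `v` and already lies in `M'`. If the surface is closed, a nonzero cycle of a link
  contains all of the link, so that `g` uses all triangles at `v` or none; since the graph
  is complete, every other vertex is in the link of `v`, so that the same alternative holds at all
  vertices below the level. If it is none, `g` lies in `M'`; otherwise the sum of `g` and of all
  triangles lies in `M'`, and its boundary is `f` since the sum of all triangles is a cycle.

The facts about links (`surfaceLinks_of_homeomorph`) come from a chart at the vertex: the link is a
retract of the punctured chart domain, by radial projection. A punctured half-disc about a boundary
point is star-shaped, so that a cycle of the link bounds there, hence in the link, and is zero. In a
disc about an interior point, a cycle of the link that misses a face of the link could be contracted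
along its cone in the complement of a point close to the vertex, hence would bound in the punctured
disc; and if the link had no nonzero cycle, a small triangle around the vertex, which is homotopic
to its projection to the link, would bound in the punctured disc, because every singular cycle of
the link is homologous to a simplicial one (`exists_simp_homologous`).

Throughout, chains of `p` vertices are indexed by `p`, so that augmented chain complexes need no
separate treatment, and all coefficients are `ℤ/2`, so that there are no signs.
-/

namespace TightSurface

noncomputable section

/-! ### Ordered chains -/

/-- Ordered chains with coefficients in `ℤ/2`: formal sums of `p`-tuples of elements of `α`. The
index counts the vertices, so that a `p`-tuple is a simplex of dimension `p - 1`, and `p = 0`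
is the degree of the augmentation. -/
abbrev Ord (α : Type*) (p : ℕ) : Type _ := (Fin p → α) →₀ ZMod 2

variable {α β γ δ : Type*}

/-- In a module over `ℤ/2` every element is its own negative. -/
theorem add_self_eq_zero_of_zmod2 {M : Type*} [AddCommGroup M] [Module (ZMod 2) M] (x : M) :
    x + x = 0 := by
  rw [← two_smul (ZMod 2) x, show (2 : ZMod 2) = 0 from rfl, zero_smul]

theorem add_add_self_of_zmod2 {M : Type*} [AddCommGroup M] [Module (ZMod 2) M] (x y : M) :
    x + y + y = x := by
  rw [add_assoc, add_self_eq_zero_of_zmod2, add_zero]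

/-- Linear maps out of a free module agree if they agree on the basis. -/
theorem linearMap_ext_single {ι M : Type*} [AddCommGroup M] [Module (ZMod 2) M]
    {f g : (ι →₀ ZMod 2) →ₗ[ZMod 2] M}
    (h : ∀ i, f (Finsupp.single i 1) = g (Finsupp.single i 1)) : f = g :=
  Finsupp.lhom_ext' fun i => LinearMap.ext_ring (h i)

/-- A linear map sends a chain supported in `A` into a submodule as soon as it does so for the
basis elements in `A`. -/
theorem map_mem_of_mem_supported {ι M : Type*} [AddCommGroup M] [Module (ZMod 2) M]
    (f : (ι →₀ ZMod 2) →ₗ[ZMod 2] M) {A : Set ι} {N : Submodule (ZMod 2) M}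
    (h : ∀ i ∈ A, f (Finsupp.single i 1) ∈ N) {c : ι →₀ ZMod 2}
    (hc : c ∈ Finsupp.supported (ZMod 2) (ZMod 2) A) : f c ∈ N := by
  rw [Finsupp.supported_eq_span_single] at hc
  exact Submodule.span_le (p := N.comap f).2 (by rintro _ ⟨i, hi, rfl⟩; exact h i hi) hc

theorem eqOn_of_mem_supported {ι M : Type*} [AddCommGroup M] [Module (ZMod 2) M]
    {f g : (ι →₀ ZMod 2) →ₗ[ZMod 2] M} {A : Set ι}
    (h : ∀ i ∈ A, f (Finsupp.single i 1) = g (Finsupp.single i 1)) {c : ι →₀ ZMod 2}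
    (hc : c ∈ Finsupp.supported (ZMod 2) (ZMod 2) A) : f c = g c := by
  have := map_mem_of_mem_supported (f - g) (N := ⊥) (A := A)
    (fun i hi => by simp [h i hi]) hc
  simpa [sub_eq_zero] using this

theorem single_mem_supported {ι : Type*} {A : Set ι} {i : ι} (h : i ∈ A) :
    Finsupp.single i (1 : ZMod 2) ∈ Finsupp.supported (ZMod 2) (ZMod 2) A :=
  Finsupp.single_mem_supported _ _ h

/-- Chains of tuples with entries in `A`. -/
abbrev ordOn (A : Set α) (p : ℕ) : Submodule (ZMod 2) (Ord α p) :=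
  Finsupp.supported (ZMod 2) (ZMod 2) {w | ∀ i, w i ∈ A}

/-- The boundary of ordered chains. -/
def bd (p : ℕ) : Ord α (p + 1) →ₗ[ZMod 2] Ord α p :=
  Finsupp.linearCombination (ZMod 2)
    fun w => ∑ i : Fin (p + 1), Finsupp.single (w ∘ i.succAbove) 1

/-- The map on ordered chains induced by a map of vertices. -/
def ordMap (f : α → β) (p : ℕ) : Ord α p →ₗ[ZMod 2] Ord β p :=
  Finsupp.linearCombination (ZMod 2) fun w => Finsupp.single (f ∘ w) 1

/-- The cone with apex `b`: it puts `b` in front of every tuple. -/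
def cone (b : α) (p : ℕ) : Ord α p →ₗ[ZMod 2] Ord α (p + 1) :=
  Finsupp.linearCombination (ZMod 2) fun w => Finsupp.single (Fin.cons b w) 1

@[simp] theorem bd_single {p : ℕ} (w : Fin (p + 1) → α) :
    bd p (Finsupp.single w 1) = ∑ i : Fin (p + 1), Finsupp.single (w ∘ i.succAbove) 1 := by
  simp [bd]

@[simp] theorem ordMap_single (f : α → β) {p : ℕ} (w : Fin p → α) :
    ordMap f p (Finsupp.single w 1) = Finsupp.single (f ∘ w) 1 := by
  simp [ordMap]

@[simp] theorem cone_single (b : α) {p : ℕ} (w : Fin p → α) :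
    cone b p (Finsupp.single w 1) = Finsupp.single (Fin.cons b w : Fin (p + 1) → α) 1 := by
  simp [cone]

theorem bd_ordMap (f : α → β) {p : ℕ} (c : Ord α (p + 1)) :
    bd p (ordMap f (p + 1) c) = ordMap f p (bd p c) := by
  revert c
  refine LinearMap.congr_fun (f := bd p ∘ₗ ordMap f (p + 1)) (g := ordMap f p ∘ₗ bd p)
    (linearMap_ext_single fun w => ?_)
  simp [map_sum, Function.comp_assoc]

theorem ordMap_ordMap (g : β → γ) (f : α → β) {p : ℕ} (c : Ord α p) :
    ordMap g p (ordMap f p c) = ordMap (g ∘ f) p c := by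
  revert c
  refine LinearMap.congr_fun (f := ordMap g p ∘ₗ ordMap f p) (g := ordMap (g ∘ f) p)
    (linearMap_ext_single fun w => ?_)
  simp [Function.comp_assoc]

theorem ordMap_cone (f : α → β) (b : α) {p : ℕ} (c : Ord α p) :
    ordMap f (p + 1) (cone b p c) = cone (f b) p (ordMap f p c) := by
  revert c
  refine LinearMap.congr_fun (f := ordMap f (p + 1) ∘ₗ cone b p) (g := cone (f b) p ∘ₗ ordMap f p)
    (linearMap_ext_single fun w => ?_)
  simp only [LinearMap.comp_apply, cone_single, ordMap_single]
  congr 1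
  funext i
  refine Fin.cases ?_ (fun j => ?_) i <;> simp

theorem bd_cone_succ (b : α) {p : ℕ} (c : Ord α (p + 1)) :
    bd (p + 1) (cone b (p + 1) c) = c + cone b p (bd p c) := by
  revert c
  refine LinearMap.congr_fun (f := bd (p + 1) ∘ₗ cone b (p + 1))
    (g := LinearMap.id + cone b p ∘ₗ bd p) (linearMap_ext_single fun w => ?_)
  simp only [LinearMap.comp_apply, cone_single, bd_single, LinearMap.add_apply, LinearMap.id_apply,
    map_sum]
  rw [Fin.sum_univ_succ]
  congr 1
  refine Finset.sum_congr rfl fun i _ => ?_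
  congr 1
  funext j
  refine Fin.cases ?_ (fun k => ?_) j <;> simp

theorem bd_cone_zero (b : α) (c : Ord α 0) : bd 0 (cone b 0 c) = c := by
  revert c
  refine LinearMap.congr_fun (f := bd 0 ∘ₗ cone b 0)
    (g := LinearMap.id) (linearMap_ext_single fun w => ?_)
  simp only [LinearMap.comp_apply, cone_single, bd_single, LinearMap.id_apply]
  simp only [Nat.reduceAdd, Finset.univ_unique, Finset.sum_singleton]
  congr 1

theorem bd_bd {p : ℕ} (c : Ord α (p + 2)) : bd p (bd (p + 1) c) = 0 := by
  revert c
  refine LinearMap.congr_fun (f := bd p ∘ₗ bd (p + 1)) (g := 0) ?_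
  -- every tuple is a cone, so the cone formula gives the claim by induction
  induction p with
  | zero =>
    refine linearMap_ext_single fun w => ?_
    rw [LinearMap.comp_apply, ← Fin.cons_self_tail w, ← cone_single, bd_cone_succ, map_add,
      bd_cone_zero, add_self_eq_zero_of_zmod2, LinearMap.zero_apply]
  | succ p ih =>
    refine linearMap_ext_single fun w => ?_
    have h := LinearMap.congr_fun ih (Finsupp.single (Fin.tail w) 1)
    rw [LinearMap.comp_apply] at h
    rw [LinearMap.comp_apply, ← Fin.cons_self_tail w, ← cone_single, bd_cone_succ, map_add,
      bd_cone_succ, h, LinearMap.zero_apply, map_zero, add_zero, add_self_eq_zero_of_zmod2,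
      LinearMap.zero_apply]

theorem cone_mem {b : α} {A : Set α} (hb : b ∈ A) {p : ℕ} {c : Ord α p} (hc : c ∈ ordOn A p) :
    cone b p c ∈ ordOn A (p + 1) :=
  map_mem_of_mem_supported _ (fun w hw => by
    rw [cone_single]
    refine single_mem_supported fun i => ?_
    refine Fin.cases ?_ (fun j => ?_) i
    · simpa using hb
    · simpa using hw j) hc

theorem bd_mem {A : Set α} {p : ℕ} {c : Ord α (p + 1)} (hc : c ∈ ordOn A (p + 1)) :
    bd p c ∈ ordOn A p :=
  map_mem_of_mem_supported _ (fun w hw => by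
    rw [bd_single]
    exact Submodule.sum_mem _ fun i _ => single_mem_supported fun j => hw _) hc

/-! ### Homotopies of ordered chain maps by cones -/

/-- The homotopy between two maps `f`, `g` of ordered chains, obtained by filling in the chain
`f w + g w + D (∂ w)` by a cone with apex `b w`. -/
def coneHtpy (f g : ∀ p, Ord α p →ₗ[ZMod 2] Ord β p) (b : ∀ p, (Fin (p + 1) → α) → β) :
    ∀ p, Ord α p →ₗ[ZMod 2] Ord β (p + 1)
  | 0 => 0
  | p + 1 => Finsupp.linearCombination (ZMod 2) fun w =>
      cone (b p w) (p + 1) (f (p + 1) (Finsupp.single w 1) + g (p + 1) (Finsupp.single w 1) +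
        coneHtpy f g b p (bd p (Finsupp.single w 1)))

theorem coneHtpy_single (f g : ∀ p, Ord α p →ₗ[ZMod 2] Ord β p) (b : ∀ p, (Fin (p + 1) → α) → β)
    (p : ℕ) (w : Fin (p + 1) → α) :
    coneHtpy f g b (p + 1) (Finsupp.single w 1) =
      cone (b p w) (p + 1) (f (p + 1) (Finsupp.single w 1) + g (p + 1) (Finsupp.single w 1) +
        coneHtpy f g b p (bd p (Finsupp.single w 1))) := by
  rw [coneHtpy, Finsupp.linearCombination_single, one_smul]

/-- Two maps of augmented ordered chain complexes that agree in degree `0` are homotopic. -/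
theorem bd_coneHtpy {f g : ∀ p, Ord α p →ₗ[ZMod 2] Ord β p} (b : ∀ p, (Fin (p + 1) → α) → β)
    (hf : ∀ p c, bd p (f (p + 1) c) = f p (bd p c))
    (hg : ∀ p c, bd p (g (p + 1) c) = g p (bd p c)) (h0 : f 0 = g 0)
    (p : ℕ) (c : Ord α (p + 1)) :
    bd (p + 1) (coneHtpy f g b (p + 1) c) + coneHtpy f g b p (bd p c) =
      f (p + 1) c + g (p + 1) c := by
  revert c
  refine LinearMap.congr_fun
    (f := bd (p + 1) ∘ₗ coneHtpy f g b (p + 1) + coneHtpy f g b p ∘ₗ bd p)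
    (g := f (p + 1) + g (p + 1)) ?_
  induction p with
  | zero =>
    refine linearMap_ext_single fun w => ?_
    simp only [LinearMap.add_apply, LinearMap.comp_apply]
    rw [coneHtpy_single, bd_cone_succ]
    simp only [map_add (bd _), hf, hg]
    rw [h0, add_self_eq_zero_of_zmod2]
    simp [coneHtpy]
  | succ p ih =>
    refine linearMap_ext_single fun w => ?_
    simp only [LinearMap.add_apply, LinearMap.comp_apply]
    have h := LinearMap.congr_fun ih (bd (p + 1) (Finsupp.single w 1))
    simp only [LinearMap.add_apply, LinearMap.comp_apply, bd_bd, map_zero, add_zero] at h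
    rw [coneHtpy_single, bd_cone_succ]
    simp only [map_add (bd _), hf, hg]
    rw [h, add_self_eq_zero_of_zmod2, map_zero, add_zero]
    exact add_add_self_of_zmod2 _ _

theorem ordMap_coneHtpy {f g : ∀ p, Ord α p →ₗ[ZMod 2] Ord β p} {b : ∀ p, (Fin (p + 1) → α) → β}
    {f' g' : ∀ p, Ord γ p →ₗ[ZMod 2] Ord δ p} {b' : ∀ p, (Fin (p + 1) → γ) → δ}
    (h : α → γ) (k : β → δ) (hf : ∀ p c, ordMap k p (f p c) = f' p (ordMap h p c))
    (hg : ∀ p c, ordMap k p (g p c) = g' p (ordMap h p c)) (hb : ∀ p w, k (b p w) = b' p (h ∘ w))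
    (p : ℕ) (c : Ord α p) :
    ordMap k (p + 1) (coneHtpy f g b p c) = coneHtpy f' g' b' p (ordMap h p c) := by
  revert c
  refine LinearMap.congr_fun (f := ordMap k (p + 1) ∘ₗ coneHtpy f g b p)
    (g := coneHtpy f' g' b' p ∘ₗ ordMap h p) ?_
  induction p with
  | zero => simp [coneHtpy]
  | succ p ih =>
    refine linearMap_ext_single fun w => ?_
    have h' := LinearMap.congr_fun ih (bd p (Finsupp.single w 1))
    simp only [LinearMap.comp_apply] at h' ⊢
    rw [coneHtpy_single, ordMap_cone]
    simp only [map_add (ordMap _ _), hf, hg]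
    rw [h', ← bd_ordMap, ordMap_single, coneHtpy_single, hb]

theorem coneHtpy_mem {f g : ∀ p, Ord α p →ₗ[ZMod 2] Ord β p} {b : ∀ p, (Fin (p + 1) → α) → β}
    {A : Set α} {B : Set β}
    (hf : ∀ p (w : Fin p → α), (∀ i, w i ∈ A) → f p (Finsupp.single w 1) ∈ ordOn B p)
    (hg : ∀ p (w : Fin p → α), (∀ i, w i ∈ A) → g p (Finsupp.single w 1) ∈ ordOn B p)
    (hb : ∀ p w, (∀ i, w i ∈ A) → b p w ∈ B) {p : ℕ} {c : Ord α p} (hc : c ∈ ordOn A p) :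
    coneHtpy f g b p c ∈ ordOn B (p + 1) := by
  induction p with
  | zero => simp [coneHtpy]
  | succ p ih =>
    refine map_mem_of_mem_supported _ (fun w hw => ?_) hc
    rw [coneHtpy_single]
    refine cone_mem (hb _ _ hw) (Submodule.add_mem _ (Submodule.add_mem _ (hf _ _ hw) (hg _ _ hw))
      (ih (bd_mem (single_mem_supported hw))))

/-! ### Unordered simplicial chains -/

/-- Simplicial chains with coefficients in `ℤ/2`: formal sums of finite sets of vertices, of any
cardinality (the empty set spans the degree of the augmentation). -/
abbrev Simp (V : Type*) : Type _ := Finset V →₀ ZMod 2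

variable {V : Type*}

/-- The boundary of simplicial chains. -/
def simpBd [DecidableEq V] : Simp V →ₗ[ZMod 2] Simp V :=
  Finsupp.linearCombination (ZMod 2) fun s => ∑ x ∈ s, Finsupp.single (s.erase x) 1

@[simp] theorem simpBd_single [DecidableEq V] (s : Finset V) :
    simpBd (Finsupp.single s 1) = ∑ x ∈ s, Finsupp.single (s.erase x) 1 := by
  simp [simpBd]

/-- The simplicial chain of an ordered chain: the order is forgotten, and tuples with a repeated
entry become zero. -/
def toSimp [DecidableEq V] (p : ℕ) : Ord V p →ₗ[ZMod 2] Simp V :=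
  Finsupp.linearCombination (ZMod 2) fun w =>
    if (Finset.univ.image w).card = p then Finsupp.single (Finset.univ.image w) 1 else 0

@[simp] theorem toSimp_single [DecidableEq V] {p : ℕ} (w : Fin p → V) :
    toSimp p (Finsupp.single w 1) =
      if (Finset.univ.image w).card = p then Finsupp.single (Finset.univ.image w) 1 else 0 := by
  simp [toSimp]

/-- The ordered chain of a simplicial chain, for a linear order of the vertices: the vertices of a
simplex are listed in increasing order, and simplices of the wrong dimension become zero. -/
def toOrd [LinearOrder V] (p : ℕ) : Simp V →ₗ[ZMod 2] Ord V p :=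
  Finsupp.linearCombination (ZMod 2) fun s =>
    if h : s.card = p then Finsupp.single (⇑(s.orderEmbOfFin h)) 1 else 0

theorem toOrd_single [LinearOrder V] {p : ℕ} (s : Finset V) (h : s.card = p) :
    toOrd p (Finsupp.single s 1) = Finsupp.single (⇑(s.orderEmbOfFin h)) 1 := by
  simp [toOrd, h]

theorem toOrd_single_of_ne [LinearOrder V] {p : ℕ} (s : Finset V) (h : s.card ≠ p) :
    toOrd p (Finsupp.single s 1) = 0 := by
  simp [toOrd, h]

theorem image_comp_succAbove [DecidableEq V] {p : ℕ} {w : Fin (p + 1) → V}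
    (hw : Function.Injective w) (i : Fin (p + 1)) :
    Finset.univ.image (w ∘ i.succAbove) = (Finset.univ.image w).erase (w i) := by
  ext x
  simp only [Finset.mem_image, Finset.mem_univ, true_and, Finset.mem_erase, Function.comp]
  constructor
  · rintro ⟨j, rfl⟩
    exact ⟨fun h => Fin.succAbove_ne i j (hw h), _, rfl⟩
  · rintro ⟨hx, j, rfl⟩
    obtain ⟨k, rfl⟩ := Fin.exists_succAbove_eq (y := i) (x := j) (fun h => hx (by rw [h]))
    exact ⟨k, rfl⟩

theorem image_comp_succAbove_of_eq [DecidableEq V] {p : ℕ} {w : Fin (p + 1) → V}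
    {i j : Fin (p + 1)} (hij : i ≠ j) (hw : w i = w j) :
    Finset.univ.image (w ∘ i.succAbove) = Finset.univ.image w := by
  ext x
  simp only [Finset.mem_image, Finset.mem_univ, true_and, Function.comp]
  constructor
  · rintro ⟨j, rfl⟩
    exact ⟨_, rfl⟩
  · rintro ⟨k, rfl⟩
    by_cases hk : k = i
    · obtain ⟨l, hl⟩ := Fin.exists_succAbove_eq hij.symm
      exact ⟨l, by rw [hl, hk, hw]⟩
    · obtain ⟨l, hl⟩ := Fin.exists_succAbove_eq hk
      exact ⟨l, by rw [hl]⟩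

theorem card_image_eq_iff [DecidableEq V] {p : ℕ} (w : Fin p → V) :
    (Finset.univ.image w).card = p ↔ Function.Injective w := by
  have h := Finset.card_image_iff (s := Finset.univ) (f := w)
  simpa [Set.injOn_univ] using h

theorem toSimp_bd [DecidableEq V] {p : ℕ} (c : Ord V (p + 1)) :
    toSimp p (bd p c) = simpBd (toSimp (p + 1) c) := by
  revert c
  refine LinearMap.congr_fun (f := toSimp p ∘ₗ bd p) (g := simpBd ∘ₗ toSimp (p + 1))
    (linearMap_ext_single fun w => ?_)
  simp only [LinearMap.comp_apply, bd_single, map_sum, toSimp_single]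
  by_cases hw : Function.Injective w
  · rw [if_pos ((card_image_eq_iff w).2 hw), simpBd_single, Finset.sum_image hw.injOn]
    refine Finset.sum_congr rfl fun i _ => ?_
    rw [if_pos ((card_image_eq_iff _).2 (hw.comp Fin.succAbove_right_injective)),
      image_comp_succAbove hw]
  · rw [if_neg (fun h => hw ((card_image_eq_iff w).1 h)), map_zero]
    simp only [Function.Injective, not_forall] at hw
    obtain ⟨i, j, hw, hij⟩ := hw
    -- only the faces opposite to `i` and `j` can be injective, and these two faces cancel
    rw [← Finset.sum_subset (Finset.subset_univ {i, j}), Finset.sum_pair hij,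
      image_comp_succAbove_of_eq hij hw, image_comp_succAbove_of_eq (Ne.symm hij) hw.symm,
      add_self_eq_zero_of_zmod2]
    intro k _ hk
    simp only [Finset.mem_insert, Finset.mem_singleton, not_or] at hk
    refine if_neg fun h => ?_
    have h := (card_image_eq_iff _).1 h
    obtain ⟨a, ha⟩ := Fin.exists_succAbove_eq (y := k) (x := i) (Ne.symm hk.1)
    obtain ⟨b, hb⟩ := Fin.exists_succAbove_eq (y := k) (x := j) (Ne.symm hk.2)
    have hab : a = b := h (by simp [ha, hb, hw])
    exact hij (by rw [← ha, ← hb, hab])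

theorem sum_orderEmbOfFin [LinearOrder V] {M : Type*} [AddCommMonoid M] {p : ℕ} (s : Finset V)
    (h : s.card = p) (F : V → M) : ∑ x ∈ s, F x = ∑ i, F (s.orderEmbOfFin h i) := by
  have him : Finset.univ.image (s.orderEmbOfFin h) = s := by
    ext x; simpa only [Finset.mem_image, Finset.mem_univ, true_and, Set.mem_range,
      Finset.mem_coe] using (Set.ext_iff.1 (Finset.range_orderEmbOfFin s h) x)
  rw [← Finset.sum_image (f := F) (s.orderEmbOfFin h).injective.injOn, him]

theorem orderEmbOfFin_comp_succAbove [LinearOrder V] {p : ℕ} (s : Finset V)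
    (h : s.card = p + 1) (i : Fin (p + 1)) (hc : (s.erase (s.orderEmbOfFin h i)).card = p) :
    ⇑(s.orderEmbOfFin h) ∘ i.succAbove = (s.erase (s.orderEmbOfFin h i)).orderEmbOfFin hc := by
  refine Finset.orderEmbOfFin_unique hc (fun j => ?_)
    ((s.orderEmbOfFin h).strictMono.comp (Fin.strictMono_succAbove i))
  exact Finset.mem_erase.2 ⟨fun h' => Fin.succAbove_ne i j ((s.orderEmbOfFin h).injective h'),
    Finset.orderEmbOfFin_mem s h _⟩

theorem toOrd_simpBd [LinearOrder V] {p : ℕ} (c : Simp V) :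
    toOrd p (simpBd c) = bd p (toOrd (p + 1) c) := by
  suffices h : toOrd p ∘ₗ simpBd = bd p ∘ₗ toOrd (V := V) (p + 1) from LinearMap.congr_fun h c
  refine linearMap_ext_single fun s => ?_
  change toOrd p (simpBd (Finsupp.single s 1)) = bd p (toOrd (p + 1) (Finsupp.single s 1))
  rw [simpBd_single, map_sum]
  by_cases hs : s.card = p + 1
  · rw [toOrd_single s hs, bd_single, sum_orderEmbOfFin s hs]
    refine Finset.sum_congr rfl fun i _ => ?_
    have hc : (s.erase (s.orderEmbOfFin hs i)).card = p := by
      rw [Finset.card_erase_of_mem (Finset.orderEmbOfFin_mem s hs i), hs, Nat.add_sub_cancel]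
    rw [toOrd_single _ hc, orderEmbOfFin_comp_succAbove s hs i hc]
  · rw [toOrd_single_of_ne _ hs, map_zero]
    refine Finset.sum_eq_zero fun x hx => toOrd_single_of_ne _ fun h => hs ?_
    rw [← h, Finset.card_erase_add_one hx]

theorem toOrd_zero_toSimp_zero [LinearOrder V] (c : Ord V 0) : toOrd 0 (toSimp 0 c) = c := by
  revert c
  refine LinearMap.congr_fun (f := toOrd 0 ∘ₗ toSimp 0) (g := LinearMap.id)
    (linearMap_ext_single fun w => ?_)
  simp only [LinearMap.comp_apply, toSimp_single, LinearMap.id_apply]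
  rw [if_pos (by simp), toOrd_single _ (by simp)]
  congr 1
  exact Subsingleton.elim _ _

theorem toSimp_toOrd [LinearOrder V] {p : ℕ} {c : Simp V}
    (hc : c ∈ Finsupp.supported (ZMod 2) (ZMod 2) {s : Finset V | s.card = p}) :
    toSimp p (toOrd p c) = c := by
  refine eqOn_of_mem_supported (f := toSimp p ∘ₗ toOrd p) (g := LinearMap.id) (fun s hs => ?_) hc
  have him : Finset.univ.image (s.orderEmbOfFin hs) = s := by
    ext x; simpa only [Finset.mem_image, Finset.mem_univ, true_and, Set.mem_range, Finset.mem_coe]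
      using Set.ext_iff.1 (Finset.range_orderEmbOfFin s hs) x
  have hs' : s.card = p := hs
  simp only [LinearMap.comp_apply, LinearMap.id_apply, toOrd_single s hs, toSimp_single, him,
    if_pos hs']

/-- The homotopy between an ordered chain and its reordering. -/
def sortHtpy [LinearOrder V] (p : ℕ) : Ord V p →ₗ[ZMod 2] Ord V (p + 1) :=
  coneHtpy (fun _ => LinearMap.id) (fun p => toOrd p ∘ₗ toSimp p) (fun _ w => w 0) p

theorem bd_sortHtpy [LinearOrder V] {p : ℕ} (c : Ord V (p + 1)) :
    bd (p + 1) (sortHtpy (p + 1) c) + sortHtpy p (bd p c) =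
      c + toOrd (p + 1) (toSimp (p + 1) c) :=
  bd_coneHtpy (f := fun _ => LinearMap.id) (g := fun p => toOrd p ∘ₗ toSimp p) _ (fun _ _ => rfl)
    (fun p c => by simp only [LinearMap.comp_apply]; rw [← toOrd_simpBd, toSimp_bd])
    (LinearMap.ext fun c => (toOrd_zero_toSimp_zero c).symm) p c

end

noncomputable section

/-! ### Singular chains -/

/-- Singular chains with coefficients in `ℤ/2`. As for ordered chains, the index counts the vertices
of the simplices; the chains with `p = 0` form the degree of the augmentation, since the simplex on
no vertices is empty. -/
abbrev Sing (X : Type*) [TopologicalSpace X] (p : ℕ) : Type _ :=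
  C(stdSimplex ℝ (Fin p), X) →₀ ZMod 2

variable {X Y Z : Type*} [TopologicalSpace X] [TopologicalSpace Y] [TopologicalSpace Z]
variable {V : Type*} [Fintype V]

/-- The affine map of simplices that sends the vertices to the points `w k`. -/
def aff {p : ℕ} (w : Fin p → stdSimplex ℝ V) : C(stdSimplex ℝ (Fin p), stdSimplex ℝ V) where
  toFun t := ⟨∑ k, t k • (w k).1, (convex_stdSimplex ℝ V).sum_mem (fun k _ => t.2.1 k) t.2.2
    fun k _ => (w k).2⟩
  continuous_toFun := by
    refine Continuous.subtype_mk (continuous_finsetSum _ fun k _ => ?_) _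
    exact ((continuous_apply k).comp continuous_subtype_val).smul continuous_const

theorem aff_apply {p : ℕ} (w : Fin p → stdSimplex ℝ V) (t : stdSimplex ℝ (Fin p)) (v : V) :
    aff w t v = ∑ k, t k * w k v := by
  change (∑ k, t k • (w k).1) v = _
  rw [Finset.sum_apply]
  rfl

theorem aff_val {p : ℕ} (w : Fin p → stdSimplex ℝ V) (t : stdSimplex ℝ (Fin p)) :
    (aff w t).1 = ∑ k, t k • (w k).1 := rfl

@[simp] theorem aff_vertex {p : ℕ} (w : Fin p → stdSimplex ℝ V) (k : Fin p) :
    aff w (stdSimplex.vertex k) = w k := by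
  ext v
  rw [aff_apply]
  simp [Pi.single_apply]

theorem aff_aff {p q : ℕ} (w : Fin p → stdSimplex ℝ V) (u : Fin q → stdSimplex ℝ (Fin p)) :
    (aff w).comp (aff u) = aff (aff w ∘ u) := by
  ext t v
  rw [ContinuousMap.comp_apply, aff_apply, aff_apply]
  simp only [aff_apply, Function.comp, Finset.sum_mul, Finset.mul_sum]
  rw [Finset.sum_comm]
  exact Finset.sum_congr rfl fun _ _ => Finset.sum_congr rfl fun _ _ => mul_assoc _ _ _

theorem aff_vertex_eq_id (p : ℕ) :
    aff (fun k : Fin p => (stdSimplex.vertex k : stdSimplex ℝ (Fin p))) = ContinuousMap.id _ := by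
  ext t v
  rw [aff_apply]
  simp [Pi.single_apply]

theorem aff_mem_convexHull {p : ℕ} (w : Fin p → stdSimplex ℝ V) (t : stdSimplex ℝ (Fin p)) :
    (aff w t).1 ∈ convexHull ℝ (Set.range fun k => (w k).1) :=
  (convex_convexHull ℝ _).sum_mem (fun k _ => t.2.1 k) t.2.2
    fun k _ => subset_convexHull ℝ _ ⟨k, rfl⟩

/-- The inclusion of the `i`-th face of a simplex. -/
def face {p : ℕ} (i : Fin (p + 1)) : C(stdSimplex ℝ (Fin p), stdSimplex ℝ (Fin (p + 1))) :=
  aff fun k => stdSimplex.vertex (i.succAbove k)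

theorem aff_comp_face {p : ℕ} (w : Fin (p + 1) → stdSimplex ℝ V) (i : Fin (p + 1)) :
    (aff w).comp (face i) = aff (w ∘ i.succAbove) := by
  rw [face, aff_aff]
  congr 1
  funext k
  simp

/-- The map on singular chains induced by a continuous map. -/
def push (f : C(X, Y)) (p : ℕ) : Sing X p →ₗ[ZMod 2] Sing Y p :=
  Finsupp.lmapDomain (ZMod 2) (ZMod 2) fun σ => f.comp σ

@[simp] theorem push_single (f : C(X, Y)) {p : ℕ} (σ : C(stdSimplex ℝ (Fin p), X)) :
    push f p (Finsupp.single σ 1) = Finsupp.single (f.comp σ) 1 := by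
  simp [push]

/-- The boundary of singular chains. -/
def sbd (p : ℕ) : Sing X (p + 1) →ₗ[ZMod 2] Sing X p :=
  Finsupp.linearCombination (ZMod 2)
    fun σ => ∑ i : Fin (p + 1), Finsupp.single (σ.comp (face i)) 1

@[simp] theorem sbd_single {p : ℕ} (σ : C(stdSimplex ℝ (Fin (p + 1)), X)) :
    sbd p (Finsupp.single σ 1) = ∑ i : Fin (p + 1), Finsupp.single (σ.comp (face i)) 1 := by
  simp [sbd]

theorem push_push (g : C(Y, Z)) (f : C(X, Y)) {p : ℕ} (z : Sing X p) :
    push g p (push f p z) = push (g.comp f) p z := by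
  suffices h : push g p ∘ₗ push f p = push (g.comp f) p from LinearMap.congr_fun h z
  refine linearMap_ext_single fun σ => ?_
  simp [ContinuousMap.comp_assoc]

@[simp] theorem push_id {p : ℕ} (z : Sing X p) : push (ContinuousMap.id X) p z = z := by
  suffices h : push (ContinuousMap.id X) p = LinearMap.id from LinearMap.congr_fun h z
  refine linearMap_ext_single fun σ => ?_
  simp

theorem sbd_push (f : C(X, Y)) {p : ℕ} (z : Sing X (p + 1)) :
    sbd p (push f (p + 1) z) = push f p (sbd p z) := by
  suffices h : sbd p ∘ₗ push f (p + 1) = push f p ∘ₗ sbd p from LinearMap.congr_fun h z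
  refine linearMap_ext_single fun σ => ?_
  simp [map_sum, ContinuousMap.comp_assoc]

theorem push_injective {f : C(X, Y)} (hf : Function.Injective f) (p : ℕ) :
    Function.Injective (push f p) :=
  Finsupp.mapDomain_injective fun _ _ h => ContinuousMap.ext fun t =>
    hf (by simpa using ContinuousMap.congr_fun h t)

/-- The singular chains all of whose simplices lie in `A`. -/
abbrev singOn (A : Set X) (p : ℕ) : Submodule (ZMod 2) (Sing X p) :=
  Finsupp.supported (ZMod 2) (ZMod 2) {σ | ∀ t, σ t ∈ A}

/-- The inclusion of a subspace. -/
def inclMap (A : Set X) : C(A, X) := ⟨Subtype.val, continuous_subtype_val⟩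

theorem push_mem {f : C(X, Y)} {A : Set X} {B : Set Y} (h : ∀ a ∈ A, f a ∈ B) {p : ℕ}
    {z : Sing X p} (hz : z ∈ singOn A p) : push f p z ∈ singOn B p :=
  map_mem_of_mem_supported _ (fun σ hσ => by
    rw [push_single]
    exact single_mem_supported fun t => h _ (hσ t)) hz

theorem push_mem_of_forall {f : C(X, Y)} {B : Set Y} (h : ∀ a, f a ∈ B) {p : ℕ} (z : Sing X p) :
    push f p z ∈ singOn B p := by
  refine push_mem (A := Set.univ) (fun a _ => h a) ?_
  simp [singOn, Finsupp.supported_univ]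

theorem exists_push_inclMap_eq {A : Set X} {p : ℕ} {z : Sing X p} (hz : z ∈ singOn A p) :
    ∃ z' : Sing A p, push (inclMap A) p z' = z := by
  have := map_mem_of_mem_supported LinearMap.id (N := LinearMap.range (push (inclMap A) p))
    (fun σ hσ => ?_) hz
  · exact this
  · refine ⟨Finsupp.single ⟨fun t => ⟨σ t, hσ t⟩, σ.continuous.subtype_mk _⟩ 1, ?_⟩
    rw [push_single]
    rfl

/-- A boundary that can be filled in a subspace is a boundary in that subspace. -/
theorem exists_sbd_eq_of_mem {A : Set X} {p : ℕ} {z : Sing A p} {b : Sing X (p + 1)}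
    (hb : b ∈ singOn A (p + 1)) (h : sbd p b = push (inclMap A) p z) :
    ∃ b' : Sing A (p + 1), sbd p b' = z := by
  obtain ⟨b', rfl⟩ := exists_push_inclMap_eq hb
  exact ⟨b', push_injective (f := inclMap A) Subtype.val_injective p (by rw [← sbd_push, h])⟩

/-! ### Realization of ordered chains -/

/-- The singular chain of an ordered chain, for an assignment of a singular simplex to each
tuple. -/
def realize {α : Type*} (A : ∀ q, (Fin q → α) → C(stdSimplex ℝ (Fin q), X)) (p : ℕ) :
    Ord α p →ₗ[ZMod 2] Sing X p :=
  Finsupp.linearCombination (ZMod 2) fun w => Finsupp.single (A p w) 1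

@[simp] theorem realize_single {α : Type*} (A : ∀ q, (Fin q → α) → C(stdSimplex ℝ (Fin q), X))
    {p : ℕ} (w : Fin p → α) : realize A p (Finsupp.single w 1) = Finsupp.single (A p w) 1 := by
  simp [realize]

theorem sbd_realize {α : Type*} {A : ∀ q, (Fin q → α) → C(stdSimplex ℝ (Fin q), X)}
    (hA : ∀ q (w : Fin (q + 1) → α) (i : Fin (q + 1)),
      (A (q + 1) w).comp (face i) = A q (w ∘ i.succAbove)) {p : ℕ} (c : Ord α (p + 1)) :
    sbd p (realize A (p + 1) c) = realize A p (bd p c) := by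
  suffices h : sbd p ∘ₗ realize A (p + 1) = realize A p ∘ₗ bd p from LinearMap.congr_fun h c
  refine linearMap_ext_single fun w => ?_
  simp [map_sum, hA]

theorem push_realize {α β : Type*} {A : ∀ q, (Fin q → α) → C(stdSimplex ℝ (Fin q), X)}
    {B : ∀ q, (Fin q → β) → C(stdSimplex ℝ (Fin q), Y)} {f : C(X, Y)} {g : α → β}
    (h : ∀ q (w : Fin q → α), f.comp (A q w) = B q (g ∘ w)) {p : ℕ} (c : Ord α p) :
    push f p (realize A p c) = realize B p (ordMap g p c) := by
  suffices h : push f p ∘ₗ realize A p = realize B p ∘ₗ ordMap g p from LinearMap.congr_fun h c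
  refine linearMap_ext_single fun w => ?_
  simp [h]

/-- The singular chain of affine simplices with given vertices. -/
abbrev real (p : ℕ) : Ord (stdSimplex ℝ V) p →ₗ[ZMod 2] Sing (stdSimplex ℝ V) p :=
  realize (fun _ => aff) p

theorem sbd_real {p : ℕ} (c : Ord (stdSimplex ℝ V) (p + 1)) :
    sbd p (real (p + 1) c) = real p (bd p c) :=
  sbd_realize (fun _ => aff_comp_face) c

theorem push_aff_real {p q : ℕ} (w : Fin q → stdSimplex ℝ V) (c : Ord (stdSimplex ℝ (Fin q)) p) :
    push (aff w) p (real p c) = real p (ordMap (aff w) p c) :=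
  push_realize (fun _ u => aff_aff w u) c

/-- The tuple of all vertices of the standard simplex. -/
def fundamental (p : ℕ) : Ord (stdSimplex ℝ (Fin p)) p :=
  Finsupp.single (fun k => stdSimplex.vertex k) 1

theorem push_real_fundamental {p : ℕ} (σ : C(stdSimplex ℝ (Fin p), X)) :
    push σ p (real p (fundamental p)) = Finsupp.single σ 1 := by
  rw [fundamental, realize_single, push_single, aff_vertex_eq_id, ContinuousMap.comp_id]

theorem ordMap_aff_fundamental {p : ℕ} (w : Fin p → stdSimplex ℝ V) :
    ordMap (aff w) p (fundamental p) = Finsupp.single w 1 := by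
  rw [fundamental, ordMap_single]
  congr 1
  funext k
  simp

/-- The operator on singular chains given by a chain of affine simplices in each standard
simplex. -/
def natOp (q : ℕ) (p : ℕ) (θ : Ord (stdSimplex ℝ (Fin p)) q) : Sing X p →ₗ[ZMod 2] Sing X q :=
  Finsupp.linearCombination (ZMod 2) fun σ => push σ q (real q θ)

@[simp] theorem natOp_single {p q : ℕ} (θ : Ord (stdSimplex ℝ (Fin p)) q)
    (σ : C(stdSimplex ℝ (Fin p), X)) :
    natOp q p θ (Finsupp.single σ 1) = push σ q (real q θ) := by
  simp [natOp]

theorem natOp_push {p q : ℕ} (θ : Ord (stdSimplex ℝ (Fin p)) q) (f : C(X, Y)) (z : Sing X p) :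
    natOp q p θ (push f p z) = push f q (natOp q p θ z) := by
  suffices h : natOp q p θ ∘ₗ push f p = push f q ∘ₗ natOp q p θ from LinearMap.congr_fun h z
  refine linearMap_ext_single fun σ => ?_
  simp [push_push]

/-! ### Barycentric subdivision -/

/-- The barycenter of the points of a tuple. -/
def bary {p : ℕ} (w : Fin (p + 1) → stdSimplex ℝ V) : stdSimplex ℝ V :=
  aff w stdSimplex.barycenter

theorem aff_bary {p q : ℕ} (w : Fin q → stdSimplex ℝ V)
    (u : Fin (p + 1) → stdSimplex ℝ (Fin q)) : aff w (bary u) = bary (aff w ∘ u) := by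
  rw [bary, bary, ← aff_aff]
  rfl

/-- Barycentric subdivision of ordered chains of points. -/
def ordSd : ∀ p, Ord (stdSimplex ℝ V) p →ₗ[ZMod 2] Ord (stdSimplex ℝ V) p
  | 0 => LinearMap.id
  | p + 1 => Finsupp.linearCombination (ZMod 2) fun w =>
      cone (bary w) p (ordSd p (bd p (Finsupp.single w 1)))

theorem ordSd_single {p : ℕ} (w : Fin (p + 1) → stdSimplex ℝ V) :
    ordSd (p + 1) (Finsupp.single w 1) =
      cone (bary w) p (ordSd p (bd p (Finsupp.single w 1))) := by
  rw [ordSd, Finsupp.linearCombination_single, one_smul]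

theorem bd_ordSd (p : ℕ) (c : Ord (stdSimplex ℝ V) (p + 1)) :
    bd p (ordSd (p + 1) c) = ordSd p (bd p c) := by
  suffices h : bd p ∘ₗ ordSd (V := V) (p + 1) = ordSd p ∘ₗ bd p from LinearMap.congr_fun h c
  induction p with
  | zero =>
    refine linearMap_ext_single fun w => ?_
    simp only [LinearMap.comp_apply]
    rw [ordSd_single, bd_cone_zero]
  | succ p ih =>
    refine linearMap_ext_single fun w => ?_
    have h := fun c => LinearMap.congr_fun (ih (0 : Ord (stdSimplex ℝ V) (p + 1))) c
    simp only [LinearMap.comp_apply] at h ⊢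
    rw [ordSd_single, bd_cone_succ, h, bd_bd, map_zero, map_zero, add_zero]

theorem ordMap_aff_ordSd {q : ℕ} (w : Fin q → stdSimplex ℝ V) {p : ℕ}
    (c : Ord (stdSimplex ℝ (Fin q)) p) :
    ordMap (aff w) p (ordSd p c) = ordSd p (ordMap (aff w) p c) := by
  suffices h : ordMap (aff w) p ∘ₗ ordSd p = ordSd p ∘ₗ ordMap (aff w) p from
    LinearMap.congr_fun h c
  induction p with
  | zero => rfl
  | succ p ih =>
    refine linearMap_ext_single fun u => ?_
    have h := fun c => LinearMap.congr_fun (ih (0 : Ord (stdSimplex ℝ (Fin q)) p)) c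
    simp only [LinearMap.comp_apply] at h ⊢
    rw [ordSd_single, ordMap_cone, h, ← bd_ordMap, ordMap_single, ordSd_single, aff_bary]

/-- The homotopy between an ordered chain of points and its subdivision. -/
def ordSdHtpy (p : ℕ) : Ord (stdSimplex ℝ V) p →ₗ[ZMod 2] Ord (stdSimplex ℝ V) (p + 1) :=
  coneHtpy (fun _ => LinearMap.id) ordSd (fun _ w => w 0) p

theorem bd_ordSdHtpy {p : ℕ} (c : Ord (stdSimplex ℝ V) (p + 1)) :
    bd (p + 1) (ordSdHtpy (p + 1) c) + ordSdHtpy p (bd p c) = c + ordSd (p + 1) c :=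
  bd_coneHtpy (f := fun _ => LinearMap.id) (g := ordSd) _ (fun _ _ => rfl) bd_ordSd rfl p c

theorem ordMap_aff_ordSdHtpy {q : ℕ} (w : Fin q → stdSimplex ℝ V) {p : ℕ}
    (c : Ord (stdSimplex ℝ (Fin q)) p) :
    ordMap (aff w) (p + 1) (ordSdHtpy p c) = ordSdHtpy p (ordMap (aff w) p c) :=
  ordMap_coneHtpy (aff w) (aff w) (fun _ _ => rfl) (fun _ _ => ordMap_aff_ordSd w _)
    (fun _ _ => rfl) p c

/-- Barycentric subdivision of singular chains. -/
def sd (p : ℕ) : Sing X p →ₗ[ZMod 2] Sing X p := natOp p p (ordSd p (fundamental p))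

/-- The homotopy between a singular chain and its subdivision. -/
def sdHtpy (p : ℕ) : Sing X p →ₗ[ZMod 2] Sing X (p + 1) :=
  natOp (p + 1) p (ordSdHtpy p (fundamental p))

theorem sd_real {p : ℕ} (c : Ord (stdSimplex ℝ V) p) : sd p (real p c) = real p (ordSd p c) := by
  suffices h : sd p ∘ₗ real p = real p ∘ₗ ordSd p from LinearMap.congr_fun h c
  refine linearMap_ext_single fun w => ?_
  simp only [LinearMap.comp_apply, realize_single, sd, natOp_single]
  rw [push_aff_real, ordMap_aff_ordSd, ordMap_aff_fundamental]

theorem sdHtpy_real {p : ℕ} (c : Ord (stdSimplex ℝ V) p) :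
    sdHtpy p (real p c) = real (p + 1) (ordSdHtpy p c) := by
  suffices h : sdHtpy p ∘ₗ real p = real (p + 1) ∘ₗ ordSdHtpy p from LinearMap.congr_fun h c
  refine linearMap_ext_single fun w => ?_
  simp only [LinearMap.comp_apply, realize_single, sdHtpy, natOp_single]
  rw [push_aff_real, ordMap_aff_ordSdHtpy, ordMap_aff_fundamental]

theorem sd_push {p : ℕ} (f : C(X, Y)) (z : Sing X p) : sd p (push f p z) = push f p (sd p z) :=
  natOp_push _ f z

theorem sdHtpy_push {p : ℕ} (f : C(X, Y)) (z : Sing X p) :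
    sdHtpy p (push f p z) = push f (p + 1) (sdHtpy p z) :=
  natOp_push _ f z

theorem sbd_sd {p : ℕ} (z : Sing X (p + 1)) : sbd p (sd (p + 1) z) = sd p (sbd p z) := by
  suffices h : sbd p ∘ₗ sd (X := X) (p + 1) = sd p ∘ₗ sbd p from LinearMap.congr_fun h z
  refine linearMap_ext_single fun σ => ?_
  simp only [LinearMap.comp_apply]
  rw [← push_real_fundamental σ, sd_push, sbd_push, sbd_push, sd_push, sd_real, sbd_real, sbd_real,
    sd_real, bd_ordSd]

theorem sbd_sdHtpy {p : ℕ} (z : Sing X (p + 1)) :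
    sbd (p + 1) (sdHtpy (p + 1) z) + sdHtpy p (sbd p z) = z + sd (p + 1) z := by
  suffices h : sbd (p + 1) ∘ₗ sdHtpy (X := X) (p + 1) + sdHtpy p ∘ₗ sbd p =
    LinearMap.id + sd (p + 1) from LinearMap.congr_fun h z
  refine linearMap_ext_single fun σ => ?_
  simp only [LinearMap.comp_apply, LinearMap.add_apply, LinearMap.id_apply]
  rw [← push_real_fundamental σ, sdHtpy_push, sbd_push, sbd_push, sdHtpy_push, sdHtpy_real,
    sbd_real, sbd_real, sdHtpy_real, sd_push, sd_real, ← map_add, ← map_add, bd_ordSdHtpy, map_add,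
    map_add]

theorem sbd_sbd {p : ℕ} (z : Sing X (p + 2)) : sbd p (sbd (p + 1) z) = 0 := by
  suffices h : sbd p ∘ₗ sbd (X := X) (p + 1) = 0 from LinearMap.congr_fun h z
  refine linearMap_ext_single fun σ => ?_
  simp only [LinearMap.comp_apply, LinearMap.zero_apply]
  rw [← push_real_fundamental σ, sbd_push, sbd_push, sbd_real, sbd_real, bd_bd, map_zero, map_zero]

theorem sbd_iterate_sd {p : ℕ} (N : ℕ) (z : Sing X (p + 1)) :
    sbd p ((sd (p + 1))^[N] z) = (sd p)^[N] (sbd p z) := by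
  induction N with
  | zero => rfl
  | succ N ih => rw [Function.iterate_succ_apply', Function.iterate_succ_apply', sbd_sd, ih]

theorem iterate_sd_push {p : ℕ} (N : ℕ) (f : C(X, Y)) (z : Sing X p) :
    (sd p)^[N] (push f p z) = push f p ((sd p)^[N] z) := by
  induction N with
  | zero => rfl
  | succ N ih => rw [Function.iterate_succ_apply', Function.iterate_succ_apply', ih, sd_push]

theorem iterate_sd_real {p : ℕ} (N : ℕ) (c : Ord (stdSimplex ℝ V) p) :
    (sd p)^[N] (real p c) = real p ((ordSd p)^[N] c) := by
  induction N with
  | zero => rfl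
  | succ N ih => rw [Function.iterate_succ_apply', Function.iterate_succ_apply', ih, sd_real]

/-- A cycle is homologous to its iterated subdivisions. -/
theorem exists_sbd_eq_add_iterate_sd {p : ℕ} {z : Sing X (p + 1)} (hz : sbd p z = 0) (N : ℕ) :
    ∃ b, sbd (p + 1) b = z + (sd (p + 1))^[N] z := by
  induction N with
  | zero => exact ⟨0, by rw [map_zero]; exact (add_self_eq_zero_of_zmod2 _).symm⟩
  | succ N ih =>
    obtain ⟨b, hb⟩ := ih
    refine ⟨b + sdHtpy (p + 1) ((sd (p + 1))^[N] z), ?_⟩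
    have h := sbd_sdHtpy ((sd (p + 1))^[N] z)
    have h0 : (sd p)^[N] (0 : Sing X p) = 0 := iterate_map_zero (sd p) N
    rw [sbd_iterate_sd, hz, h0, map_zero, add_zero] at h
    rw [map_add, hb, h, ← add_assoc, add_add_self_of_zmod2, Function.iterate_succ_apply']

/-! ### Simplices of iterated subdivisions are small -/

theorem dist_le_of_mem_convexHull {E : Type*} [SeminormedAddCommGroup E] [NormedSpace ℝ E]
    {s : Set E} {b x : E} {r : ℝ} (h : ∀ y ∈ s, dist y b ≤ r) (hx : x ∈ convexHull ℝ s) :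
    dist x b ≤ r :=
  convexHull_min (t := Metric.closedBall b r) h (convex_closedBall b r) hx

theorem dist_bary_le {p : ℕ} (w : Fin (p + 1) → stdSimplex ℝ V) {d : ℝ}
    (hd : ∀ i j, dist (w i) (w j) ≤ d) (k : Fin (p + 1)) :
    dist (w k) (bary w) ≤ p / (p + 1) * d := by
  have hb : (bary w).1 = ∑ j, ((p : ℝ) + 1)⁻¹ • (w j).1 := by
    rw [bary, aff_val]
    refine Finset.sum_congr rfl fun j _ => ?_
    congr 1
    change ((Fintype.card (Fin (p + 1)) : ℝ))⁻¹ = _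
    simp
  have hp : (0 : ℝ) < p + 1 := by positivity
  have h1 : (w k).1 - (bary w).1 = ((p : ℝ) + 1)⁻¹ • ∑ j, ((w k).1 - (w j).1) := by
    rw [hb, Finset.sum_sub_distrib, smul_sub, Finset.smul_sum (r := ((p : ℝ) + 1)⁻¹)
      (f := fun j => (w j).1)]
    congr 1
    rw [Finset.sum_const, Finset.card_univ, Fintype.card_fin, ← Nat.cast_smul_eq_nsmul ℝ, smul_smul]
    push_cast
    rw [inv_mul_cancel₀ hp.ne', one_smul]
  have h2 : ‖∑ j, ((w k).1 - (w j).1)‖ ≤ p * d := by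
    rw [Fin.sum_univ_succAbove _ k, sub_self, zero_add]
    refine (norm_sum_le _ _).trans ((Finset.sum_le_card_nsmul _ _ d fun j _ => ?_).trans ?_)
    · rw [← dist_eq_norm]; exact hd _ _
    · simp
  rw [Subtype.dist_eq, dist_eq_norm, h1, norm_smul, norm_inv, Real.norm_of_nonneg hp.le]
  calc ((p : ℝ) + 1)⁻¹ * ‖∑ j, ((w k).1 - (w j).1)‖ ≤ ((p : ℝ) + 1)⁻¹ * (p * d) := by gcongr
    _ = p / (p + 1) * d := by ring

theorem ordSd_single_mem {p : ℕ} (w : Fin p → stdSimplex ℝ V) {d : ℝ} (hd0 : 0 ≤ d)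
    (hd : ∀ i j, dist (w i) (w j) ≤ d) :
    ordSd p (Finsupp.single w 1) ∈ Finsupp.supported (ZMod 2) (ZMod 2)
      {u : Fin p → stdSimplex ℝ V | (∀ i, (u i).1 ∈ convexHull ℝ (Set.range fun k => (w k).1)) ∧
        ∀ i j, dist (u i) (u j) ≤ (p - 1 : ℝ) / p * d} := by
  induction p with
  | zero => exact single_mem_supported ⟨fun i => i.elim0, fun i => i.elim0⟩
  | succ p ih =>
    rw [ordSd_single, bd_single, map_sum, map_sum]
    refine Submodule.sum_mem _ fun i _ => ?_
    refine map_mem_of_mem_supported _ (fun u hu => ?_) (ih (w ∘ i.succAbove) fun _ _ => hd _ _)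
    rw [cone_single]
    refine single_mem_supported ?_
    have hmem : ∀ j, (u j).1 ∈ convexHull ℝ (Set.range fun k => (w k).1) := fun j =>
      convexHull_mono (by rintro _ ⟨k, rfl⟩; exact ⟨_, rfl⟩) (hu.1 j)
    have hcast : ((p + 1 : ℕ) - 1 : ℝ) / (p + 1 : ℕ) * d = p / (p + 1) * d := by push_cast; ring
    have hbd : ∀ j, dist (u j) (bary w) ≤ p / (p + 1) * d := fun j =>
      dist_le_of_mem_convexHull (by rintro _ ⟨k, rfl⟩; exact dist_bary_le w hd k) (hmem j)
    have h0 : (0 : ℝ) ≤ p / (p + 1) * d := by positivity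
    refine ⟨fun j => ?_, fun j k => ?_⟩
    · refine Fin.cases ?_ (fun j => ?_) j
      · exact aff_mem_convexHull w _
      · simpa using hmem j
    · rw [hcast]
      refine Fin.cases ?_ (fun j => ?_) j <;> refine Fin.cases ?_ (fun k => ?_) k
      · simpa using h0
      · simpa [dist_comm] using hbd k
      · simpa using hbd j
      · simp only [Fin.cons_succ]
        refine (hu.2 j k).trans (mul_le_mul_of_nonneg_right ?_ hd0)
        have hp : (0 : ℝ) < p := by exact_mod_cast j.pos
        rw [div_le_div_iff₀ hp (by positivity)]
        nlinarith

theorem iterate_ordSd_single_mem {p : ℕ} (w : Fin p → stdSimplex ℝ V) {d : ℝ} (hd0 : 0 ≤ d)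
    (hd : ∀ i j, dist (w i) (w j) ≤ d) (N : ℕ) :
    (ordSd p)^[N] (Finsupp.single w 1) ∈ Finsupp.supported (ZMod 2) (ZMod 2)
      {u : Fin p → stdSimplex ℝ V | ∀ i j, dist (u i) (u j) ≤ ((p - 1 : ℝ) / p) ^ N * d} := by
  rcases Nat.eq_zero_or_pos p with rfl | hp
  · rw [Finsupp.mem_supported]
    exact fun u _ i => i.elim0
  have hr : (0 : ℝ) ≤ (p - 1 : ℝ) / p := by
    have : (1 : ℝ) ≤ p := by exact_mod_cast hp
    exact div_nonneg (by linarith) (by linarith)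
  induction N with
  | zero => exact single_mem_supported fun i j => by simpa using hd i j
  | succ N ih =>
    rw [Function.iterate_succ_apply']
    refine map_mem_of_mem_supported _ (fun u hu => ?_) ih
    refine Finsupp.supported_mono ?_ (ordSd_single_mem u (by positivity) hu)
    rintro v ⟨-, hv⟩ i j
    refine (hv i j).trans (le_of_eq ?_)
    ring

/-- The singular simplices of diameter less than `δ`. -/
def smallSimplices (X : Type*) [PseudoMetricSpace X] (p : ℕ) (δ : ℝ) :
    Set C(stdSimplex ℝ (Fin p), X) :=
  {σ | ∀ s t, dist (σ s) (σ t) < δ}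

/-- Iterated subdivision makes the simplices of a singular chain arbitrarily small. -/
theorem exists_iterate_sd_mem_small {X : Type*} [PseudoMetricSpace X] {p : ℕ} (z : Sing X p) {δ : ℝ}
    (hδ : 0 < δ) : ∃ N₀, ∀ N ≥ N₀,
      (sd p)^[N] z ∈ Finsupp.supported (ZMod 2) (ZMod 2) (smallSimplices X p δ) := by
  induction z using Finsupp.induction_linear with
  | zero =>
    refine ⟨0, fun N _ => ?_⟩
    have h0 : (sd p)^[N] (0 : Sing X p) = 0 := iterate_map_zero (sd p) N
    rw [h0]
    exact Submodule.zero_mem _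
  | add z₁ z₂ h₁ h₂ =>
    obtain ⟨N₁, h₁⟩ := h₁
    obtain ⟨N₂, h₂⟩ := h₂
    refine ⟨max N₁ N₂, fun N hN => ?_⟩
    have h0 : (sd p)^[N] (z₁ + z₂) = (sd p)^[N] z₁ + (sd p)^[N] z₂ := iterate_map_add (sd p) N _ _
    rw [h0]
    exact Submodule.add_mem _ (h₁ N ((le_max_left _ _).trans hN))
      (h₂ N ((le_max_right _ _).trans hN))
  | single σ a =>
    have hσ : UniformContinuous σ := CompactSpace.uniformContinuous_of_continuous σ.continuous
    obtain ⟨η, hη, hση⟩ := Metric.uniformContinuous_iff.1 hσ δ hδ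
    have hr1 : |(p - 1 : ℝ) / p| < 1 := by
      rcases Nat.eq_zero_or_pos p with rfl | hp
      · simp
      · have : (1 : ℝ) ≤ p := by exact_mod_cast hp
        rw [abs_of_nonneg (div_nonneg (by linarith) (by linarith)), div_lt_one (by linarith)]
        linarith
    have hlim := (tendsto_pow_atTop_nhds_zero_of_abs_lt_one hr1).mul_const (1 : ℝ)
    rw [zero_mul] at hlim
    obtain ⟨N₀, hN₀⟩ := Filter.eventually_atTop.1 (hlim.eventually (gt_mem_nhds hη))
    refine ⟨N₀, fun N hN => ?_⟩
    have hs : Finsupp.single σ a = a • Finsupp.single σ (1 : ZMod 2) := by simp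
    have hsm : (sd p)^[N] (a • Finsupp.single σ (1 : ZMod 2)) =
        a • (sd p)^[N] (Finsupp.single σ (1 : ZMod 2)) := by
      rw [← Module.End.pow_apply, map_smul, Module.End.pow_apply]
    rw [hs, hsm]
    refine Submodule.smul_mem _ _ ?_
    rw [← push_real_fundamental σ, iterate_sd_push, iterate_sd_real, fundamental]
    have hd : ∀ i j : Fin p, dist (stdSimplex.vertex i : stdSimplex ℝ (Fin p))
        (stdSimplex.vertex j) ≤ 1 := fun i j =>
      (Metric.dist_le_diam_of_mem (bounded_stdSimplex _) (single_mem_stdSimplex ℝ i)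
        (single_mem_stdSimplex ℝ j)).trans diam_stdSimplex_le
    refine map_mem_of_mem_supported (push σ p ∘ₗ real p) (fun u hu => ?_)
      (iterate_ordSd_single_mem _ zero_le_one hd N)
    rw [LinearMap.comp_apply, realize_single, push_single]
    refine single_mem_supported fun s t => hση ?_
    refine lt_of_le_of_lt ?_ (hN₀ N hN)
    refine dist_le_of_mem_convexHull ?_ (aff_mem_convexHull u s)
    rintro _ ⟨i, rfl⟩
    rw [dist_comm]
    refine dist_le_of_mem_convexHull ?_ (aff_mem_convexHull u t)
    rintro _ ⟨j, rfl⟩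
    exact hu j i

end

noncomputable section

/-! ### Prisms and homotopy invariance -/

variable {X Y : Type*} [TopologicalSpace X] [TopologicalSpace Y]

/-- The prism operator on ordered chains. -/
def ordPrism {α : Type*} (p : ℕ) : Ord α p →ₗ[ZMod 2] Ord (α × Fin 2) (p + 1) :=
  coneHtpy (fun p => ordMap (fun a => (a, 0)) p) (fun p => ordMap (fun a => (a, 1)) p)
    (fun _ w => (w 0, 0)) p

theorem bd_ordPrism {α : Type*} {p : ℕ} (c : Ord α (p + 1)) :
    bd (p + 1) (ordPrism (p + 1) c) + ordPrism p (bd p c) =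
      ordMap (fun a => (a, 0)) (p + 1) c + ordMap (fun a => (a, 1)) (p + 1) c := by
  refine bd_coneHtpy (f := fun p => ordMap (fun a => (a, (0 : Fin 2))) p)
    (g := fun p => ordMap (fun a => (a, 1)) p) _ (fun _ _ => bd_ordMap _ _)
    (fun _ _ => bd_ordMap _ _) (linearMap_ext_single fun w => ?_) p c
  rw [ordMap_single, ordMap_single]
  congr 1
  exact Subsingleton.elim _ _

theorem ordMap_ordPrism {α β : Type*} (f : α → β) {p : ℕ} (c : Ord α p) :
    ordMap (Prod.map f id) (p + 1) (ordPrism p c) = ordPrism p (ordMap f p c) :=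
  ordMap_coneHtpy f (Prod.map f id)
    (fun _ _ => by rw [ordMap_ordMap, ordMap_ordMap]; rfl)
    (fun _ _ => by rw [ordMap_ordMap, ordMap_ordMap]; rfl) (fun _ _ => rfl) p c

/-- The affine simplex with given vertices in the product of a simplex and an interval. -/
def prismSimplex {p q : ℕ} (u : Fin q → Fin p × Fin 2) :
    C(stdSimplex ℝ (Fin q), stdSimplex ℝ (Fin p) × stdSimplex ℝ (Fin 2)) :=
  (aff fun k => stdSimplex.vertex (u k).1).prodMk (aff fun k => stdSimplex.vertex (u k).2)

theorem prismSimplex_comp_face {p q : ℕ} (u : Fin (q + 1) → Fin p × Fin 2) (i : Fin (q + 1)) :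
    (prismSimplex u).comp (face i) = prismSimplex (u ∘ i.succAbove) := by
  have h1 := aff_comp_face
    (fun k => (stdSimplex.vertex (u k).1 : stdSimplex ℝ (Fin p))) i
  have h2 := aff_comp_face
    (fun k => (stdSimplex.vertex (u k).2 : stdSimplex ℝ (Fin 2))) i
  refine ContinuousMap.ext fun t => Prod.ext ?_ ?_
  · exact ContinuousMap.congr_fun h1 t
  · exact ContinuousMap.congr_fun h2 t

theorem face_comp_prismSimplex {p q : ℕ} (i : Fin (p + 1)) (u : Fin q → Fin p × Fin 2) :
    ((face i).prodMap (ContinuousMap.id (stdSimplex ℝ (Fin 2)))).comp (prismSimplex u) =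
      prismSimplex (Prod.map i.succAbove id ∘ u) := by
  have h1 := aff_aff (fun k => (stdSimplex.vertex (i.succAbove k) : stdSimplex ℝ (Fin (p + 1))))
    (fun k => (stdSimplex.vertex (u k).1 : stdSimplex ℝ (Fin p)))
  refine ContinuousMap.ext fun t => Prod.ext ?_ rfl
  refine (ContinuousMap.congr_fun h1 t).trans ?_
  change aff _ t = aff _ t
  congr 2
  funext k
  simp

/-- A homotopy of each singular simplex of `X`, with values in `Y`, compatible with the passage to
faces. It need not come from a homotopy of maps `X → Y`. -/
structure SimplexHomotopy (X Y : Type*) [TopologicalSpace X] [TopologicalSpace Y] where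
  /-- The homotopy of a simplex. -/
  toFun : ∀ p, C(stdSimplex ℝ (Fin p), X) →
    C(stdSimplex ℝ (Fin p) × stdSimplex ℝ (Fin 2), Y)
  comp_face : ∀ p (σ : C(stdSimplex ℝ (Fin (p + 1)), X)) (i : Fin (p + 1)),
    toFun p (σ.comp (face i)) = (toFun (p + 1) σ).comp ((face i).prodMap (ContinuousMap.id _))

/-- The singular chain map at an end of a homotopy of simplices. -/
def SimplexHomotopy.endMap (h : SimplexHomotopy X Y) (ε : Fin 2) (p : ℕ) :
    Sing X p →ₗ[ZMod 2] Sing Y p :=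
  Finsupp.linearCombination (ZMod 2) fun σ => Finsupp.single
    ((h.toFun p σ).comp ((ContinuousMap.id _).prodMk (.const _ (stdSimplex.vertex ε)))) 1

@[simp] theorem SimplexHomotopy.endMap_single (h : SimplexHomotopy X Y) (ε : Fin 2) {p : ℕ}
    (σ : C(stdSimplex ℝ (Fin p), X)) : h.endMap ε p (Finsupp.single σ 1) = Finsupp.single
      ((h.toFun p σ).comp ((ContinuousMap.id _).prodMk (.const _ (stdSimplex.vertex ε)))) 1 := by
  simp [endMap]

/-- The prism operator of a homotopy of simplices. -/
def SimplexHomotopy.prism (h : SimplexHomotopy X Y) (p : ℕ) : Sing X p →ₗ[ZMod 2] Sing Y (p + 1) :=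
  Finsupp.linearCombination (ZMod 2) fun σ => push (h.toFun p σ) (p + 1)
    (realize (fun _ => prismSimplex) (p + 1) (ordPrism p (Finsupp.single id 1)))

theorem SimplexHomotopy.prism_single (h : SimplexHomotopy X Y) {p : ℕ}
    (σ : C(stdSimplex ℝ (Fin p), X)) : h.prism p (Finsupp.single σ 1) =
      push (h.toFun p σ) (p + 1)
        (realize (fun _ => prismSimplex) (p + 1) (ordPrism p (Finsupp.single id 1))) := by
  simp [prism]

theorem prismSimplex_pair {p : ℕ} (ε : Fin 2) :
    prismSimplex (fun k : Fin p => (k, ε)) =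
      (ContinuousMap.id _).prodMk (.const _ (stdSimplex.vertex ε)) := by
  refine ContinuousMap.ext fun t => Prod.ext ?_ ?_
  · exact ContinuousMap.congr_fun (aff_vertex_eq_id p) t
  · change aff (fun _ => stdSimplex.vertex ε) t = stdSimplex.vertex ε
    refine stdSimplex.ext (funext fun v => ?_)
    rw [aff_apply, ← Finset.sum_mul, stdSimplex.sum_eq_one, one_mul]

theorem SimplexHomotopy.sbd_prism (h : SimplexHomotopy X Y) {p : ℕ} (z : Sing X (p + 1)) :
    sbd (p + 1) (h.prism (p + 1) z) + h.prism p (sbd p z) =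
      h.endMap 0 (p + 1) z + h.endMap 1 (p + 1) z := by
  suffices h : sbd (p + 1) ∘ₗ h.prism (p + 1) + h.prism p ∘ₗ sbd p =
    h.endMap 0 (p + 1) + h.endMap 1 (p + 1) from LinearMap.congr_fun h z
  refine linearMap_ext_single fun σ => ?_
  simp only [LinearMap.comp_apply, LinearMap.add_apply, endMap_single]
  have h1 : h.prism p (sbd p (Finsupp.single σ 1)) = push (h.toFun (p + 1) σ) (p + 1)
      (realize (fun _ => prismSimplex) (p + 1) (ordPrism p (bd p (Finsupp.single id 1)))) := by
    rw [sbd_single, bd_single, map_sum, map_sum, map_sum, map_sum]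
    refine Finset.sum_congr rfl fun i _ => ?_
    have hi : ordPrism p (Finsupp.single (id ∘ i.succAbove) 1) =
        ordMap (Prod.map i.succAbove id) (p + 1) (ordPrism p (Finsupp.single id 1)) := by
      rw [ordMap_ordPrism, ordMap_single]; rfl
    rw [prism_single, h.comp_face, hi, ← push_push]
    congr 1
    exact push_realize (fun _ u => face_comp_prismSimplex i u) _
  rw [h1, prism_single, sbd_push, sbd_realize (fun _ => prismSimplex_comp_face), ← map_add,
    ← map_add, bd_ordPrism, map_add, map_add, ordMap_single, ordMap_single, realize_single,
    realize_single, push_single, push_single, ← prismSimplex_pair, ← prismSimplex_pair]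
  rfl

theorem SimplexHomotopy.prism_mem (h : SimplexHomotopy X Y) {p : ℕ} {z : Sing X p} {B : Set Y}
    {A : Set C(stdSimplex ℝ (Fin p), X)} (hz : z ∈ Finsupp.supported (ZMod 2) (ZMod 2) A)
    (hA : ∀ σ ∈ A, ∀ x, h.toFun p σ x ∈ B) : h.prism p z ∈ singOn B (p + 1) :=
  map_mem_of_mem_supported _ (fun σ hσ => by
    rw [prism_single]
    exact push_mem_of_forall (hA σ hσ) _) hz

/-- Homotopic maps send a cycle to homologous cycles. -/
theorem exists_sbd_eq_of_homotopy {f g : C(X, Y)} (H : ContinuousMap.Homotopy f g) {p : ℕ}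
    {z : Sing X (p + 1)} (hz : sbd p z = 0) :
    ∃ b, sbd (p + 1) b = push f (p + 1) z + push g (p + 1) z := by
  let h : SimplexHomotopy X Y :=
    { toFun := fun p σ =>
        ⟨fun x => H (stdSimplexHomeomorphUnitInterval x.2, σ x.1), by fun_prop⟩
      comp_face := fun p σ i => rfl }
  have h0 : h.endMap 0 (p + 1) = push f (p + 1) := linearMap_ext_single fun σ => by
    rw [h.endMap_single, push_single]
    congr 1
    refine ContinuousMap.ext fun t => ?_
    change H (stdSimplexHomeomorphUnitInterval (stdSimplex.vertex 0), σ t) = f (σ t)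
    rw [stdSimplexHomeomorphUnitInterval_zero, H.apply_zero]
  have h1 : h.endMap 1 (p + 1) = push g (p + 1) := linearMap_ext_single fun σ => by
    rw [h.endMap_single, push_single]
    congr 1
    refine ContinuousMap.ext fun t => ?_
    change H (stdSimplexHomeomorphUnitInterval (stdSimplex.vertex 1), σ t) = g (σ t)
    rw [stdSimplexHomeomorphUnitInterval_one, H.apply_one]
  refine ⟨h.prism (p + 1) z, ?_⟩
  have := h.sbd_prism z
  rwa [hz, map_zero, add_zero, h0, h1] at this

/-- If `f` is homotopic to `g` and `g` kills a cycle up to boundary, so does `f`. -/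
theorem exists_sbd_eq_push_of_homotopy {f g : C(X, Y)} (H : ContinuousMap.Homotopy f g) {p : ℕ}
    {z : Sing X (p + 1)} (hz : sbd p z = 0) (hg : ∃ b, sbd (p + 1) b = push g (p + 1) z) :
    ∃ b, sbd (p + 1) b = push f (p + 1) z := by
  obtain ⟨b, hb⟩ := exists_sbd_eq_of_homotopy H hz
  obtain ⟨b', hb'⟩ := hg
  exact ⟨b + b', by rw [map_add, hb, hb', add_add_self_of_zmod2]⟩

/-- The image of a `1`-chain under a constant map is a boundary. -/
theorem exists_sbd_eq_push_const (y : Y) (z : Sing X 2) :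
    ∃ b, sbd 2 b = push (ContinuousMap.const X y) 2 z := by
  -- the constant simplex with three vertices has three equal faces, an odd number
  have key : push (ContinuousMap.const X y) 2 =
      sbd 2 ∘ₗ Finsupp.linearCombination (ZMod 2)
        (fun _ : C(stdSimplex ℝ (Fin 2), X) => Finsupp.single
          (ContinuousMap.const (stdSimplex ℝ (Fin 3)) y) (1 : ZMod 2)) :=
    linearMap_ext_single fun σ => by
      rw [push_single, LinearMap.comp_apply, Finsupp.linearCombination_single, one_smul, sbd_single]
      have hc : ∀ i : Fin (2 + 1), (ContinuousMap.const (stdSimplex ℝ (Fin 3)) y).comp (face i) =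
        ContinuousMap.const (stdSimplex ℝ (Fin 2)) y := fun i => rfl
      simp only [hc]
      rw [Finset.sum_const, Finset.card_univ, Fintype.card_fin, succ_nsmul, two_nsmul,
        add_self_eq_zero_of_zmod2, zero_add]
      rfl
  exact ⟨_, (LinearMap.congr_fun key z).symm⟩

theorem exists_sbd_eq_push_comp (g : C(X, Y)) {p : ℕ} {z : Sing X p}
    (h : ∃ b, sbd p b = z) : ∃ b, sbd p b = push g p z := by
  obtain ⟨b, rfl⟩ := h
  exact ⟨push g (p + 1) b, sbd_push g b⟩

end

noncomputable section

/-! ### Carriers of families of faces -/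

variable {V : Type*}

/-- The family of faces is closed under passage to nonempty subsets. -/
def DownClosed (F : Set (Finset V)) : Prop := ∀ s ∈ F, ∀ t ⊆ s, t.Nonempty → t ∈ F

/-- Ordered chains of tuples whose entries lie in a common face of `F`. -/
abbrev ordFaces (F : Set (Finset V)) (p : ℕ) : Submodule (ZMod 2) (Ord V p) :=
  Finsupp.supported (ZMod 2) (ZMod 2) {w | ∃ s ∈ F, ∀ i, w i ∈ s}

/-- Simplicial chains of the faces of `F` with `p` vertices. -/
abbrev simpFaces (F : Set (Finset V)) (p : ℕ) : Submodule (ZMod 2) (Simp V) :=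
  Finsupp.supported (ZMod 2) (ZMod 2) {s | s ∈ F ∧ s.card = p}

theorem ordOn_le_ordFaces {F : Set (Finset V)} {s : Finset V} (hs : s ∈ F) (p : ℕ) :
    ordOn (s : Set V) p ≤ ordFaces F p :=
  Finsupp.supported_mono fun _ hw => ⟨s, hs, hw⟩

theorem toSimp_mem [DecidableEq V] {F : Set (Finset V)} (hF : DownClosed F) {p : ℕ}
    {c : Ord V (p + 1)} (hc : c ∈ ordFaces F (p + 1)) :
    toSimp (p + 1) c ∈ simpFaces F (p + 1) :=
  map_mem_of_mem_supported _ (fun w hw => by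
    obtain ⟨s, hs, hw⟩ := hw
    rw [toSimp_single]
    split_ifs with h
    · refine single_mem_supported ⟨hF s hs _ ?_ ?_, h⟩
      · intro x hx
        obtain ⟨i, -, rfl⟩ := Finset.mem_image.1 hx
        exact hw i
      · exact Finset.univ_nonempty.image _
    · exact Submodule.zero_mem _) hc

theorem toOrd_mem [LinearOrder V] {F : Set (Finset V)} {p : ℕ}
    {f : Simp V} (hf : f ∈ simpFaces F p) : toOrd p f ∈ ordFaces F p :=
  map_mem_of_mem_supported _ (fun s hsp => by
    obtain ⟨hs, hp⟩ := hsp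
    rw [toOrd_single s hp]
    exact single_mem_supported ⟨s, hs, fun i => Finset.orderEmbOfFin_mem s hp i⟩) hf

theorem toOrd_toSimp_mem [LinearOrder V] {A : Set V} {p : ℕ} (w : Fin p → V) (hw : ∀ i, w i ∈ A) :
    toOrd p (toSimp p (Finsupp.single w 1)) ∈ ordOn A p := by
  rw [toSimp_single]
  split_ifs with h
  · rw [toOrd_single _ h]
    refine single_mem_supported fun i => ?_
    obtain ⟨k, -, hk⟩ := Finset.mem_image.1 (Finset.orderEmbOfFin_mem _ h i)
    rw [← hk]
    exact hw k
  · simp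

theorem sortHtpy_mem [LinearOrder V] {F : Set (Finset V)} {p : ℕ} {c : Ord V p}
    (hc : c ∈ ordFaces F p) : sortHtpy p c ∈ ordFaces F (p + 1) :=
  map_mem_of_mem_supported _ (fun w hw => by
    obtain ⟨s, hs, hw⟩ := hw
    refine ordOn_le_ordFaces hs _ (coneHtpy_mem (A := (s : Set V)) (B := (s : Set V))
      (fun p w hw => single_mem_supported (A := {w : Fin p → V | ∀ i, w i ∈ (s : Set V)}) hw)
      (fun _ w hw => toOrd_toSimp_mem w hw)
      (fun _ w hw => hw 0)
      (single_mem_supported (A := {w : Fin p → V | ∀ i, w i ∈ (s : Set V)}) hw))) hc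

theorem simpBd_single_ne_zero [DecidableEq V] {s : Finset V} (hs : s.Nonempty) :
    simpBd (Finsupp.single s (1 : ZMod 2)) ≠ 0 := by
  obtain ⟨x, hx⟩ := hs
  intro h
  have h1 := DFunLike.congr_fun h (s.erase x)
  rw [simpBd_single, Finsupp.finsetSum_apply, Finset.sum_eq_single x] at h1
  · simp at h1
  · intro y hy hyx
    rw [Finsupp.single_apply, if_neg]
    intro he
    have : y ∈ s.erase x := Finset.mem_erase.2 ⟨hyx, hy⟩
    rw [← he] at this
    simp at this
  · exact fun h => (h hx).elim

variable [Fintype V]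

theorem mem_supp {x : V → ℝ} {i : V} : i ∈ supp x ↔ x i ≠ 0 := by
  simp [supp]

theorem supp_nonempty (x : stdSimplex ℝ V) : (supp x.1).Nonempty := by
  by_contra h
  have h0 : ∀ i, x.1 i = 0 := fun i => by
    by_contra hi
    exact h ⟨i, mem_supp.2 hi⟩
  have := x.2.2
  simp [h0] at this

theorem pos_of_mem_supp {x : stdSimplex ℝ V} {i : V} (h : i ∈ supp x.1) : 0 < x i :=
  lt_of_le_of_ne (x.2.1 i) (Ne.symm (mem_supp.1 h))

/-- The points of the standard simplex that are carried by a face in `F`. -/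
def carrier (F : Set (Finset V)) : Set (stdSimplex ℝ V) := {x | supp x.1 ∈ F}

/-! ### Approximation of singular chains by simplicial chains -/

/-- The realization of ordered chains of vertices. -/
abbrev realV [DecidableEq V] (p : ℕ) : Ord V p →ₗ[ZMod 2] Sing (stdSimplex ℝ V) p :=
  realize (fun _ w => aff fun k => stdSimplex.vertex (w k)) p

theorem sbd_realV [DecidableEq V] {p : ℕ} (c : Ord V (p + 1)) :
    sbd p (realV (p + 1) c) = realV p (bd p c) :=
  sbd_realize (A := fun _ w => aff fun k => stdSimplex.vertex (w k))
    (fun _ w i => aff_comp_face (fun k => stdSimplex.vertex (w k)) i) c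

theorem supp_aff_subset [DecidableEq V] {p : ℕ} {w : Fin p → V} {s : Finset V}
    (hw : ∀ k, w k ∈ s) (t : stdSimplex ℝ (Fin p)) :
    supp (aff (fun k => stdSimplex.vertex (w k)) t).1 ⊆ s := by
  intro i hi
  by_contra his
  refine mem_supp.1 hi ?_
  change aff (fun k => stdSimplex.vertex (w k)) t i = 0
  rw [aff_apply]
  refine Finset.sum_eq_zero fun k _ => ?_
  have : w k ≠ i := fun h => his (h ▸ hw k)
  simp [Pi.single_eq_of_ne this.symm]

theorem realV_mem [DecidableEq V] {F : Set (Finset V)} (hF : DownClosed F) {p : ℕ} {c : Ord V p}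
    (hc : c ∈ ordFaces F p) : realV p c ∈ singOn (carrier F) p :=
  map_mem_of_mem_supported _ (fun w hw => by
    obtain ⟨s, hs, hw⟩ := hw
    rw [realize_single]
    exact single_mem_supported fun t => hF s hs _ (supp_aff_subset hw t) (supp_nonempty _)) hc

/-- A choice `j` of a vertex for each point of the simplex turns singular chains into ordered
chains: only the vertices of the singular simplices are remembered. -/
def approx (j : stdSimplex ℝ V → V) (p : ℕ) : Sing (stdSimplex ℝ V) p →ₗ[ZMod 2] Ord V p :=
  Finsupp.linearCombination (ZMod 2) fun σ =>
    Finsupp.single (fun k => j (σ (stdSimplex.vertex k))) 1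

@[simp] theorem approx_single (j : stdSimplex ℝ V → V) {p : ℕ}
    (σ : C(stdSimplex ℝ (Fin p), stdSimplex ℝ V)) :
    approx j p (Finsupp.single σ 1) =
      Finsupp.single (fun k => j (σ (stdSimplex.vertex k))) 1 := by
  simp [approx]

theorem face_vertex {p : ℕ} (i : Fin (p + 1)) (k : Fin p) :
    face i (stdSimplex.vertex k) = stdSimplex.vertex (i.succAbove k) :=
  aff_vertex _ k

theorem bd_approx (j : stdSimplex ℝ V → V) {p : ℕ} (z : Sing (stdSimplex ℝ V) (p + 1)) :
    bd p (approx j (p + 1) z) = approx j p (sbd p z) := by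
  suffices h : bd p ∘ₗ approx j (p + 1) = approx j p ∘ₗ sbd p from LinearMap.congr_fun h z
  refine linearMap_ext_single fun σ => ?_
  simp only [LinearMap.comp_apply, approx_single, bd_single, sbd_single, map_sum,
    ContinuousMap.comp_apply, face_vertex]
  rfl

/-- The segment joining two points of the simplex. -/
def segmentPoint (x y : stdSimplex ℝ V) (s : stdSimplex ℝ (Fin 2)) : stdSimplex ℝ V :=
  ⟨s 0 • x.1 + s 1 • y.1, (convex_stdSimplex ℝ V) x.2 y.2 (s.2.1 0) (s.2.1 1)
    (stdSimplex.add_eq_one s)⟩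

/-- The straight-line homotopy from a singular simplex to its approximation. -/
def approxHtpy [DecidableEq V] (j : stdSimplex ℝ V → V) :
    SimplexHomotopy (stdSimplex ℝ V) (stdSimplex ℝ V) where
  toFun p σ :=
    { toFun := fun x => segmentPoint (σ x.1)
        (aff (fun k => stdSimplex.vertex (j (σ (stdSimplex.vertex k)))) x.1) x.2
      continuous_toFun := by
        have h : ∀ i : Fin 2, Continuous fun x : stdSimplex ℝ (Fin p) × stdSimplex ℝ (Fin 2) =>
            x.2 i := fun i =>
          (continuous_apply i).comp (continuous_subtype_val.comp continuous_snd)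
        refine Continuous.subtype_mk (((h 0).smul ?_).add ((h 1).smul ?_)) _
        · exact continuous_subtype_val.comp (σ.continuous.comp continuous_fst)
        · exact continuous_subtype_val.comp ((ContinuousMap.continuous _).comp continuous_fst) }
  comp_face p σ i := by
    refine ContinuousMap.ext fun x => ?_
    have h := ContinuousMap.congr_fun (aff_comp_face (V := V)
      (fun k => stdSimplex.vertex (j (σ (stdSimplex.vertex k)))) i) x.1
    change segmentPoint (σ (face i x.1))
      (aff (fun k => stdSimplex.vertex (j (σ (face i (stdSimplex.vertex k))))) x.1) x.2 =
      segmentPoint (σ (face i x.1)) (aff _ (face i x.1)) x.2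
    rw [ContinuousMap.comp_apply] at h
    rw [h]
    simp only [face_vertex]
    rfl

theorem approxHtpy_zero [DecidableEq V] (j : stdSimplex ℝ V → V) (p : ℕ) :
    (approxHtpy j).endMap 0 p = LinearMap.id :=
  linearMap_ext_single fun σ => by
    rw [SimplexHomotopy.endMap_single, LinearMap.id_apply]
    congr 1
    refine ContinuousMap.ext fun t => Subtype.ext ?_
    change (stdSimplex.vertex (S := ℝ) (0 : Fin 2)) 0 • (σ t).1 +
      (stdSimplex.vertex (S := ℝ) (0 : Fin 2)) 1 • _ = (σ t).1
    simp

theorem approxHtpy_one [DecidableEq V] (j : stdSimplex ℝ V → V) (p : ℕ) :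
    (approxHtpy j).endMap 1 p = realV p ∘ₗ approx j p :=
  linearMap_ext_single fun σ => by
    rw [SimplexHomotopy.endMap_single, LinearMap.comp_apply, approx_single, realize_single]
    congr 1
    refine ContinuousMap.ext fun t => Subtype.ext ?_
    change (stdSimplex.vertex (S := ℝ) (1 : Fin 2)) 0 • (σ t).1 +
      (stdSimplex.vertex (S := ℝ) (1 : Fin 2)) 1 •
        (aff (fun k => stdSimplex.vertex (j (σ (stdSimplex.vertex k)))) t).1 = _
    simp

/-- The singular simplices all of whose points contain the chosen vertices in their support. -/
def adapted (j : stdSimplex ℝ V → V) (p : ℕ) : Set C(stdSimplex ℝ (Fin p), stdSimplex ℝ V) :=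
  {σ | ∀ k t, j (σ (stdSimplex.vertex k)) ∈ supp (σ t).1}

theorem mem_adapted_of_small {j : stdSimplex ℝ V → V} {δ : ℝ} (hj : ∀ x : stdSimplex ℝ V, δ ≤ x (j x)) {p : ℕ}
    {σ : C(stdSimplex ℝ (Fin p), stdSimplex ℝ V)}
    (hσ : σ ∈ smallSimplices (stdSimplex ℝ V) p δ) : σ ∈ adapted j p := by
  intro k t
  refine mem_supp.2 fun h0 => ?_
  have h1 := hσ (stdSimplex.vertex k) t
  have h2 := dist_le_pi_dist (σ (stdSimplex.vertex k)).1 (σ t).1 (j (σ (stdSimplex.vertex k)))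
  rw [h0, Real.dist_eq, sub_zero] at h2
  have h3 := hj (σ (stdSimplex.vertex k))
  have h4 := le_abs_self ((σ (stdSimplex.vertex k)).1 (j (σ (stdSimplex.vertex k))))
  rw [Subtype.dist_eq] at h1
  change δ ≤ (σ (stdSimplex.vertex k)).1 (j (σ (stdSimplex.vertex k))) at h3
  linarith

theorem approx_mem {F : Set (Finset V)} {j : stdSimplex ℝ V → V} {p : ℕ}
    {z : Sing (stdSimplex ℝ V) (p + 1)} (hz : z ∈ singOn (carrier F) (p + 1))
    (hj : z ∈ Finsupp.supported (ZMod 2) (ZMod 2) (adapted j (p + 1))) :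
    approx j (p + 1) z ∈ ordFaces F (p + 1) := by
  refine map_mem_of_mem_supported _
    (A := {σ | ∀ t, σ t ∈ carrier F} ∩ adapted j (p + 1)) (fun σ hσ => ?_) ?_
  · rw [approx_single]
    exact single_mem_supported ⟨_, hσ.1 (stdSimplex.vertex 0), fun k => hσ.2 k _⟩
  · rw [Finsupp.supported_inter]; exact ⟨hz, hj⟩

theorem supp_segmentPoint_subset {x y : stdSimplex ℝ V} {s : Finset V} (hx : supp x.1 ⊆ s)
    (hy : supp y.1 ⊆ s) (τ : stdSimplex ℝ (Fin 2)) : supp (segmentPoint x y τ).1 ⊆ s := by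
  intro i hi
  by_contra his
  have hx' : x.1 i = 0 := by
    by_contra h; exact his (hx (mem_supp.2 h))
  have hy' : y.1 i = 0 := by
    by_contra h; exact his (hy (mem_supp.2 h))
  refine mem_supp.1 hi ?_
  change τ 0 * x.1 i + τ 1 * y.1 i = 0
  rw [hx', hy', mul_zero, mul_zero, add_zero]

/-- An adapted cycle in a subset `A` of the carrier, all of whose straight-line homotopies stay in
`A`, is homologous in `A` to its approximation. -/
theorem exists_sbd_eq_add_approx [DecidableEq V] {j : stdSimplex ℝ V → V} {A : Set (stdSimplex ℝ V)}
    {p : ℕ} {z : Sing (stdSimplex ℝ V) (p + 1)} (hz : sbd p z = 0)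
    {B : Set C(stdSimplex ℝ (Fin (p + 1)), stdSimplex ℝ V)}
    (hB : z ∈ Finsupp.supported (ZMod 2) (ZMod 2) B)
    (hA : ∀ σ ∈ B, ∀ t τ, segmentPoint (σ t)
      (aff (fun k => stdSimplex.vertex (j (σ (stdSimplex.vertex k)))) t) τ ∈ A) :
    ∃ b ∈ singOn A (p + 2), sbd (p + 1) b = z + realV (p + 1) (approx j (p + 1) z) := by
  refine ⟨(approxHtpy j).prism (p + 1) z,
    (approxHtpy j).prism_mem hB fun σ hσ x => hA σ hσ x.1 x.2, ?_⟩
  have := (approxHtpy j).sbd_prism z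
  rwa [hz, map_zero, add_zero, approxHtpy_zero, approxHtpy_one] at this

theorem iterate_sd_mem {X : Type*} [TopologicalSpace X] {A : Set X} {p : ℕ} {z : Sing X p}
    (hz : z ∈ singOn A p) (N : ℕ) : (sd p)^[N] z ∈ singOn A p := by
  obtain ⟨z, rfl⟩ := exists_push_inclMap_eq hz
  rw [iterate_sd_push]
  exact push_mem_of_forall (fun a => a.2) _

theorem exists_mem_sbd_eq_add_iterate_sd {X : Type*} [TopologicalSpace X] {A : Set X} {p : ℕ}
    {z : Sing X (p + 1)} (hz : z ∈ singOn A (p + 1)) (hz0 : sbd p z = 0) (N : ℕ) :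
    ∃ b ∈ singOn A (p + 2), sbd (p + 1) b = z + (sd (p + 1))^[N] z := by
  obtain ⟨z, rfl⟩ := exists_push_inclMap_eq hz
  have hz0' : sbd p z = 0 := push_injective (f := inclMap A) Subtype.val_injective p
    (by rw [← sbd_push, hz0, map_zero])
  obtain ⟨b, hb⟩ := exists_sbd_eq_add_iterate_sd hz0' N
  exact ⟨push (inclMap A) _ b, push_mem_of_forall (fun a => a.2) _,
    by rw [sbd_push, hb, map_add, iterate_sd_push]⟩

theorem exists_le_apply (x : stdSimplex ℝ V) : ∃ i, (1 : ℝ) / Fintype.card V ≤ x i := by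
  by_contra! h
  have hne : (Finset.univ : Finset V).Nonempty := (supp_nonempty x).mono (Finset.subset_univ _)
  have h1 := Finset.sum_lt_sum_of_nonempty hne fun i _ => h i
  rw [stdSimplex.sum_eq_one, Finset.sum_const, nsmul_eq_mul, Finset.card_univ] at h1
  have : (Fintype.card V : ℝ) ≠ 0 := by
    have := Finset.card_pos.2 hne
    rw [Finset.card_univ] at this
    positivity
  rw [mul_one_div_cancel this] at h1
  exact lt_irrefl _ h1

theorem card_pos_of_stdSimplex (x : stdSimplex ℝ V) : 0 < (Fintype.card V : ℝ) := by
  obtain ⟨i, -⟩ := supp_nonempty x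
  exact_mod_cast Fintype.card_pos_iff.2 ⟨i⟩

/-- A vertex at which a barycentric coordinate is maximal. -/
def maxVertex (x : stdSimplex ℝ V) : V := (exists_le_apply x).choose

theorem le_maxVertex (x : stdSimplex ℝ V) : (1 : ℝ) / Fintype.card V ≤ x (maxVertex x) :=
  (exists_le_apply x).choose_spec

theorem maxVertex_mem_supp (x : stdSimplex ℝ V) : maxVertex x ∈ supp x.1 :=
  mem_supp.2 ((one_div_pos.2 (card_pos_of_stdSimplex x)).trans_le (le_maxVertex x)).ne'

theorem isEmpty_or_pos (V : Type*) [Fintype V] :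
    IsEmpty (stdSimplex ℝ V) ∨ (0 : ℝ) < 1 / Fintype.card V := by
  rcases isEmpty_or_nonempty (stdSimplex ℝ V) with h | ⟨⟨x⟩⟩
  · exact Or.inl h
  · exact Or.inr (one_div_pos.2 (card_pos_of_stdSimplex x))

theorem exists_iterate_sd_adapted {p : ℕ} {j : stdSimplex ℝ V → V} {δ : ℝ} (hδ : 0 < δ)
    (hj : ∀ x : stdSimplex ℝ V, δ ≤ x (j x)) (z : Sing (stdSimplex ℝ V) p) :
    ∃ N₀, ∀ N ≥ N₀, (sd p)^[N] z ∈ Finsupp.supported (ZMod 2) (ZMod 2) (adapted j p) := by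
  obtain ⟨N₀, h⟩ := exists_iterate_sd_mem_small z hδ
  exact ⟨N₀, fun N hN => Finsupp.supported_mono (fun σ hσ => mem_adapted_of_small hj hσ) (h N hN)⟩

theorem exists_iterate_sd_adapted_maxVertex {p : ℕ} (z : Sing (stdSimplex ℝ V) p) :
    ∃ N₀, ∀ N ≥ N₀,
      (sd p)^[N] z ∈ Finsupp.supported (ZMod 2) (ZMod 2) (adapted (V := V) maxVertex p) := by
  rcases isEmpty_or_pos V with h | h
  · refine ⟨0, fun N _ => ?_⟩
    rw [Finsupp.mem_supported]
    exact fun σ _ k t => (h.false (σ t)).elim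
  · exact exists_iterate_sd_adapted h le_maxVertex z

theorem segmentPoint_mem_carrier [DecidableEq V] {F : Set (Finset V)} (hF : DownClosed F)
    {j : stdSimplex ℝ V → V} {p : ℕ} {σ : C(stdSimplex ℝ (Fin p), stdSimplex ℝ V)}
    (h1 : ∀ t, σ t ∈ carrier F) (h2 : σ ∈ adapted j p) (t : stdSimplex ℝ (Fin p))
    (τ : stdSimplex ℝ (Fin 2)) : segmentPoint (σ t)
      (aff (fun k => stdSimplex.vertex (j (σ (stdSimplex.vertex k)))) t) τ ∈ carrier F :=
  hF _ (h1 t) _ (supp_segmentPoint_subset subset_rfl (supp_aff_subset (fun k => h2 k t) t) τ)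
    (supp_nonempty _)

/-- Every singular cycle of a simplicial complex is homologous to a simplicial cycle. -/
theorem exists_simp_homologous [LinearOrder V] {F : Set (Finset V)} (hF : DownClosed F) {p : ℕ}
    {z : Sing (stdSimplex ℝ V) (p + 1)} (hz : z ∈ singOn (carrier F) (p + 1))
    (hz0 : sbd p z = 0) :
    ∃ f ∈ simpFaces F (p + 1), simpBd f = 0 ∧ ∃ b ∈ singOn (carrier F) (p + 2),
      sbd (p + 1) b = z + realV (p + 1) (toOrd (p + 1) f) := by
  obtain ⟨N, hN⟩ := exists_iterate_sd_adapted_maxVertex z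
  have hN := hN N le_rfl
  set z' := (sd (p + 1))^[N] z with hz'
  have hzF : z' ∈ singOn (carrier F) (p + 1) := iterate_sd_mem hz N
  have hz0' : sbd p z' = 0 := by
    rw [hz', sbd_iterate_sd, hz0]; exact iterate_map_zero (sd p) N
  obtain ⟨b₁, hb₁, hb₁'⟩ := exists_mem_sbd_eq_add_iterate_sd hz hz0 N
  rw [← hz'] at hb₁'
  obtain ⟨b₂, hb₂, hb₂'⟩ := exists_sbd_eq_add_approx (A := carrier F) (j := maxVertex) hz0'
    (B := {σ | ∀ t, σ t ∈ carrier F} ∩ adapted maxVertex (p + 1))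
    (by rw [Finsupp.supported_inter]; exact ⟨hzF, hN⟩)
    (fun σ hσ t τ => segmentPoint_mem_carrier hF hσ.1 hσ.2 t τ)
  set c := approx (V := V) maxVertex (p + 1) z' with hc
  have hcF : c ∈ ordFaces F (p + 1) := approx_mem hzF hN
  have hc0 : bd p c = 0 := by rw [hc, bd_approx, hz0', map_zero]
  refine ⟨toSimp (p + 1) c, toSimp_mem hF hcF, by rw [← toSimp_bd, hc0, map_zero],
    b₁ + b₂ + realV (p + 2) (sortHtpy (p + 1) c), Submodule.add_mem _ (Submodule.add_mem _ hb₁ hb₂)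
      (realV_mem hF (sortHtpy_mem hcF)), ?_⟩
  have h := bd_sortHtpy c
  rw [hc0, map_zero, add_zero] at h
  rw [map_add, map_add, hb₁', hb₂', sbd_realV, h, map_add, ← add_assoc (z + z'), add_add_self_of_zmod2,
    ← add_assoc, add_add_self_of_zmod2]

/-- Subdividing a simplicial chain and approximating it again, by vertices in the supports of the
points, gives back the simplicial chain. -/
theorem toSimp_approx_iterate_sd [LinearOrder V] {j : stdSimplex ℝ V → V}
    (hj : ∀ x : stdSimplex ℝ V, j x ∈ supp x.1) (N p : ℕ) {f : Simp V}
    (hf : f ∈ Finsupp.supported (ZMod 2) (ZMod 2) {s : Finset V | s.card = p}) :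
    toSimp p (approx j p ((sd p)^[N] (realV p (toOrd p f)))) = f := by
  have hit : ∀ p z, (sd (X := stdSimplex ℝ V) p)^[N] z = ((sd p) ^ N) z := fun p z =>
    (Module.End.pow_apply _ _ _).symm
  induction p generalizing f with
  | zero =>
    have h0 : ∀ z : Sing (stdSimplex ℝ V) 0, (sd 0)^[N] z = z := fun z => by
      suffices h : sd (X := stdSimplex ℝ V) 0 = LinearMap.id by
        rw [h]; exact Function.iterate_fixed rfl N
      refine linearMap_ext_single fun σ => ?_
      rw [sd, natOp_single, ordSd, LinearMap.id_apply, push_real_fundamental, LinearMap.id_apply]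
    rw [h0]
    have hid : approx j 0 ∘ₗ realV 0 = LinearMap.id := linearMap_ext_single fun w => by
      rw [LinearMap.comp_apply, realize_single, approx_single, LinearMap.id_apply]
      congr 1
      exact Subsingleton.elim _ _
    have := LinearMap.congr_fun hid (toOrd 0 f)
    rw [LinearMap.comp_apply, LinearMap.id_apply] at this
    rw [this, toSimp_toOrd hf]
  | succ p ih =>
    simp only [hit]
    refine eqOn_of_mem_supported (f := toSimp (p + 1) ∘ₗ approx j (p + 1) ∘ₗ
      ((sd (p + 1)) ^ N) ∘ₗ realV (p + 1) ∘ₗ toOrd (p + 1)) (g := LinearMap.id)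
      (fun s hs => ?_) hf
    simp only [LinearMap.comp_apply, LinearMap.id_apply, ← hit]
    have hs' : s.card = p + 1 := hs
    have hsne : s.Nonempty := Finset.card_pos.1 (by omega)
    let F : Set (Finset V) := {t | t ⊆ s ∧ t.Nonempty}
    have hF : DownClosed F := fun t ht u hu hne => ⟨hu.trans ht.1, hne⟩
    set m := toSimp (p + 1) (approx j (p + 1) ((sd (p + 1))^[N]
      (realV (p + 1) (toOrd (p + 1) (Finsupp.single s 1))))) with hm
    have hbdm : simpBd m = simpBd (Finsupp.single s 1) := by
      rw [hm, ← toSimp_bd, bd_approx, sbd_iterate_sd, sbd_realV, ← toOrd_simpBd]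
      refine ih ?_
      rw [simpBd_single]
      refine Submodule.sum_mem _ fun x hx => single_mem_supported ?_
      have := Finset.card_erase_add_one hx
      change (s.erase x).card = p
      omega
    -- `m` is a chain of simplices of full dimension inside `s`, hence a multiple of `s`
    have hmF : m ∈ simpFaces F (p + 1) := by
      refine toSimp_mem hF ?_
      have h1 : realV (p + 1) (toOrd (p + 1) (Finsupp.single s 1)) ∈
          singOn (carrier F) (p + 1) :=
        realV_mem hF (toOrd_mem (single_mem_supported ⟨⟨subset_rfl, hsne⟩, hs'⟩))
      refine map_mem_of_mem_supported _ (fun σ hσ => ?_) (iterate_sd_mem h1 N)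
      rw [approx_single]
      exact single_mem_supported ⟨s, ⟨subset_rfl, hsne⟩, fun k => (hσ _).1 (hj _)⟩
    have hms : m = m s • Finsupp.single s 1 := by
      ext t
      by_cases ht : t = s
      · subst ht; simp
      · have : t ∉ m.support := fun h => by
          have := hmF h
          exact ht (Finset.eq_of_subset_of_card_le this.1.1 (by rw [this.2, hs']))
        rw [Finsupp.notMem_support_iff.1 this]
        simp [Ne.symm ht]
    have h01 : m s = 0 ∨ m s = 1 := by generalize m s = a; revert a; decide
    rcases h01 with h | h
    · rw [h, zero_smul] at hms
      rw [hms, map_zero] at hbdm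
      exact (simpBd_single_ne_zero hsne hbdm.symm).elim
    · rw [hms, h, one_smul]

/-- In a graph, a simplicial `1`-cycle that is a boundary of singular chains is zero. -/
theorem simp_eq_zero_of_boundary [LinearOrder V] {F : Set (Finset V)} (hF : DownClosed F)
    (hcard : ∀ s ∈ F, s.card ≤ 2) {f : Simp V} (hf : f ∈ simpFaces F 2)
    (h : ∃ b ∈ singOn (carrier F) 3, sbd 2 b = realV 2 (toOrd 2 f)) : f = 0 := by
  obtain ⟨b, hb, hbf⟩ := h
  obtain ⟨N, hN⟩ := exists_iterate_sd_adapted_maxVertex b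
  have hN := hN N le_rfl
  have h3 : toSimp 3 (approx maxVertex 3 ((sd 3)^[N] b)) = 0 := by
    have := toSimp_mem hF (approx_mem (iterate_sd_mem hb N) hN)
    have he : {s : Finset V | s ∈ F ∧ s.card = 2 + 1} = ∅ := by
      ext s
      simp only [Set.mem_ofPred_eq, Set.mem_empty_iff_false, iff_false, not_and]
      intro hs h3
      have := hcard s hs
      omega
    rw [simpFaces, he, Finsupp.supported_empty] at this
    exact (Submodule.mem_bot _).1 this
  rw [← toSimp_approx_iterate_sd (j := maxVertex) maxVertex_mem_supp N 2
    (Finsupp.supported_mono (fun s hs => hs.2) hf), ← hbf, ← sbd_iterate_sd, ← bd_approx, toSimp_bd,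
    h3, map_zero]

end

noncomputable section

/-! ### Half-spaces and induced subcomplexes -/

variable {V : Type*}

/-- The faces of `F` all of whose vertices lie above the level `c`. -/
def facesAbove (F : Set (Finset V)) (l : V → ℝ) (c : ℝ) : Set (Finset V) :=
  {s | s ∈ F ∧ ∀ i ∈ s, c < l i}

theorem DownClosed.facesAbove {F : Set (Finset V)} (hF : DownClosed F) (l : V → ℝ) (c : ℝ) :
    DownClosed (facesAbove F l c) :=
  fun s hs t hts hne => ⟨hF s hs.1 t hts hne, fun i hi => hs.2 i (hts hi)⟩

theorem singOn_mono {X : Type*} [TopologicalSpace X] {A B : Set X} (h : A ⊆ B) (p : ℕ) :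
    singOn A p ≤ singOn B p :=
  Finsupp.supported_mono fun _ hσ t => h (hσ t)

variable [Fintype V]

/-- The part of the carrier of `F` that lies above the level `c` of the affine function with values
`l i` at the vertices. -/
def carrierAbove (F : Set (Finset V)) (l : V → ℝ) (c : ℝ) : Set (stdSimplex ℝ V) :=
  {x | x ∈ carrier F ∧ c < ∑ i, x i * l i}

theorem lt_sum_mul {l : V → ℝ} {c : ℝ} {x : stdSimplex ℝ V} (h : ∀ i ∈ supp x.1, c < l i) :
    c < ∑ i, x i * l i := by
  have h1 : c = ∑ i, x i * c := by rw [← Finset.sum_mul, stdSimplex.sum_eq_one, one_mul]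
  rw [h1]
  obtain ⟨k, hk⟩ := supp_nonempty x
  refine Finset.sum_lt_sum (fun i _ => ?_) ⟨k, Finset.mem_univ _,
    mul_lt_mul_of_pos_left (h k hk) (pos_of_mem_supp hk)⟩
  by_cases hi : i ∈ supp x.1
  · exact mul_le_mul_of_nonneg_left (h i hi).le (stdSimplex.zero_le x i)
  · have : x i = 0 := by
      by_contra h0; exact hi (mem_supp.2 h0)
    rw [this, zero_mul, zero_mul]

theorem carrier_facesAbove_subset (F : Set (Finset V)) (l : V → ℝ) (c : ℝ) :
    carrier (facesAbove F l c) ⊆ carrierAbove F l c :=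
  fun _ hx => ⟨hx.1, lt_sum_mul hx.2⟩

theorem sum_mul_segmentPoint (l : V → ℝ) (x y : stdSimplex ℝ V) (τ : stdSimplex ℝ (Fin 2)) :
    ∑ i, segmentPoint x y τ i * l i = τ 0 * ∑ i, x i * l i + τ 1 * ∑ i, y i * l i := by
  rw [Finset.mul_sum, Finset.mul_sum, ← Finset.sum_add_distrib]
  refine Finset.sum_congr rfl fun i _ => ?_
  change (τ 0 * x i + τ 1 * y i) * l i = _
  ring

/-- The mass that a point gives to the vertices above the level `c`. -/
def massAbove (l : V → ℝ) (c : ℝ) (x : stdSimplex ℝ V) : ℝ := ∑ i with c < l i, x i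

theorem massAbove_pos {F : Set (Finset V)} {l : V → ℝ} {c : ℝ} {x : stdSimplex ℝ V}
    (hx : x ∈ carrierAbove F l c) : 0 < massAbove l c x := by
  refine lt_of_le_of_ne (Finset.sum_nonneg fun i _ => stdSimplex.zero_le x i) fun h => ?_
  have h0 := (Finset.sum_eq_zero_iff_of_nonneg fun i _ => stdSimplex.zero_le x i).1 h.symm
  have h1 : ∑ i, x i * l i ≤ ∑ i, x i * c := Finset.sum_le_sum fun i _ => by
    by_cases hi : c < l i
    · rw [h0 i (by simpa using hi), zero_mul, zero_mul]
    · exact mul_le_mul_of_nonneg_left (not_lt.1 hi) (stdSimplex.zero_le x i)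
  rw [← Finset.sum_mul, stdSimplex.sum_eq_one, one_mul] at h1
  exact absurd hx.2 (not_lt.2 h1)

theorem continuous_massAbove (l : V → ℝ) (c : ℝ) : Continuous (massAbove l c) :=
  continuous_finsetSum _ fun i _ => (continuous_apply i).comp continuous_subtype_val

/-- On a single chain, the mass above the level is bounded below. -/
theorem exists_massAbove_ge {F : Set (Finset V)} {l : V → ℝ} {c : ℝ} {p : ℕ}
    {z : Sing (stdSimplex ℝ V) p} (hz : z ∈ singOn (carrierAbove F l c) p) :
    ∃ ε > 0, z ∈ singOn {x | x ∈ carrierAbove F l c ∧ ε ≤ massAbove l c x} p := by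
  have h : ∀ᶠ ε in nhdsWithin (0 : ℝ) (Set.Ioi 0), ∀ σ ∈ z.support, ∀ t, ε ≤ massAbove l c (σ t) := by
    rw [Filter.eventually_all_finset]
    intro σ hσ
    rcases isEmpty_or_nonempty (stdSimplex ℝ (Fin p)) with he | hne
    · exact Filter.Eventually.of_forall fun ε t => (he.false t).elim
    · obtain ⟨t₀, -, ht₀⟩ := isCompact_univ.exists_isMinOn Set.univ_nonempty
        ((continuous_massAbove l c).comp σ.continuous).continuousOn
      have hpos : 0 < massAbove l c (σ t₀) := massAbove_pos (hz hσ t₀)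
      filter_upwards [Ioo_mem_nhdsGT hpos] with ε hε t
      exact hε.2.le.trans (ht₀ (Set.mem_univ t))
  obtain ⟨ε, hε, hpos⟩ := (h.and self_mem_nhdsWithin).exists
  exact ⟨ε, hpos, fun σ hσ t => ⟨hz hσ t, hε σ hσ t⟩⟩

/-- A vertex for each point, carrying a definite mass, and chosen above the level wherever the mass
above the level is at least `ε`. -/
theorem exists_vertex_choice (l : V → ℝ) (c : ℝ) {ε : ℝ} (hε : 0 < ε) (x : stdSimplex ℝ V) :
    ∃ i, min ε 1 / Fintype.card V ≤ x i ∧ (ε ≤ massAbove l c x → c < l i) := by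
  have hV := card_pos_of_stdSimplex x
  by_cases hx : ε ≤ massAbove l c x
  · by_contra! h
    have h1 : ∀ i ∈ Finset.univ.filter fun i => c < l i, x i < min ε 1 / Fintype.card V := by
      intro i hi
      by_contra hlt
      exact (not_lt.2 (h i (not_lt.1 hlt)).2) (Finset.mem_filter.1 hi).2
    have hne : (Finset.univ.filter fun i => c < l i).Nonempty := by
      rw [Finset.nonempty_iff_ne_empty]
      intro h0
      rw [massAbove, h0, Finset.sum_empty] at hx
      linarith
    have h2 := Finset.sum_lt_sum_of_nonempty hne h1
    rw [Finset.sum_const, nsmul_eq_mul] at h2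
    have hle : ((Finset.univ.filter fun i => c < l i).card : ℝ) ≤ Fintype.card V := by
      exact_mod_cast Finset.card_le_univ _
    have h3 : ((Finset.univ.filter fun i => c < l i).card : ℝ) * (min ε 1 / Fintype.card V) ≤
        min ε 1 := by
      rw [mul_div_assoc', div_le_iff₀ hV, mul_comm]
      exact mul_le_mul_of_nonneg_left hle (le_min hε.le zero_le_one)
    have h4 : massAbove l c x < min ε 1 := h2.trans_le h3
    exact absurd (h4.trans_le (min_le_left _ _)) (not_lt.2 hx)
  · refine ⟨maxVertex x, le_trans ?_ (le_maxVertex x), fun h => (hx h).elim⟩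
    exact div_le_div_of_nonneg_right (min_le_right _ _) hV.le

/-- If the simplicial homology of the subcomplex induced by the vertices above a level injects into
that of the complex, then the singular homology of the part of the complex above that level
injects as well. -/
theorem exists_sbd_eq_of_carrierAbove [LinearOrder V] {F : Set (Finset V)} (hF : DownClosed F)
    (l : V → ℝ) (c : ℝ) {p : ℕ}
    (hinj : ∀ f ∈ simpFaces (facesAbove F l c) (p + 1), ∀ g ∈ simpFaces F (p + 2), simpBd g = f →
      ∃ g' ∈ simpFaces (facesAbove F l c) (p + 2), simpBd g' = f)
    {z : Sing (stdSimplex ℝ V) (p + 1)} (hz : z ∈ singOn (carrierAbove F l c) (p + 1))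
    {b : Sing (stdSimplex ℝ V) (p + 2)} (hb : b ∈ singOn (carrier F) (p + 2))
    (hbz : sbd (p + 1) b = z) :
    ∃ b' ∈ singOn (carrierAbove F l c) (p + 2), sbd (p + 1) b' = z := by
  have hz0 : sbd p z = 0 := by rw [← hbz, sbd_sbd]
  obtain ⟨ε, hε, hzε⟩ := exists_massAbove_ge hz
  choose j hj using exists_vertex_choice l c hε
  obtain ⟨N, hNz, hNb⟩ : ∃ N,
      (sd (p + 1))^[N] z ∈ Finsupp.supported (ZMod 2) (ZMod 2) (adapted j (p + 1)) ∧
      (sd (p + 2))^[N] b ∈ Finsupp.supported (ZMod 2) (ZMod 2) (adapted j (p + 2)) := by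
    rcases isEmpty_or_pos V with h | h
    · refine ⟨0, ?_, ?_⟩ <;> rw [Finsupp.mem_supported] <;>
        exact fun σ _ k t => (h.false (σ t)).elim
    · have hδ : 0 < min ε 1 / Fintype.card V :=
        div_pos (lt_min hε one_pos) (one_div_pos.1 h)
      obtain ⟨N₁, h₁⟩ := exists_iterate_sd_adapted hδ (fun x => (hj x).1) z
      obtain ⟨N₂, h₂⟩ := exists_iterate_sd_adapted hδ (fun x => (hj x).1) b
      exact ⟨max N₁ N₂, h₁ _ (le_max_left _ _), h₂ _ (le_max_right _ _)⟩
  set z' := (sd (p + 1))^[N] z with hz'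
  set b' := (sd (p + 2))^[N] b with hb'
  have hb'z : sbd (p + 1) b' = z' := by rw [hb', sbd_iterate_sd, hbz]
  have hz'0 : sbd p z' = 0 := by rw [← hb'z, sbd_sbd]
  have hz'ε := iterate_sd_mem hzε N
  rw [← hz'] at hz'ε
  obtain ⟨b₁, hb₁, hb₁z⟩ := exists_mem_sbd_eq_add_iterate_sd hz hz0 N
  rw [← hz'] at hb₁z
  -- the simplices of `z'` are adapted, and their chosen vertices lie above the level
  have hB : z' ∈ Finsupp.supported (ZMod 2) (ZMod 2)
      ({σ | ∀ t, σ t ∈ {x | x ∈ carrierAbove F l c ∧ ε ≤ massAbove l c x}} ∩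
        adapted j (p + 1)) := by
    rw [Finsupp.supported_inter]; exact ⟨hz'ε, hNz⟩
  have hcz : approx j (p + 1) z' ∈ ordFaces (facesAbove F l c) (p + 1) := by
    refine map_mem_of_mem_supported _ (fun σ hσ => ?_) hB
    rw [approx_single]
    refine single_mem_supported
      ⟨Finset.univ.image fun k => j (σ (stdSimplex.vertex k)), ⟨?_, ?_⟩, fun k =>
        Finset.mem_image_of_mem _ (Finset.mem_univ k)⟩
    · refine hF _ (hσ.1 (stdSimplex.vertex 0)).1.1 _ ?_ (Finset.univ_nonempty.image _)
      intro i hi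
      obtain ⟨k, -, rfl⟩ := Finset.mem_image.1 hi
      exact hσ.2 k _
    · intro i hi
      obtain ⟨k, -, rfl⟩ := Finset.mem_image.1 hi
      exact (hj _).2 (hσ.1 _).2
  obtain ⟨b₂, hb₂, hb₂z⟩ := exists_sbd_eq_add_approx (A := carrierAbove F l c) (j := j) hz'0 hB
    (fun σ hσ t τ => by
      refine ⟨segmentPoint_mem_carrier hF (fun t => (hσ.1 t).1.1) hσ.2 t τ, ?_⟩
      rw [sum_mul_segmentPoint]
      have h1 := (hσ.1 t).1.2
      have h2 : c < ∑ i, aff (fun k => stdSimplex.vertex (j (σ (stdSimplex.vertex k)))) t i * l i := by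
        refine lt_sum_mul fun i hi => ?_
        have := supp_aff_subset (s := Finset.univ.image fun k => j (σ (stdSimplex.vertex k)))
          (fun k => Finset.mem_image_of_mem _ (Finset.mem_univ k)) t hi
        obtain ⟨k, -, rfl⟩ := Finset.mem_image.1 this
        exact (hj _).2 (hσ.1 _).2
      have h0 := τ.2.1 0
      have h0' := τ.2.1 1
      have hs := stdSimplex.add_eq_one τ
      exact (convex_Ioi c) h1 h2 h0 h0' hs)
  obtain ⟨g', hg', hg'f⟩ := hinj (toSimp (p + 1) (approx j (p + 1) z'))
    (toSimp_mem (hF.facesAbove l c) hcz) (toSimp (p + 2) (approx j (p + 2) b'))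
    (toSimp_mem hF (approx_mem (iterate_sd_mem hb N) hNb))
    (by rw [← toSimp_bd, bd_approx, hb'z])
  have hA : ∀ {q : ℕ} {d : Ord V q}, d ∈ ordFaces (facesAbove F l c) q →
      realV q d ∈ singOn (carrierAbove F l c) q := fun hd =>
    singOn_mono (carrier_facesAbove_subset F l c) _
      (realV_mem (hF.facesAbove l c) hd)
  refine ⟨b₁ + b₂ + realV (p + 2) (sortHtpy (p + 1) (approx j (p + 1) z')) +
    realV (p + 2) (toOrd (p + 2) g'), Submodule.add_mem _ (Submodule.add_mem _
      (Submodule.add_mem _ hb₁ hb₂) (hA (sortHtpy_mem hcz))) (hA (toOrd_mem hg')), ?_⟩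
  have h := bd_sortHtpy (approx j (p + 1) z')
  rw [bd_approx, hz'0, map_zero, map_zero, add_zero] at h
  rw [map_add, map_add, map_add, hb₁z, hb₂z, sbd_realV, sbd_realV, h, ← toOrd_simpBd, hg'f, map_add,
    ← add_assoc (z + z'), add_add_self_of_zmod2, ← add_assoc, add_add_self_of_zmod2,
    add_add_self_of_zmod2]

end

noncomputable section

/-! ### Simplicial injectivity for surfaces with a complete graph -/

variable {V : Type*}

/-- The link of a vertex: the nonempty faces that do not contain `v` but span a face with it. -/
def linkFaces [DecidableEq V] (F : Set (Finset V)) (v : V) : Set (Finset V) :=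
  {s | s.Nonempty ∧ v ∉ s ∧ insert v s ∈ F}

theorem DownClosed.linkFaces [DecidableEq V] {F : Set (Finset V)} (hF : DownClosed F) (v : V) :
    DownClosed (linkFaces F v) :=
  fun _ hs t hts hne => ⟨hne, fun h => hs.2.1 (hts h),
    hF _ hs.2.2 _ (Finset.insert_subset_insert v hts) (Finset.insert_nonempty v t)⟩

/-- The part of a simplicial chain in the link of `v`: the vertex `v` is deleted from the simplices
that contain it, and the other simplices are dropped. -/
def linkPart [DecidableEq V] (v : V) : Simp V →ₗ[ZMod 2] Simp V :=
  Finsupp.linearCombination (ZMod 2) fun s =>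
    if v ∈ s then Finsupp.single (s.erase v) 1 else 0

@[simp] theorem linkPart_single [DecidableEq V] (v : V) (s : Finset V) :
    linkPart v (Finsupp.single s 1) = if v ∈ s then Finsupp.single (s.erase v) 1 else 0 := by
  simp [linkPart]

theorem linkPart_simpBd [DecidableEq V] (v : V) (g : Simp V) :
    linkPart v (simpBd g) = simpBd (linkPart v g) := by
  suffices h : linkPart v ∘ₗ simpBd = simpBd ∘ₗ linkPart v from LinearMap.congr_fun h g
  refine linearMap_ext_single fun s => ?_
  simp only [LinearMap.comp_apply, simpBd_single, map_sum, linkPart_single]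
  by_cases hv : v ∈ s
  · rw [if_pos hv, simpBd_single, ← Finset.add_sum_erase _ _ hv, if_neg (by simp), zero_add]
    refine Finset.sum_congr rfl fun x hx => ?_
    rw [if_pos (Finset.mem_erase.2 ⟨(Finset.ne_of_mem_erase hx).symm, hv⟩),
      Finset.erase_right_comm]
  · rw [if_neg hv, map_zero]
    exact Finset.sum_eq_zero fun x _ => if_neg fun h => hv (Finset.mem_of_mem_erase h)

theorem linkPart_apply [DecidableEq V] (v : V) (g : Simp V) (e : Finset V) (hv : v ∉ e) :
    linkPart v g e = g (insert v e) := by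
  suffices h : Finsupp.lapply e ∘ₗ linkPart v =
      (Finsupp.lapply (insert v e) : Simp V →ₗ[ZMod 2] ZMod 2) from
    LinearMap.congr_fun h g
  refine linearMap_ext_single fun s => ?_
  simp only [LinearMap.comp_apply, linkPart_single, Finsupp.lapply_apply]
  by_cases hs : v ∈ s
  · rw [if_pos hs, Finsupp.single_apply, Finsupp.single_apply]
    refine if_congr ⟨?_, ?_⟩ rfl rfl
    · rintro rfl; exact (Finset.insert_erase hs).symm
    · rintro rfl; exact Finset.erase_insert hv
  · rw [if_neg hs, Finsupp.zero_apply, Finsupp.single_apply, if_neg]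
    rintro rfl
    exact hs (Finset.mem_insert_self v e)

theorem linkPart_mem [DecidableEq V] {F : Set (Finset V)} (v : V) {p : ℕ} {g : Simp V}
    (hg : g ∈ simpFaces F (p + 2)) : linkPart v g ∈ simpFaces (linkFaces F v) (p + 1) :=
  map_mem_of_mem_supported _ (fun s hs => by
    rw [linkPart_single]
    split_ifs with hv
    · have hc := Finset.card_erase_add_one hv
      rw [hs.2] at hc
      have hc' : (s.erase v).card = p + 1 := by omega
      exact single_mem_supported ⟨⟨Finset.card_pos.1 (by omega), by simp,
        by rw [Finset.insert_erase hv]; exact hs.1⟩, hc'⟩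
    · exact Submodule.zero_mem _) hg

theorem zmod2_eq_one {a : ZMod 2} (h : a ≠ 0) : a = 1 := by
  revert h; revert a; decide

/-- The condition on the links of the vertices that holds for surfaces: either no link contains a
nonzero cycle (vertices on the boundary), or each link contains one and each such cycle covers the
whole link (closed surfaces). -/
def SurfaceLinks [DecidableEq V] (F : Set (Finset V)) : Prop :=
  (∀ v, ∀ f ∈ simpFaces (linkFaces F v) 2, simpBd f = 0 → f = 0) ∨
  ((∀ v, ∀ f ∈ simpFaces (linkFaces F v) 2, simpBd f = 0 → f ≠ 0 →
      ∀ s ∈ linkFaces F v, ∃ e, f e ≠ 0 ∧ s ⊆ e) ∧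
    ∀ v, ∃ f ∈ simpFaces (linkFaces F v) 2, simpBd f = 0 ∧ f ≠ 0)

/-- A cycle covering the whole link has coefficient one at every edge of the link. -/
theorem apply_edge_eq_one [DecidableEq V] {F : Set (Finset V)} {f : Simp V} (hf : f ∈ simpFaces F 2)
    {s : Finset V} (hs : s.card = 2) (h : ∃ e, f e ≠ 0 ∧ s ⊆ e) : f s = 1 := by
  obtain ⟨e, he, hse⟩ := h
  have he2 : e.card = 2 := (hf (Finsupp.mem_support_iff.2 he)).2
  rw [Finset.eq_of_subset_of_card_le hse (by rw [hs, he2])]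
  exact zmod2_eq_one he

theorem simpBd_mem [DecidableEq V] {F : Set (Finset V)} (hF : DownClosed F) {p : ℕ} {g : Simp V}
    (hg : g ∈ simpFaces F (p + 2)) : simpBd g ∈ simpFaces F (p + 1) :=
  map_mem_of_mem_supported _ (fun s hs => by
    rw [simpBd_single]
    refine Submodule.sum_mem _ fun x hx => ?_
    have hc := Finset.card_erase_add_one hx
    rw [hs.2] at hc
    have hc' : (s.erase x).card = p + 1 := by omega
    exact single_mem_supported ⟨hF s hs.1 _ (Finset.erase_subset _ _)
      (Finset.card_pos.1 (by omega)), hc'⟩) hg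

variable [Fintype V]

/-- The sum of all triangles. -/
def allTriangles (F : Set (Finset V)) : Simp V :=
  letI := Classical.decPred fun t : Finset V => t ∈ F ∧ t.card = 3
  Finsupp.equivFunOnFinite.symm fun t => if t ∈ F ∧ t.card = 3 then 1 else 0

theorem allTriangles_apply (F : Set (Finset V)) {t : Finset V} (h : t ∈ F) (h3 : t.card = 3) :
    allTriangles F t = 1 := by
  simp [allTriangles, h, h3]

theorem allTriangles_mem (F : Set (Finset V)) : allTriangles F ∈ simpFaces F 3 := by
  intro t ht
  by_contra h
  refine Finsupp.mem_support_iff.1 ht ?_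
  have h' : ¬ (t ∈ F ∧ t.card = 3) := h
  simp [allTriangles, h']

theorem simpBd_allTriangles [DecidableEq V] {F : Set (Finset V)} (hF : DownClosed F)
    (h1 : ∀ v, ∀ f ∈ simpFaces (linkFaces F v) 2, simpBd f = 0 → f ≠ 0 →
      ∀ s ∈ linkFaces F v, ∃ e, f e ≠ 0 ∧ s ⊆ e)
    (h2 : ∀ v, ∃ f ∈ simpFaces (linkFaces F v) 2, simpBd f = 0 ∧ f ≠ 0) :
    simpBd (allTriangles F) = 0 := by
  have hlink : ∀ v, linkPart v (simpBd (allTriangles F)) = 0 := fun v => by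
    obtain ⟨f, hf, hf0, hfne⟩ := h2 v
    have hl : linkPart v (allTriangles F) ∈ simpFaces (linkFaces F v) 2 :=
      linkPart_mem v (allTriangles_mem F)
    have : linkPart v (allTriangles F) = f := by
      ext e
      by_cases he : e ∈ linkFaces F v ∧ e.card = 2
      · rw [linkPart_apply v _ e he.1.2.1, allTriangles_apply F he.1.2.2
          (by rw [Finset.card_insert_of_notMem he.1.2.1, he.2]),
          apply_edge_eq_one hf he.2 (h1 v f hf hf0 hfne e he.1)]
      · rw [Finsupp.notMem_support_iff.1 fun h => he (hl h),
          Finsupp.notMem_support_iff.1 fun h => he (hf h)]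
    rw [linkPart_simpBd, this, hf0]
  ext e
  by_contra hne
  have he := simpBd_mem hF (p := 1) (allTriangles_mem F) (Finsupp.mem_support_iff.2 hne)
  obtain ⟨v, hv⟩ := Finset.card_pos.1 (show 0 < e.card by rw [he.2]; norm_num)
  apply hne
  have := linkPart_apply v (simpBd (allTriangles F)) (e.erase v) (by simp)
  rw [Finset.insert_erase hv, hlink] at this
  exact this.symm

/-- In degree one: a cycle above the level that bounds triangles bounds triangles above the level.
The triangles around a vertex below the level form a cycle in its link, so that either none or all
of them are used. -/
theorem exists_simpBd_eq_triangles [DecidableEq V] {F : Set (Finset V)} (hF : DownClosed F)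
    (hcomplete : ∀ i j : V, i ≠ j → {i, j} ∈ F) (hlinks : SurfaceLinks F) (l : V → ℝ) (c : ℝ)
    {f g : Simp V} (hf : f ∈ simpFaces (facesAbove F l c) 2) (hg : g ∈ simpFaces F 3)
    (hgf : simpBd g = f) : ∃ g' ∈ simpFaces (facesAbove F l c) 3, simpBd g' = f := by
  have hd : ∀ v, linkPart v g ∈ simpFaces (linkFaces F v) 2 := fun v => linkPart_mem v hg
  have hd0 : ∀ v, ¬ c < l v → simpBd (linkPart v g) = 0 := fun v hv => by
    rw [← linkPart_simpBd, hgf]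
    refine eqOn_of_mem_supported (f := linkPart v) (g := 0) (fun s hs => ?_) hf
    rw [linkPart_single, if_neg fun h => hv (hs.1.2 v h), LinearMap.zero_apply]
  have hgv : ∀ {v t}, v ∈ t → linkPart v g (t.erase v) = g t := fun {v t} hv => by
    rw [linkPart_apply v g _ (by simp), Finset.insert_erase hv]
  -- if no triangle at a vertex below the level is used, then `g` itself lies above the level
  have hnone : (∀ v, ¬ c < l v → linkPart v g = 0) → g ∈ simpFaces (facesAbove F l c) 3 :=
    fun h t ht => ⟨⟨(hg ht).1, fun v hv => by
      by_contra hlv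
      have := hgv hv
      rw [h v hlv] at this
      exact Finsupp.mem_support_iff.1 ht this.symm⟩, (hg ht).2⟩
  rcases hlinks with hbdry | ⟨h1, h2⟩
  · exact ⟨g, hnone fun v hv => hbdry v _ (hd v) (hd0 v hv), hgf⟩
  · by_cases hex : ∃ v₀, ¬ c < l v₀ ∧ linkPart v₀ g = 0
    · obtain ⟨v₀, hv₀, hz⟩ := hex
      refine ⟨g, hnone fun v hv => ?_, hgf⟩
      by_contra hne
      have hvv : v ≠ v₀ := by rintro rfl; exact hne hz
      obtain ⟨e, he, hse⟩ := h1 v _ (hd v) (hd0 v hv) hne {v₀}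
        ⟨Finset.singleton_nonempty _, by simpa using hvv, hcomplete v v₀ hvv⟩
      have hve : v ∉ e := (hd v (Finsupp.mem_support_iff.2 he)).1.2.1
      rw [linkPart_apply v g e hve] at he
      have hv₀e : v₀ ∈ insert v e :=
        Finset.mem_insert_of_mem (hse (Finset.mem_singleton_self v₀))
      rw [← hgv hv₀e, hz] at he
      exact he rfl
    · refine ⟨g + allTriangles F, fun t ht => ?_, by
        rw [map_add, hgf, simpBd_allTriangles hF h1 h2, add_zero]⟩
      have htF : t ∈ F ∧ t.card = 3 :=
        Submodule.add_mem _ hg (allTriangles_mem F) ht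
      refine ⟨⟨htF.1, fun v hv => ?_⟩, htF.2⟩
      by_contra hlv
      refine Finsupp.mem_support_iff.1 ht ?_
      have hcard : (t.erase v).card = 2 := by rw [Finset.card_erase_of_mem hv, htF.2]
      have h3 := apply_edge_eq_one (hd v) hcard (h1 v _ (hd v) (hd0 v hlv) ?_ _
        ⟨Finset.card_pos.1 (by omega), by simp, by rw [Finset.insert_erase hv]; exact htF.1⟩)
      · rw [hgv hv] at h3
        rw [Finsupp.add_apply, h3, allTriangles_apply F htF.1 htF.2]
        rfl
      · exact fun h => hex ⟨v, hlv, h⟩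

/-- For the complexes in question, simplicial homology of an induced subcomplex injects. -/
theorem simp_injective [LinearOrder V] {F : Set (Finset V)} (hF : DownClosed F)
    (hcard : ∀ s ∈ F, s.card ≤ 3) (hcomplete : ∀ i j : V, i ≠ j → {i, j} ∈ F)
    (hlinks : SurfaceLinks F) (l : V → ℝ) (c : ℝ) (p : ℕ)
    (f : Simp V) (hf : f ∈ simpFaces (facesAbove F l c) (p + 1))
    (g : Simp V) (hg : g ∈ simpFaces F (p + 2)) (hgf : simpBd g = f) :
    ∃ g' ∈ simpFaces (facesAbove F l c) (p + 2), simpBd g' = f := by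
  rcases p with _ | _ | p
  · -- the cone from a vertex above the level fills in a `0`-cycle
    rcases eq_or_ne f 0 with rfl | hne
    · exact ⟨0, Submodule.zero_mem _, map_zero _⟩
    obtain ⟨s₀, hs₀⟩ := Finsupp.support_nonempty_iff.2 hne
    obtain ⟨⟨hs₀F, hs₀l⟩, hs₀c⟩ := hf hs₀
    obtain ⟨a, rfl⟩ := Finset.card_eq_one.1 hs₀c
    have ha : c < l a := hs₀l a (Finset.mem_singleton_self a)
    have hmem : cone a 1 (toOrd 1 f) ∈ ordFaces (facesAbove F l c) 2 := by
      refine map_mem_of_mem_supported _ (fun w hw => ?_) (toOrd_mem hf)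
      obtain ⟨s, hs, hw⟩ := hw
      rw [cone_single]
      refine single_mem_supported ⟨{a, w 0}, ⟨?_, ?_⟩, fun i => ?_⟩
      · rcases eq_or_ne a (w 0) with h | h
        · rw [← h, Finset.pair_eq_singleton]; exact hs₀F
        · exact hcomplete a _ h
      · intro i hi
        rcases Finset.mem_insert.1 hi with rfl | hi
        · exact ha
        · rw [Finset.mem_singleton.1 hi]; exact hs.2 _ (hw 0)
      · fin_cases i <;> simp
    refine ⟨toSimp 2 (cone a 1 (toOrd 1 f)), toSimp_mem (hF.facesAbove l c) hmem, ?_⟩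
    rw [← toSimp_bd, bd_cone_succ]
    have h0 : bd 0 (toOrd 1 f) = 0 := by
      rw [← hgf, toOrd_simpBd, bd_bd]
    rw [h0, map_zero, add_zero, toSimp_toOrd (Finsupp.supported_mono (fun s hs => hs.2) hf)]
  · exact exists_simpBd_eq_triangles hF hcomplete hlinks l c hf hg hgf
  · -- there are no simplices of dimension three or more
    have : g = 0 := by
      rw [← Finsupp.support_eq_empty, Finset.eq_empty_iff_forall_notMem]
      intro s hs
      have h1 := hcard s (hg hs).1
      have h2 := (hg hs).2
      omega
    exact ⟨0, Submodule.zero_mem _, by rw [← hgf, this]⟩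

end

noncomputable section

/-! ### Cones over links -/

variable {V : Type*} [Fintype V]

/-- The height of a point of the punctured star above the vertex. -/
def height (v : V) (x : stdSimplex ℝ V) : unitInterval :=
  ⟨1 - x v, sub_nonneg.2 (stdSimplex.le_one x v), by
    have := stdSimplex.zero_le x v
    linarith⟩

theorem continuous_height (v : V) : Continuous (height v) :=
  Continuous.subtype_mk (continuous_const.sub
    ((continuous_apply v).comp continuous_subtype_val)) _

variable [DecidableEq V]

/-- The point at height `u` on the segment from the vertex `v` to the point `m`. -/
def conePoint (v : V) (u : unitInterval) (m : stdSimplex ℝ V) : stdSimplex ℝ V :=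
  ⟨(1 - (u : ℝ)) • Pi.single v 1 + (u : ℝ) • m.1, (convex_stdSimplex ℝ V)
    (single_mem_stdSimplex ℝ v) m.2 (sub_nonneg.2 u.2.2) u.2.1 (sub_add_cancel _ _)⟩

theorem conePoint_apply (v : V) (u : unitInterval) (m : stdSimplex ℝ V) (i : V) :
    conePoint v u m i = (1 - u) * (Pi.single v 1 : V → ℝ) i + u * m i := rfl

theorem continuous_conePoint (v : V) :
    Continuous fun x : unitInterval × stdSimplex ℝ V => conePoint v x.1 x.2 := by
  have h1 : Continuous fun x : unitInterval × stdSimplex ℝ V => (x.1 : ℝ) :=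
    continuous_subtype_val.comp continuous_fst
  have h2 : Continuous fun x : unitInterval × stdSimplex ℝ V => x.2.1 :=
    continuous_subtype_val.comp continuous_snd
  exact Continuous.subtype_mk (((continuous_const.sub h1).smul continuous_const).add
    (h1.smul h2)) _

theorem conePoint_zero (v : V) (m : stdSimplex ℝ V) : conePoint v 0 m = stdSimplex.vertex v := by
  ext i
  rw [conePoint_apply]
  simp

variable {F : Set (Finset V)} {v : V}

theorem apply_eq_zero_of_mem_link {m : stdSimplex ℝ V} (hm : m ∈ carrier (linkFaces F v)) :
    m v = 0 := by
  by_contra h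
  exact hm.2.1 (mem_supp.2 h)

theorem conePoint_apply_self {m : stdSimplex ℝ V} (hm : m ∈ carrier (linkFaces F v))
    (u : unitInterval) : conePoint v u m v = 1 - u := by
  rw [conePoint_apply, apply_eq_zero_of_mem_link hm]
  simp

theorem conePoint_apply_of_ne (m : stdSimplex ℝ V) (u : unitInterval) {i : V} (hi : i ≠ v) :
    conePoint v u m i = u * m i := by
  rw [conePoint_apply, Pi.single_eq_of_ne hi]
  simp

theorem conePoint_mem (hF : DownClosed F) {m : stdSimplex ℝ V} (hm : m ∈ carrier (linkFaces F v))
    (u : unitInterval) : conePoint v u m ∈ carrier F := by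
  refine hF _ hm.2.2 _ (fun i hi => ?_) (supp_nonempty _)
  rcases eq_or_ne i v with rfl | hiv
  · exact Finset.mem_insert_self _ _
  · refine Finset.mem_insert_of_mem (mem_supp.2 fun h => mem_supp.1 hi ?_)
    change conePoint v u m i = 0
    rw [conePoint_apply_of_ne m u hiv]
    change (u : ℝ) * m.1 i = 0
    rw [h, mul_zero]

theorem conePoint_inj {m m' : stdSimplex ℝ V} (hm : m ∈ carrier (linkFaces F v))
    (hm' : m' ∈ carrier (linkFaces F v)) {u u' : unitInterval}
    (h : conePoint v u m = conePoint v u' m') : u = u' ∧ (u ≠ 0 → m = m') := by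
  have hu : u = u' := by
    have := DFunLike.congr_fun h v
    rw [conePoint_apply_self hm, conePoint_apply_self hm'] at this
    exact Subtype.ext (by linarith)
  refine ⟨hu, fun h0 => ?_⟩
  subst hu
  ext i
  rcases eq_or_ne i v with rfl | hiv
  · rw [apply_eq_zero_of_mem_link hm, apply_eq_zero_of_mem_link hm']
  · have := DFunLike.congr_fun h i
    rw [conePoint_apply_of_ne m u hiv, conePoint_apply_of_ne m' u hiv] at this
    exact mul_left_cancel₀ (fun h => h0 (Subtype.ext h)) this

theorem eq_vertex_of_apply_eq_one {x : stdSimplex ℝ V} (h : x v = 1) :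
    x = stdSimplex.vertex v := by
  ext i
  rcases eq_or_ne i v with rfl | hiv
  · rw [h]; simp
  · have h1 := stdSimplex.sum_eq_one x
    rw [← Finset.add_sum_erase _ _ (Finset.mem_univ v), h] at h1
    have h2 : ∑ i ∈ Finset.univ.erase v, x i = 0 := by linarith
    rw [(Finset.sum_eq_zero_iff_of_nonneg fun i _ => stdSimplex.zero_le x i).1 h2 i
      (Finset.mem_erase.2 ⟨hiv, Finset.mem_univ i⟩)]
    simp [hiv]

/-- The open star of `v` with the vertex itself removed. -/
def puncturedStar (F : Set (Finset V)) (v : V) : Set (stdSimplex ℝ V) :=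
  {x | x ∈ carrier F ∧ 0 < x v ∧ x v < 1}

/-- The radial projection of the punctured star onto the link. -/
def linkProj (F : Set (Finset V)) (v : V) : C(puncturedStar F v, carrier (linkFaces F v)) where
  toFun x := ⟨⟨fun i => if i = v then 0 else x.1 i / (1 - x.1 v), by
      have h1 : 0 < 1 - x.1 v := sub_pos.2 x.2.2.2
      refine ⟨fun i => ?_, ?_⟩
      · beta_reduce
        split_ifs
        · exact le_rfl
        · exact div_nonneg (stdSimplex.zero_le _ _) h1.le
      · rw [← Finset.add_sum_erase _ _ (Finset.mem_univ v), if_pos rfl, zero_add]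
        have h2 := stdSimplex.sum_eq_one x.1
        rw [← Finset.add_sum_erase _ _ (Finset.mem_univ v)] at h2
        rw [Finset.sum_congr rfl fun i hi => if_neg (Finset.ne_of_mem_erase hi),
          ← Finset.sum_div, div_eq_one_iff_eq h1.ne']
        linarith⟩, by
    have h1 : 0 < 1 - x.1 v := sub_pos.2 x.2.2.2
    refine ⟨supp_nonempty _, fun h => mem_supp.1 h (if_pos rfl), ?_⟩
    have hx : supp x.1.1 ∈ F := x.2.1
    convert hx
    ext i
    rw [Finset.mem_insert, mem_supp, mem_supp]
    rcases eq_or_ne i v with rfl | hiv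
    · simpa using (show x.1.1 i ≠ 0 from x.2.2.1.ne')
    · simp only [hiv, if_false, false_or]
      exact (div_ne_zero_iff.trans (and_iff_left h1.ne'))⟩
  continuous_toFun := by
    have hc : ∀ i, Continuous fun x : puncturedStar F v => x.1 i := fun i =>
      (continuous_apply i).comp (continuous_subtype_val.comp continuous_subtype_val)
    refine Continuous.subtype_mk (Continuous.subtype_mk (continuous_pi fun i => ?_) _) _
    by_cases hi : i = v
    · simp only [hi, if_true]; exact continuous_const
    · simp only [hi, if_false]
      exact (hc i).div (continuous_const.sub (hc v)) fun x => (sub_pos.2 x.2.2.2).ne'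

theorem linkProj_apply_of_ne (x : puncturedStar F v) {i : V} (hi : i ≠ v) :
    (linkProj F v x).1 i = x.1 i / (1 - x.1 v) :=
  if_neg hi

theorem linkProj_conePoint {x : puncturedStar F v} {m : stdSimplex ℝ V}
    (hm : m ∈ carrier (linkFaces F v)) {u : unitInterval} (hx : x.1 = conePoint v u m) :
    linkProj F v x = ⟨m, hm⟩ := by
  refine Subtype.ext ?_
  ext i
  rcases eq_or_ne i v with rfl | hiv
  · rw [apply_eq_zero_of_mem_link (linkProj F i x).2, apply_eq_zero_of_mem_link hm]
  · have h1 := x.2.2.2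
    rw [linkProj_apply_of_ne x hiv, hx, conePoint_apply_self hm, conePoint_apply_of_ne m u hiv]
    rw [hx, conePoint_apply_self hm] at h1
    rw [sub_sub_cancel, mul_comm, mul_div_assoc, div_self (by linarith), mul_one]

theorem conePoint_linkProj (x : puncturedStar F v) :
    conePoint v (height v x.1) (linkProj F v x).1 = x.1 := by
  ext i
  have h1 : 1 - x.1 v ≠ 0 := (sub_pos.2 x.2.2.2).ne'
  rcases eq_or_ne i v with rfl | hiv
  · rw [conePoint_apply_self (linkProj F i x).2]
    simp [height]
  · rw [conePoint_apply_of_ne _ _ hiv, linkProj_apply_of_ne x hiv]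
    exact mul_div_cancel₀ _ h1

theorem isClosed_carrier (hF : DownClosed F) : IsClosed (carrier F) := by
  have : carrier F = ⋃ s ∈ F, ⋂ i, {x : stdSimplex ℝ V | i ∉ s → x i = 0} := by
    ext x
    simp only [Set.mem_iUnion, Set.mem_iInter, Set.mem_ofPred_eq, exists_prop]
    refine ⟨fun hx => ⟨_, hx, fun i hi => ?_⟩, fun ⟨s, hs, h⟩ => ?_⟩
    · by_contra h; exact hi (mem_supp.2 h)
    · refine hF s hs _ (fun i hi => ?_) (supp_nonempty x)
      by_contra his
      exact mem_supp.1 hi (h i his)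
  rw [this]
  refine (Set.toFinite F).isClosed_biUnion fun s _ => isClosed_iInter fun i => ?_
  by_cases hi : i ∈ s
  · simp [hi]
  · simp only [hi, not_false_eq_true, true_implies]
    exact isClosed_eq ((continuous_apply i).comp continuous_subtype_val) continuous_const

/-- The singular cycle of a simplicial cycle, in the carrier. -/
theorem exists_lift_simp {V : Type*} [Fintype V] [LinearOrder V] {F : Set (Finset V)}
    (hF : DownClosed F) {p : ℕ} {f : Simp V} (hf : f ∈ simpFaces F (p + 1)) (hf0 : simpBd f = 0) :
    ∃ z : Sing (carrier F) (p + 1), push (inclMap _) (p + 1) z = realV (p + 1) (toOrd (p + 1) f) ∧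
      sbd p z = 0 := by
  obtain ⟨z, hz⟩ := exists_push_inclMap_eq (realV_mem hF (toOrd_mem hf))
  refine ⟨z, hz, push_injective (f := inclMap (carrier F)) Subtype.val_injective p ?_⟩
  rw [← sbd_push, hz, sbd_realV, ← toOrd_simpBd, hf0, map_zero, map_zero, map_zero]

end

noncomputable section

/-! ### Punctured neighbourhoods in the plane -/

/-- In a star-shaped set every singular `1`-cycle is a boundary. -/
theorem exists_sbd_eq_of_starConvex {E : Type*} [NormedAddCommGroup E] [NormedSpace ℝ E]
    {Q : Set E} {q : E} (hq : q ∈ Q) (hQ : StarConvex ℝ q Q) {z : Sing Q 2} (hz : sbd 1 z = 0) :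
    ∃ b, sbd 2 b = z := by
  let H : ContinuousMap.Homotopy (ContinuousMap.id Q) (ContinuousMap.const Q (⟨q, hq⟩ : Q)) :=
    { toFun := fun x => ⟨(x.1 : ℝ) • q + (1 - (x.1 : ℝ)) • x.2.1,
        hQ x.2.2 x.1.2.1 (sub_nonneg.2 x.1.2.2) (add_sub_cancel _ _)⟩
      continuous_toFun := by fun_prop
      map_zero_left := fun x => Subtype.ext (by simp)
      map_one_left := fun x => Subtype.ext (by simp) }
  obtain ⟨b, hb⟩ := exists_sbd_eq_push_of_homotopy H hz (exists_sbd_eq_push_const _ z)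
  exact ⟨b, by rw [hb, push_id]⟩

/-- A map that avoids the point `q`, as a map to the complement of `q`. -/
def avoid {X E : Type*} [TopologicalSpace X] [TopologicalSpace E] (f : C(X, E)) {q : E}
    (h : ∀ x, f x ≠ q) : C(X, ({q}ᶜ : Set E)) :=
  ⟨fun x => ⟨f x, h x⟩, f.continuous.subtype_mk _⟩

/-- A homotopy that avoids the point `q`. -/
def avoidHomotopy {X E : Type*} [TopologicalSpace X] [TopologicalSpace E] {f g : C(X, E)} {q : E}
    (H : ContinuousMap.Homotopy f g) (h : ∀ x, H x ≠ q) (hf : ∀ x, f x ≠ q) (hg : ∀ x, g x ≠ q) :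
    ContinuousMap.Homotopy (avoid f hf) (avoid g hg) where
  toFun x := ⟨H x, h x⟩
  continuous_toFun := H.continuous.subtype_mk _
  map_zero_left x := Subtype.ext (H.apply_zero x)
  map_one_left x := Subtype.ext (H.apply_one x)

/-- The radial retraction of the punctured space onto a punctured closed ball, which is the identity
on that ball. -/
def squeeze {E : Type*} [NormedAddCommGroup E] [NormedSpace ℝ E] (q : E) {r : ℝ} (hr : 0 < r) :
    C(({q}ᶜ : Set E), (Metric.closedBall q r \ {q} : Set E)) where
  toFun x := ⟨q + min 1 (r / ‖x.1 - q‖) • (x.1 - q), by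
    have h0 : 0 < ‖x.1 - q‖ := norm_pos_iff.2 (sub_ne_zero.2 x.2)
    have hm : 0 < min 1 (r / ‖x.1 - q‖) := lt_min one_pos (div_pos hr h0)
    refine ⟨?_, fun h => ?_⟩
    · rw [mem_closedBall_iff_norm, add_sub_cancel_left, norm_smul, Real.norm_of_nonneg hm.le]
      calc min 1 (r / ‖x.1 - q‖) * ‖x.1 - q‖ ≤ r / ‖x.1 - q‖ * ‖x.1 - q‖ := by
            gcongr; exact min_le_right _ _
        _ = r := div_mul_cancel₀ _ h0.ne'
    · have := add_eq_left.1 (Set.mem_singleton_iff.1 h)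
      rcases smul_eq_zero.1 this with h | h
      · exact hm.ne' h
      · exact x.2 (sub_eq_zero.1 h)⟩
  continuous_toFun := by
    have h1 : Continuous fun x : ({q}ᶜ : Set E) => x.1 - q :=
      continuous_subtype_val.sub continuous_const
    refine Continuous.subtype_mk (continuous_const.add ((continuous_const.min
      (continuous_const.div h1.norm fun x => ?_)).smul h1)) _
    exact norm_ne_zero_iff.2 (sub_ne_zero.2 x.2)

theorem squeeze_apply_of_mem {E : Type*} [NormedAddCommGroup E] [NormedSpace ℝ E] {q : E} {r : ℝ}
    (hr : 0 < r) {x : ({q}ᶜ : Set E)} (hx : x.1 ∈ Metric.closedBall q r) :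
    (squeeze q hr x).1 = x.1 := by
  have h0 : 0 < ‖x.1 - q‖ := norm_pos_iff.2 (sub_ne_zero.2 x.2)
  change q + min 1 (r / ‖x.1 - q‖) • (x.1 - q) = x.1
  rw [mem_closedBall_iff_norm] at hx
  rw [min_eq_left ((one_le_div h0).2 hx), one_smul, add_sub_cancel]

/-! ### Charts at a vertex and the cone over its link -/

/-- A neighbourhood of the vertex `v` of a complex, parametrized by a subset `O` of a vector space,
with the vertex at `q₀`: a continuous injection `g` of `O` into the open star of `v`, through
which the cone points of height less than `ε` over the link factor continuously. -/
structure ConeChart {V E : Type*} [Fintype V] [DecidableEq V] [TopologicalSpace E]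
    (F : Set (Finset V)) (v : V) (O : Set E) (q₀ : O) where
  /-- The parametrization of a neighbourhood of the vertex. -/
  g : C(O, stdSimplex ℝ V)
  g_mem : ∀ q, g q ∈ carrier F
  g_pos : ∀ q, 0 < g q v
  g_inj : Function.Injective g
  g_base : g q₀ = stdSimplex.vertex v
  /-- The height up to which the cone over the link lies in the neighbourhood. -/
  ε : ℝ
  ε_pos : 0 < ε
  ε_le : ε ≤ 1
  /-- The small cone over the link, in the coordinates of the chart. -/
  α : C({u : unitInterval // (u : ℝ) < ε} × carrier (linkFaces F v), O)
  g_α : ∀ x, g (α x) = conePoint v x.1.1 x.2.1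

namespace ConeChart

variable {V E : Type*} [Fintype V] [LinearOrder V] [TopologicalSpace E]
  {F : Set (Finset V)} {v : V} {O : Set E} {q₀ : O} (Φ : ConeChart F v O q₀)

/-- The copy of the link at height `u` of the cone. -/
def slice (u : {u : unitInterval // (u : ℝ) < Φ.ε}) : C(carrier (linkFaces F v), O) :=
  Φ.α.comp ((ContinuousMap.const _ u).prodMk (ContinuousMap.id _))

theorem g_apply_lt {q : O} (hq : q ≠ q₀) : Φ.g q v < 1 := by
  refine lt_of_le_of_ne (stdSimplex.le_one _ _) fun h => hq (Φ.g_inj ?_)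
  rw [Φ.g_base]
  exact eq_vertex_of_apply_eq_one h

theorem α_ne (u : {u : unitInterval // (u : ℝ) < Φ.ε}) (hu : u.1 ≠ 0)
    (m : carrier (linkFaces F v)) : Φ.α (u, m) ≠ q₀ := by
  intro h
  have h1 := Φ.g_α (u, m)
  rw [h, Φ.g_base] at h1
  have h2 := DFunLike.congr_fun h1 v
  rw [conePoint_apply_self m.2] at h2
  refine hu (Subtype.ext ?_)
  simp only [Pi.single_eq_same, stdSimplex.vertex_coe] at h2
  change (u.1 : ℝ) = 0
  linarith

theorem α_zero (h : ((0 : unitInterval) : ℝ) < Φ.ε) (m : carrier (linkFaces F v)) :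
    Φ.α (⟨0, h⟩, m) = q₀ := by
  refine Φ.g_inj ?_
  rw [Φ.g_α, Φ.g_base]
  exact conePoint_zero v m.1

/-- The radial projection of the punctured chart domain onto the link. -/
def proj : C({q : O // q ≠ q₀}, carrier (linkFaces F v)) :=
  (linkProj F v).comp ⟨fun q => ⟨Φ.g q.1, Φ.g_mem _, Φ.g_pos _, Φ.g_apply_lt q.2⟩,
    (Φ.g.continuous.comp continuous_subtype_val).subtype_mk _⟩

theorem proj_eq {q : {q : O // q ≠ q₀}} {u : unitInterval} {m : carrier (linkFaces F v)}
    (h : Φ.g q.1 = conePoint v u m.1) : Φ.proj q = m :=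
  linkProj_conePoint m.2 h

/-- The link at positive height is a retract of the punctured chart domain. So a simplicial cycle of
the link that bounds in the punctured chart domain is zero. -/
theorem simp_eq_zero (hF : DownClosed F) (hcard : ∀ s ∈ F, s.card ≤ 3)
    (u : {u : unitInterval // (u : ℝ) < Φ.ε})
    {f : Simp V} (hf : f ∈ simpFaces (linkFaces F v) 2)
    {z : Sing (carrier (linkFaces F v)) 2} (hz : push (inclMap _) 2 z = realV 2 (toOrd 2 f))
    (A : C(carrier (linkFaces F v), {q : O // q ≠ q₀}))
    (hA : ∀ m, (A m).1 = Φ.α (u, m)) (hb : ∃ b, sbd 2 b = push A 2 z) : f = 0 := by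
  obtain ⟨b, hb⟩ := exists_sbd_eq_push_comp Φ.proj hb
  have hid : Φ.proj.comp A = ContinuousMap.id _ := ContinuousMap.ext fun m =>
    Φ.proj_eq (u := u.1) (by rw [hA, Φ.g_α]; rfl)
  rw [push_push, hid, push_id] at hb
  refine simp_eq_zero_of_boundary (hF.linkFaces v) (fun s hs => ?_) hf
    ⟨push (inclMap _) 3 b, push_mem_of_forall (fun a => a.2) _, by rw [sbd_push, hb, hz]⟩
  have := hcard _ hs.2.2
  rw [Finset.card_insert_of_notMem hs.2.1] at this
  omega

theorem exists_height : ∃ u : {u : unitInterval // (u : ℝ) < Φ.ε}, u.1 ≠ 0 := by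
  refine ⟨⟨⟨Φ.ε / 2, by have := Φ.ε_pos; positivity, ?_⟩, ?_⟩, fun h => ?_⟩
  · have := Φ.ε_le; have := Φ.ε_pos; linarith
  · exact half_lt_self Φ.ε_pos
  · have := congrArg Subtype.val h
    have h0 := Φ.ε_pos
    simp at this
    linarith

/-- The height `t u`. -/
def scale (t : unitInterval) (u : {u : unitInterval // (u : ℝ) < Φ.ε}) :
    {u : unitInterval // (u : ℝ) < Φ.ε} :=
  ⟨t * u.1, lt_of_le_of_lt (mul_le_of_le_one_left u.1.2.1 t.2.2) u.2⟩

theorem continuous_scale (u : {u : unitInterval // (u : ℝ) < Φ.ε}) :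
    Continuous fun t => Φ.scale t u :=
  (continuous_mul_const u.1).subtype_mk _

/-- If the punctured chart domain is star-shaped, as at a boundary point of a surface, then the link
has no nonzero cycles. -/
theorem simp_eq_zero_of_starConvex {E : Type*} [NormedAddCommGroup E] [NormedSpace ℝ E] {O : Set E}
    {q₀ : O} (Φ : ConeChart F v O q₀) (hF : DownClosed F) (hcard : ∀ s ∈ F, s.card ≤ 3)
    {q₁ : E} (hq₁ : q₁ ∈ O \ {q₀.1}) (hstar : StarConvex ℝ q₁ (O \ {q₀.1}))
    {f : Simp V} (hf : f ∈ simpFaces (linkFaces F v) 2) (hf0 : simpBd f = 0) : f = 0 := by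
  obtain ⟨u, hu⟩ := Φ.exists_height
  obtain ⟨z, hz, hz0⟩ := exists_lift_simp (hF.linkFaces v) hf hf0
  let A : C(carrier (linkFaces F v), (O \ {q₀.1} : Set E)) :=
    ⟨fun m => ⟨Φ.slice u m, (Φ.slice u m).2, fun h => Φ.α_ne u hu m (Subtype.ext h)⟩,
      (continuous_subtype_val.comp (Φ.slice u).continuous).subtype_mk _⟩
  let B : C((O \ {q₀.1} : Set E), {q : O // q ≠ q₀}) :=
    ⟨fun q => ⟨⟨q.1, q.2.1⟩, fun h => q.2.2 (congrArg Subtype.val h)⟩,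
      (continuous_subtype_val.subtype_mk _).subtype_mk _⟩
  have hb := exists_sbd_eq_push_comp B (exists_sbd_eq_of_starConvex hq₁ hstar
    (z := push A 2 z) (by rw [sbd_push, hz0, map_zero]))
  refine Φ.simp_eq_zero hF hcard u hf hz (B.comp A) (fun m => rfl) ?_
  rwa [push_push] at hb

end ConeChart

end

noncomputable section

/-! ### Links of interior points -/

/-- The barycenter of a face has exactly that face as its support. -/
theorem exists_supp_eq {V : Type*} [Fintype V] {s : Finset V} (hs : s.Nonempty) :
    ∃ y : stdSimplex ℝ V, supp y.1 = s := by
  classical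
  have h0 : (s.card : ℝ) ≠ 0 := Nat.cast_ne_zero.2 (Finset.card_ne_zero.2 hs)
  refine ⟨⟨fun i => if i ∈ s then (s.card : ℝ)⁻¹ else 0, fun i => ?_, ?_⟩, ?_⟩
  · beta_reduce
    split_ifs <;> positivity
  · simp [h0]
  · ext i
    rw [mem_supp]
    simp [hs.ne_empty]

namespace ConeChart

variable {V E : Type*} [Fintype V] [LinearOrder V] [NormedAddCommGroup E] [NormedSpace ℝ E]
  {F : Set (Finset V)} {v : V} {O : Set E} {q₀ : O} (Φ : ConeChart F v O q₀)

/-- The slices of the cone lie in a ball contained in the chart domain, onto which the punctured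
space retracts. So it suffices that a cycle of the link bounds in the punctured space. -/
theorem simp_eq_zero_of_ball (hF : DownClosed F) (hcard : ∀ s ∈ F, s.card ≤ 3) {ρ : ℝ} (hρ : 0 < ρ)
    (hO : Metric.closedBall q₀.1 ρ ⊆ O) (hα : ∀ x, (Φ.α x).1 ∈ Metric.closedBall q₀.1 ρ)
    (u : {u : unitInterval // (u : ℝ) < Φ.ε})
    {f : Simp V} (hf : f ∈ simpFaces (linkFaces F v) 2)
    {z : Sing (carrier (linkFaces F v)) 2} (hz : push (inclMap _) 2 z = realV 2 (toOrd 2 f))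
    (A : C(carrier (linkFaces F v), ({q₀.1}ᶜ : Set E)))
    (hA : ∀ m, (A m).1 = Φ.slice u m) (hb : ∃ b, sbd 2 b = push A 2 z) : f = 0 := by
  let B : C((Metric.closedBall q₀.1 ρ \ {q₀.1} : Set E), {q : O // q ≠ q₀}) :=
    ⟨fun q => ⟨⟨q.1, hO q.2.1⟩, fun h => q.2.2 (congrArg Subtype.val h)⟩,
      (continuous_subtype_val.subtype_mk _).subtype_mk _⟩
  have hb' := exists_sbd_eq_push_comp (B.comp (squeeze q₀.1 hρ)) hb
  rw [push_push] at hb'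
  refine Φ.simp_eq_zero hF hcard u hf hz _ (fun m => Subtype.ext ?_) hb'
  have hm : (A m).1 ∈ Metric.closedBall q₀.1 ρ := by rw [hA]; exact hα _
  exact (squeeze_apply_of_mem hρ hm).trans (hA m)

/-- A nonzero cycle in the link of an interior vertex covers every face of the link. Otherwise the
cone over the cycle misses a point near the vertex, and contracting along this cone shows that
the cycle bounds in the complement of that point. -/
theorem exists_subset_of_ne_zero (hF : DownClosed F) (hcard : ∀ s ∈ F, s.card ≤ 3) {ρ : ℝ}
    (hρ : 0 < ρ) (hO : Metric.closedBall q₀.1 ρ ⊆ O)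
    (hα : ∀ x, (Φ.α x).1 ∈ Metric.closedBall q₀.1 ρ)
    {f : Simp V} (hf : f ∈ simpFaces (linkFaces F v) 2) (hf0 : simpBd f = 0) (hne : f ≠ 0)
    {s₀ : Finset V} (hs₀ : s₀ ∈ linkFaces F v) : ∃ e, f e ≠ 0 ∧ s₀ ⊆ e := by
  by_contra hcon
  refine hne ?_
  obtain ⟨u, hu⟩ := Φ.exists_height
  obtain ⟨y, hy⟩ := exists_supp_eq hs₀.1
  have hyL : y ∈ carrier (linkFaces F v) := by rw [carrier, Set.mem_ofPred_eq, hy]; exact hs₀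
  let G : Set (Finset V) := {t | t.Nonempty ∧ ∃ e, f e ≠ 0 ∧ t ⊆ e}
  have hG : DownClosed G := fun s ⟨_, e, he, hse⟩ t ht hne => ⟨hne, e, he, ht.trans hse⟩
  have hfe : ∀ e, f e ≠ 0 → e ∈ linkFaces F v ∧ e.card = 2 := fun e he =>
    hf (Finsupp.mem_support_iff.2 he)
  have hfG : f ∈ simpFaces G 2 := fun e he => by
    have h1 := Finsupp.mem_support_iff.1 he
    exact ⟨⟨(hfe e h1).1.1, e, h1, subset_rfl⟩, (hfe e h1).2⟩
  have hGL : carrier G ⊆ carrier (linkFaces F v) := fun x ⟨h1, e, he, h2⟩ =>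
    hF.linkFaces v _ (hfe e he).1 _ h2 h1
  have hyG : y ∉ carrier G := fun h => by
    have h2 : supp y.1 ∈ G := h
    rw [hy] at h2
    exact hcon h2.2
  obtain ⟨z, hz, hz0⟩ := exists_lift_simp hG hfG hf0
  let i : C(carrier G, carrier (linkFaces F v)) := ⟨Set.inclusion hGL, continuous_inclusion hGL⟩
  let a : unitInterval → carrier (linkFaces F v) → E := fun t m => Φ.α (Φ.scale t u, m)
  have ha : Continuous fun x : unitInterval × carrier (linkFaces F v) => a x.1 x.2 :=
    continuous_subtype_val.comp (Φ.α.continuous.comp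
      (((Φ.continuous_scale u).comp continuous_fst).prodMk continuous_snd))
  have ha0 : ∀ m, a 0 m = q₀ := fun m => by
    have h0 : ((0 : unitInterval) : ℝ) < Φ.ε := Φ.ε_pos
    have : Φ.scale 0 u = ⟨0, h0⟩ := Subtype.ext (zero_mul _)
    simp only [a]
    rw [this, Φ.α_zero]
  have ha1 : ∀ m, a 1 m = Φ.slice u m := fun m => by
    have : Φ.scale 1 u = u := Subtype.ext (one_mul _)
    simp only [a]
    rw [this]
    rfl
  have hainj : ∀ {t t' m m'}, t' ≠ 0 → a t m = a t' m' → m = m' := fun {t t' m m'} ht' h => by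
    have h1 := congrArg Φ.g (Subtype.ext h)
    rw [Φ.g_α, Φ.g_α] at h1
    obtain ⟨h2, h3⟩ := conePoint_inj m.2 m'.2 h1
    refine Subtype.ext (h3 ?_)
    rw [h2]
    exact mul_ne_zero ht' hu
  -- the slice at height `u` of the cone over the cycle keeps a distance `d` from the vertex
  have hcomp : IsCompact (Set.range fun m : carrier G => a 1 (i m)) := by
    have : CompactSpace (carrier G) := isCompact_iff_compactSpace.1 (isClosed_carrier hG).isCompact
    exact isCompact_range (ha.comp (continuous_const.prodMk i.continuous))
  obtain ⟨d, hd, hdisj⟩ := Metric.isOpen_iff.1 hcomp.isClosed.isOpen_compl q₀.1 (by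
    rintro ⟨m, hm⟩
    rw [← ha0 (i m)] at hm
    simp only [a] at hm
    have h1 := congrArg Φ.g (Subtype.ext hm)
    rw [Φ.g_α, Φ.g_α] at h1
    have h2 := (conePoint_inj (i m).2 (i m).2 h1).1
    simp [scale] at h2
    exact hu h2)
  have hd' : ∀ m : carrier G, d ≤ ‖a 1 (i m) - q₀‖ := fun m => by
    by_contra h
    exact hdisj (mem_ball_iff_norm.2 (not_le.1 h)) ⟨m, rfl⟩
  obtain ⟨t, ht0, ht⟩ : ∃ t : unitInterval, t ≠ 0 ∧ ‖a t ⟨y, hyL⟩ - q₀‖ < d := by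
    have hc : Continuous fun t => a t ⟨y, hyL⟩ := ha.comp (continuous_id.prodMk continuous_const)
    have h1 : ∀ᶠ t in nhds (0 : unitInterval), ‖a t ⟨y, hyL⟩ - q₀‖ < d := by
      have := hc.continuousAt (x := 0) (Metric.ball_mem_nhds _ hd)
      simp only [ha0] at this
      filter_upwards [this] with t ht
      exact mem_ball_iff_norm.1 ht
    obtain ⟨t, h2, h3⟩ := ((h1.filter_mono nhdsWithin_le_nhds).and
      (self_mem_nhdsWithin (s := ({0}ᶜ : Set unitInterval)))).exists
    exact ⟨t, h3, h2⟩
  set q₁ := a t ⟨y, hyL⟩ with hq₁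
  -- contraction along the cone, in the complement of `q₁`
  let A : C(carrier G, E) := ⟨fun m => a 1 (i m), ha.comp (continuous_const.prodMk i.continuous)⟩
  let H : ContinuousMap.Homotopy (ContinuousMap.const _ q₀.1) A :=
    { toFun := fun x => a x.1 (i x.2)
      continuous_toFun := ha.comp (continuous_fst.prodMk (i.continuous.comp continuous_snd))
      map_zero_left := fun m => ha0 (i m)
      map_one_left := fun m => rfl }
  have hH : ∀ x, H x ≠ q₁ := fun x h => by
    have h1 : x.2.1 = y := congrArg Subtype.val (hainj ht0 h)
    exact hyG (h1 ▸ x.2.2)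
  have hA1 : ∀ m, A m ≠ q₁ := fun m h => hH (1, m) ((H.apply_one m).trans h)
  have hc1 : ∀ m, ContinuousMap.const (carrier G) q₀.1 m ≠ q₁ := fun m h =>
    hH (0, m) ((H.apply_zero m).trans h)
  obtain ⟨b, hb⟩ := exists_sbd_eq_push_of_homotopy (avoidHomotopy H hH hc1 hA1).symm hz0 (by
    have hq : q₀.1 ∈ ({q₁}ᶜ : Set E) := fun h => by
      refine ht0 ?_
      have h1 : q₀.1 = q₁ := h
      rw [← ha0 ⟨y, hyL⟩] at h1
      have h2 := congrArg Φ.g (Subtype.ext h1)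
      rw [Φ.g_α, Φ.g_α] at h2
      have h3 := (conePoint_inj hyL hyL h2).1
      simp [scale] at h3
      exact (h3.resolve_right hu)
    exact exists_sbd_eq_push_const (⟨q₀.1, hq⟩ : ({q₁}ᶜ : Set E)) z)
  -- translation of `q₁` to `q₀`, and the straight homotopy back
  let Tr : C(({q₁}ᶜ : Set E), ({q₀.1}ᶜ : Set E)) :=
    ⟨fun x => ⟨x.1 + (q₀.1 - q₁), fun h => x.2 (by
      have h1 : x.1 + (q₀.1 - q₁) = q₀.1 := h
      have : x.1 - q₁ = 0 := by rw [← sub_eq_zero.2 h1]; abel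
      exact sub_eq_zero.1 this)⟩,
      (continuous_subtype_val.add continuous_const).subtype_mk _⟩
  let A' : C(carrier G, E) := ⟨fun m => A m + (q₀.1 - q₁), A.continuous.add continuous_const⟩
  let K : ContinuousMap.Homotopy A A' :=
    { toFun := fun x => A x.2 + (x.1 : ℝ) • (q₀.1 - q₁)
      continuous_toFun := by fun_prop
      map_zero_left := fun m => by simp
      map_one_left := fun m => by simp [A'] }
  have hK : ∀ x, K x ≠ q₀.1 := fun x h => by
    have h1 : A x.2 + (x.1 : ℝ) • (q₀.1 - q₁) = q₀.1 := h
    have h2 : A x.2 - q₀.1 = (x.1 : ℝ) • (q₁ - q₀.1) := by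
      rw [← neg_sub q₀.1 q₁, smul_neg, eq_neg_iff_add_eq_zero, ← sub_eq_zero.2 h1]
      abel
    have h3 : ‖A x.2 - q₀.1‖ < d := by
      rw [h2, norm_smul, Real.norm_of_nonneg x.1.2.1]
      exact lt_of_le_of_lt (mul_le_of_le_one_left (norm_nonneg _) x.1.2.2) ht
    exact absurd (hd' x.2) (not_le.2 h3)
  have hA0 : ∀ m, A m ≠ q₀.1 := fun m h => hK (0, m) ((K.apply_zero m).trans h)
  have hA'0 : ∀ m, A' m ≠ q₀.1 := fun m h => hK (1, m) ((K.apply_one m).trans h)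
  obtain ⟨b', hb'⟩ := exists_sbd_eq_push_of_homotopy (avoidHomotopy K hK hA0 hA'0) hz0 (by
    have := exists_sbd_eq_push_comp Tr ⟨b, hb⟩
    rw [push_push] at this
    exact this)
  refine Φ.simp_eq_zero_of_ball hF hcard hρ hO hα u hf (z := push i 2 z) ?_
    (avoid (⟨fun m => Φ.slice u m, continuous_subtype_val.comp (Φ.slice u).continuous⟩ :
      C(carrier (linkFaces F v), E)) fun m h => Φ.α_ne u hu m (Subtype.ext h)) (fun m => rfl)
    ⟨b', ?_⟩
  · rw [push_push]
    exact hz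
  · rw [hb', push_push]
    congr 2
    exact ContinuousMap.ext fun m => Subtype.ext (ha1 (i m))

end ConeChart

end

noncomputable section

/-! ### A cycle around an interior vertex -/

/-- The proper faces of a triangle. -/
def triangleBoundary : Set (Finset (Fin 3)) := {t | t.Nonempty ∧ t ≠ Finset.univ}

theorem downClosed_triangleBoundary : DownClosed triangleBoundary := fun _ hs _ ht hne =>
  ⟨hne, fun h => hs.2 (Finset.univ_subset_iff.1 (h ▸ ht))⟩

/-- The sum of the three edges of a triangle. -/
abbrev triangleCycle : Simp (Fin 3) := simpBd (Finsupp.single Finset.univ 1)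

theorem triangleCycle_mem : triangleCycle ∈ simpFaces triangleBoundary 2 := by
  rw [triangleCycle, simpBd_single]
  refine Submodule.sum_mem _ fun x _ => single_mem_supported ?_
  have h : (Finset.univ.erase x : Finset (Fin 3)).card = 2 := by
    rw [Finset.card_erase_of_mem (Finset.mem_univ x)]; rfl
  exact ⟨⟨Finset.card_pos.1 (by omega), fun h' => by simp [h'] at h⟩, h⟩

theorem simpBd_triangleCycle : simpBd triangleCycle = 0 := by
  have h : Finsupp.single (Finset.univ : Finset (Fin 3)) (1 : ZMod 2) =
      toSimp 3 (Finsupp.single id 1) := by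
    rw [toSimp_single, Finset.image_id, if_pos (by simp)]
  rw [triangleCycle, h, ← toSimp_bd, ← toSimp_bd, bd_bd, map_zero]

/-- The boundary of a triangle does not bound in its carrier. -/
theorem not_exists_sbd_eq_triangle {z : Sing (carrier triangleBoundary) 2}
    (hz : push (inclMap _) 2 z = realV 2 (toOrd 2 triangleCycle)) : ¬ ∃ b, sbd 2 b = z := by
  rintro ⟨b, hb⟩
  refine simpBd_single_ne_zero Finset.univ_nonempty
    (simp_eq_zero_of_boundary downClosed_triangleBoundary (fun s hs => ?_) triangleCycle_mem
      ⟨push (inclMap _) 3 b, push_mem_of_forall (fun a => a.2) _, by rw [sbd_push, hb, hz]⟩)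
  have := (Finset.card_lt_iff_ne_univ s).2 hs.2
  rw [Fintype.card_fin] at this
  omega

/-- An affine embedding of the triangle in the plane that sends its barycenter to the origin. -/
def planeVector (m : stdSimplex ℝ (Fin 3)) : EuclideanSpace ℝ (Fin 2) := !₂[m 0 - m 2, m 1 - m 2]

theorem continuous_planeVector : Continuous planeVector := by
  have hc : ∀ i, Continuous fun m : stdSimplex ℝ (Fin 3) => m i := fun i =>
    (continuous_apply i).comp continuous_subtype_val
  refine (PiLp.continuous_toLp 2 _).comp (continuous_pi fun i => ?_)
  fin_cases i
  · exact (hc 0).sub (hc 2)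
  · exact (hc 1).sub (hc 2)

theorem norm_planeVector_le (m : stdSimplex ℝ (Fin 3)) : ‖planeVector m‖ ≤ 2 := by
  rw [EuclideanSpace.norm_eq, Real.sqrt_le_left (by norm_num)]
  have h : ∀ i j, |m i - m j| ≤ 1 := fun i j => by
    have := stdSimplex.zero_le m i
    have := stdSimplex.zero_le m j
    have := stdSimplex.le_one m i
    have := stdSimplex.le_one m j
    rw [abs_le]
    constructor <;> linarith
  have h2 : ∀ i j, |m i - m j| ^ 2 ≤ 1 := fun i j => pow_le_one₀ (abs_nonneg _) (h i j)
  simp only [planeVector, Fin.sum_univ_two, Real.norm_eq_abs]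
  change |m 0 - m 2| ^ 2 + |m 1 - m 2| ^ 2 ≤ 2 ^ 2
  linarith [h2 0 2, h2 1 2]

/-- The homogeneous barycentric coordinates, with sum zero, that invert `planeVector` up to the shift
by the barycenter. -/
def zeroSumCoord (x : EuclideanSpace ℝ (Fin 2)) : Fin 3 → ℝ :=
  ![x 0 - (x 0 + x 1) / 3, x 1 - (x 0 + x 1) / 3, - ((x 0 + x 1) / 3)]

theorem continuous_zeroSumCoord (i : Fin 3) : Continuous fun x => zeroSumCoord x i := by
  have hc : ∀ i, Continuous fun x : EuclideanSpace ℝ (Fin 2) => x i := fun i => by fun_prop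
  have h0 := hc 0
  have h1 := hc 1
  fin_cases i
  · exact h0.sub ((h0.add h1).div_const 3)
  · exact h1.sub ((h0.add h1).div_const 3)
  · exact ((h0.add h1).div_const 3).neg

theorem zeroSumCoord_planeVector (m : stdSimplex ℝ (Fin 3)) (η : ℝ) (i : Fin 3) :
    zeroSumCoord (η • planeVector m) i = η * (m i - 1 / 3) := by
  have h := stdSimplex.sum_eq_one m
  rw [Fin.sum_univ_three] at h
  have h2 : m 2 = 1 - m 0 - m 1 := by linarith
  have e0 : (η • planeVector m) 0 = η * (m 0 - m 2) := rfl
  have e1 : (η • planeVector m) 1 = η * (m 1 - m 2) := rfl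
  rw [zeroSumCoord, e0, e1, h2]
  fin_cases i
  · simp; ring
  · simp; ring
  · simp [h2]; ring

/-- The least of the coordinates. -/
def minCoord (x : EuclideanSpace ℝ (Fin 2)) : ℝ :=
  min (zeroSumCoord x 0) (min (zeroSumCoord x 1) (zeroSumCoord x 2))

theorem minCoord_le (x : EuclideanSpace ℝ (Fin 2)) (i : Fin 3) : minCoord x ≤ zeroSumCoord x i := by
  fin_cases i
  · exact min_le_left _ _
  · exact (min_le_right _ _).trans (min_le_left _ _)
  · exact (min_le_right _ _).trans (min_le_right _ _)

theorem exists_minCoord_eq (x : EuclideanSpace ℝ (Fin 2)) : ∃ i, minCoord x = zeroSumCoord x i := by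
  rcases min_choice (zeroSumCoord x 0) (min (zeroSumCoord x 1) (zeroSumCoord x 2)) with h | h
  · exact ⟨0, h⟩
  · rcases min_choice (zeroSumCoord x 1) (zeroSumCoord x 2) with h' | h'
    · exact ⟨1, h.trans h'⟩
    · exact ⟨2, h.trans h'⟩

theorem sum_zeroSumCoord (x : EuclideanSpace ℝ (Fin 2)) : ∑ i, zeroSumCoord x i = 0 := by
  rw [Fin.sum_univ_three]
  simp [zeroSumCoord]
  ring

theorem minCoord_neg {x : EuclideanSpace ℝ (Fin 2)} (hx : x ≠ 0) : minCoord x < 0 := by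
  by_contra h
  have h0 : ∀ i, 0 ≤ zeroSumCoord x i := fun i => (not_lt.1 h).trans (minCoord_le x i)
  have h1 := (Finset.sum_eq_zero_iff_of_nonneg fun i _ => h0 i).1 (sum_zeroSumCoord x)
  have e0 : x 0 - (x 0 + x 1) / 3 = 0 := h1 0 (Finset.mem_univ _)
  have e1 : x 1 - (x 0 + x 1) / 3 = 0 := h1 1 (Finset.mem_univ _)
  refine hx ?_
  ext i
  fin_cases i
  · change x 0 = 0; linarith
  · change x 1 = 0; linarith

/-- The radial projection of the punctured plane onto the boundary of the triangle. -/
def triangleProj : C({x : EuclideanSpace ℝ (Fin 2) // x ≠ 0}, carrier triangleBoundary) where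
  toFun x := ⟨⟨fun i => 1 / 3 + zeroSumCoord x.1 i / (-3 * minCoord x.1), by
    have h := minCoord_neg x.2
    refine ⟨fun i => ?_, ?_⟩
    · have h1 : (-1 / 3 : ℝ) ≤ zeroSumCoord x.1 i / (-3 * minCoord x.1) := by
        rw [le_div_iff₀ (by linarith)]
        linarith [minCoord_le x.1 i]
      beta_reduce
      linarith
    · rw [Finset.sum_add_distrib, ← Finset.sum_div Finset.univ (zeroSumCoord x.1),
        sum_zeroSumCoord]
      simp⟩, supp_nonempty _, fun hs => by
    have h := minCoord_neg x.2
    obtain ⟨i, hi⟩ := exists_minCoord_eq x.1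
    refine mem_supp.1 (hs ▸ Finset.mem_univ i : i ∈ _) ?_
    change 1 / 3 + zeroSumCoord x.1 i / (-3 * minCoord x.1) = 0
    rw [← hi]
    have h' := h.ne
    field_simp
    norm_num⟩
  continuous_toFun := by
    have h1 : ∀ i, Continuous fun x : {x : EuclideanSpace ℝ (Fin 2) // x ≠ 0} =>
        zeroSumCoord x.1 i := fun i => (continuous_zeroSumCoord i).comp continuous_subtype_val
    have h2 : Continuous fun x : {x : EuclideanSpace ℝ (Fin 2) // x ≠ 0} => minCoord x.1 :=
      (h1 0).min ((h1 1).min (h1 2))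
    refine Continuous.subtype_mk (Continuous.subtype_mk (continuous_pi fun i =>
      continuous_const.add ((h1 i).div (continuous_const.mul h2) fun x => ?_)) _) _
    exact mul_ne_zero (by norm_num) (minCoord_neg x.2).ne

theorem exists_apply_eq_zero {m : stdSimplex ℝ (Fin 3)} (hm : m ∈ carrier triangleBoundary) :
    ∃ i, m i = 0 := by
  by_contra! h
  exact hm.2 (Finset.eq_univ_of_forall fun i => mem_supp.2 (h i))

theorem planeVector_ne_zero {m : stdSimplex ℝ (Fin 3)} (hm : m ∈ carrier triangleBoundary)
    {η : ℝ} (hη : 0 < η) : η • planeVector m ≠ 0 := by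
  intro h
  obtain ⟨i, hi⟩ := exists_apply_eq_zero hm
  have h1 := zeroSumCoord_planeVector m η i
  rw [h, hi] at h1
  have h2 : zeroSumCoord 0 i = 0 := by fin_cases i <;> simp [zeroSumCoord]
  rw [h2] at h1
  linarith

theorem triangleProj_planeVector {m : stdSimplex ℝ (Fin 3)} (hm : m ∈ carrier triangleBoundary)
    {η : ℝ} (hη : 0 < η) :
    triangleProj ⟨η • planeVector m, planeVector_ne_zero hm hη⟩ = ⟨m, hm⟩ := by
  have hmin : minCoord (η • planeVector m) = - (η / 3) := by
    obtain ⟨i, hi⟩ := exists_apply_eq_zero hm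
    refine le_antisymm ((minCoord_le _ i).trans ?_) ?_
    · rw [zeroSumCoord_planeVector, hi]; linarith
    · obtain ⟨j, hj⟩ := exists_minCoord_eq (η • planeVector m)
      rw [hj, zeroSumCoord_planeVector]
      have := mul_nonneg hη.le (stdSimplex.zero_le m j)
      linarith
  refine Subtype.ext ?_
  ext i
  change 1 / 3 + zeroSumCoord (η • planeVector m) i / (-3 * minCoord (η • planeVector m)) = m i
  rw [hmin, zeroSumCoord_planeVector]
  field_simp
  ring

namespace ConeChart

variable {V : Type*} [Fintype V] [LinearOrder V] {F : Set (Finset V)} {v : V}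
  {O : Set (EuclideanSpace ℝ (Fin 2))} {q₀ : O}

/-- The link of an interior vertex contains a nonzero cycle: a small triangle around the vertex is
homotopic, in the punctured chart domain, to its radial projection to the link, and it does not
bound there. -/
theorem exists_cycle (Φ : ConeChart F v O q₀) (hF : DownClosed F) {ρ : ℝ} (hρ : 0 < ρ)
    (hO : Metric.closedBall q₀.1 ρ ⊆ O) :
    ∃ f ∈ simpFaces (linkFaces F v) 2, simpBd f = 0 ∧ f ≠ 0 := by
  by_contra hcon
  push Not at hcon
  obtain ⟨u, hu⟩ := Φ.exists_height
  obtain ⟨z, hz, hz0⟩ := exists_lift_simp downClosed_triangleBoundary triangleCycle_mem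
    simpBd_triangleCycle
  -- points close to the vertex have small height
  obtain ⟨δ, hδ, hδ'⟩ : ∃ δ > 0, ∀ x : O, dist x q₀ < δ → 1 - Φ.ε < Φ.g x v := by
    have hc : Continuous fun x : O => Φ.g x v :=
      (continuous_apply v).comp (continuous_subtype_val.comp Φ.g.continuous)
    have h1 : 1 - Φ.ε < Φ.g q₀ v := by
      rw [Φ.g_base]
      simpa using Φ.ε_pos
    exact Metric.eventually_nhds_iff.1 (hc.continuousAt.eventually (lt_mem_nhds h1))
  let η := min ρ (δ / 2) / 2
  have hmin : 0 < min ρ (δ / 2) := lt_min hρ (half_pos hδ)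
  have hη : 0 < η := half_pos hmin
  have hnorm : ∀ m, ‖η • planeVector m‖ ≤ min ρ (δ / 2) := fun m => by
    rw [norm_smul, Real.norm_of_nonneg hη.le]
    calc η * ‖planeVector m‖ ≤ η * 2 := by gcongr; exact norm_planeVector_le m
      _ = min ρ (δ / 2) := by simp [η]
  let κ : C(carrier triangleBoundary, {q : O // q ≠ q₀}) :=
    ⟨fun m => ⟨⟨q₀.1 + η • planeVector m.1, hO (by
        rw [mem_closedBall_iff_norm, add_sub_cancel_left]
        exact (hnorm m.1).trans (min_le_left _ _))⟩, fun h =>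
          planeVector_ne_zero m.2 hη (add_eq_left.1 (congrArg Subtype.val h))⟩,
      ((continuous_const.add ((continuous_planeVector.comp
        continuous_subtype_val).const_smul η)).subtype_mk _).subtype_mk _⟩
  have hκ : ∀ m, 1 - Φ.ε < Φ.g (κ m).1 v := fun m => hδ' _ (by
    rw [Subtype.dist_eq, dist_eq_norm]
    change ‖q₀.1 + η • planeVector m.1 - q₀.1‖ < δ
    rw [add_sub_cancel_left]
    exact ((hnorm m.1).trans (min_le_right _ _)).trans_lt (half_lt_self hδ))
  -- the projection of the triangle to the link bounds, since the link has no nonzero cycles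
  set w := push (Φ.proj.comp κ) 2 z with hw
  have hw0 : sbd 1 w = 0 := by rw [hw, sbd_push, hz0, map_zero]
  obtain ⟨f, hf, hf0, b, hb, hbf⟩ := exists_simp_homologous (hF.linkFaces v) (p := 1)
    (z := push (inclMap _) 2 w) (push_mem_of_forall (fun a => a.2) _)
    (by rw [sbd_push, hw0, map_zero])
  rw [hcon f hf hf0, map_zero, map_zero, add_zero] at hbf
  have hbw := exists_sbd_eq_of_mem hb hbf
  -- the radial homotopy from the triangle to a slice of the cone
  let A : C(carrier (linkFaces F v), {q : O // q ≠ q₀}) :=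
    ⟨fun m => ⟨Φ.slice u m, Φ.α_ne u hu m⟩, (Φ.slice u).continuous.subtype_mk _⟩
  let h : unitInterval × carrier triangleBoundary → {u : unitInterval // (u : ℝ) < Φ.ε} := fun x =>
    ⟨⟨(1 - x.1) * height v (Φ.g (κ x.2).1) + x.1 * u.1, (convex_Icc (0 : ℝ) 1)
      (height v (Φ.g (κ x.2).1)).2 u.1.2 (sub_nonneg.2 x.1.2.2) x.1.2.1 (sub_add_cancel _ _)⟩,
      (convex_Iio Φ.ε) (show (height v (Φ.g (κ x.2).1) : ℝ) < Φ.ε from by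
        have := hκ x.2
        change 1 - Φ.g (κ x.2).1 v < Φ.ε
        linarith) u.2 (sub_nonneg.2 x.1.2.2) x.1.2.1 (sub_add_cancel _ _)⟩
  have hhc : Continuous h := by
    have h1 : Continuous fun x : unitInterval × carrier triangleBoundary =>
        (height v (Φ.g (κ x.2).1) : ℝ) := continuous_subtype_val.comp ((continuous_height v).comp
      (Φ.g.continuous.comp (continuous_subtype_val.comp (κ.continuous.comp continuous_snd))))
    have h2 : Continuous fun x : unitInterval × carrier triangleBoundary => (x.1 : ℝ) :=
      continuous_subtype_val.comp continuous_fst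
    exact ((((continuous_const.sub h2).mul h1).add
      (h2.mul continuous_const)).subtype_mk _).subtype_mk _
  have hh0 : ∀ x, (h x).1 ≠ 0 := fun x hx => by
    have h1 : (0 : ℝ) < height v (Φ.g (κ x.2).1) := sub_pos.2 (Φ.g_apply_lt (κ x.2).2)
    have h2 : (0 : ℝ) < u.1 := lt_of_le_of_ne u.1.2.1 fun h => hu (Subtype.ext h.symm)
    have h3 := (convex_Ioi (0 : ℝ)) h1 h2 (sub_nonneg.2 x.1.2.2) x.1.2.1 (sub_add_cancel _ _)
    exact h3.ne' (congrArg Subtype.val hx)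
  let H : ContinuousMap.Homotopy κ (A.comp (Φ.proj.comp κ)) :=
    { toFun := fun x => ⟨Φ.α (h x, Φ.proj (κ x.2)), Φ.α_ne _ (hh0 x) _⟩
      continuous_toFun := (Φ.α.continuous.comp (hhc.prodMk (Φ.proj.continuous.comp
        (κ.continuous.comp continuous_snd)))).subtype_mk _
      map_zero_left := fun m => by
        refine Subtype.ext (Φ.g_inj ?_)
        rw [Φ.g_α]
        have e : (h (0, m)).1 = height v (Φ.g (κ m).1) := Subtype.ext (by simp [h])
        change conePoint v (h (0, m)).1 _ = _
        rw [e]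
        exact conePoint_linkProj ⟨Φ.g (κ m).1, Φ.g_mem _, Φ.g_pos _, Φ.g_apply_lt (κ m).2⟩
      map_one_left := fun m => by
        refine Subtype.ext ?_
        have e : h (1, m) = u := Subtype.ext (Subtype.ext (by simp [h]))
        change Φ.α (h (1, m), _) = Φ.α (u, _)
        rw [e]
        rfl }
  have hb2 := exists_sbd_eq_push_of_homotopy H hz0 (by
    have := exists_sbd_eq_push_comp A hbw
    rw [hw, push_push] at this
    exact this)
  -- the projection of the punctured plane to the triangle
  let P : C({q : O // q ≠ q₀}, carrier triangleBoundary) :=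
    triangleProj.comp ⟨fun q => ⟨q.1.1 - q₀.1, fun h => q.2 (Subtype.ext (sub_eq_zero.1 h))⟩,
      ((continuous_subtype_val.comp continuous_subtype_val).sub continuous_const).subtype_mk _⟩
  have hP : P.comp κ = ContinuousMap.id _ := ContinuousMap.ext fun m => by
    refine Eq.trans ?_ (triangleProj_planeVector m.2 hη)
    exact congrArg triangleProj (Subtype.ext (add_sub_cancel_left _ _))
  have hb3 := exists_sbd_eq_push_comp P hb2
  rw [push_push, hP, push_id] at hb3
  exact not_exists_sbd_eq_triangle hz hb3

end ConeChart

end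

noncomputable section

/-! ### The links of a triangulated surface -/

theorem dist_conePoint_vertex_le {V : Type*} [Fintype V] [DecidableEq V] (v : V)
    (u : unitInterval) (m : stdSimplex ℝ V) :
    dist (conePoint v u m) (stdSimplex.vertex v) ≤ u := by
  rw [Subtype.dist_eq, dist_pi_le_iff u.2.1]
  intro i
  change |conePoint v u m i - (Pi.single v 1 : V → ℝ) i| ≤ u
  have h : conePoint v u m i - (Pi.single v 1 : V → ℝ) i = u * (m i - (Pi.single v 1 : V → ℝ) i) := by
    rw [conePoint_apply]; ring
  rw [h, abs_mul, abs_of_nonneg u.2.1]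
  refine mul_le_of_le_one_right u.2.1 ?_
  have h0 := stdSimplex.zero_le m i
  have h1 := stdSimplex.le_one m i
  rcases eq_or_ne i v with rfl | hiv
  · rw [Pi.single_eq_same, abs_le]; constructor <;> linarith
  · rw [Pi.single_eq_of_ne hiv, abs_le]; constructor <;> linarith

variable {V : Type*} [Fintype V] [LinearOrder V] {F : Set (Finset V)} {S : Type*}
  [TopologicalSpace S] [ChartedSpace (EuclideanHalfSpace 2) S]

/-- A surface homeomorphic to the carrier of `F` has cone charts at the vertices, on arbitrarily
small half-balls. -/
theorem exists_coneChart (e : carrier F ≃ₜ S) (hF : DownClosed F) {v : V}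
    (hv : stdSimplex.vertex v ∈ carrier F) {q : EuclideanSpace ℝ (Fin 2)}
    (hq : q = extChartAt (𝓡∂ 2) (e ⟨_, hv⟩) (e ⟨_, hv⟩)) {r₀ : ℝ} (hr₀ : 0 < r₀) :
    ∃ r > 0, r ≤ r₀ ∧ ∃ hqr : q ∈ Metric.ball q r ∩ Set.range (𝓡∂ 2),
      ∃ Φ : ConeChart F v (Metric.ball q r ∩ Set.range (𝓡∂ 2)) ⟨q, hqr⟩,
        ∀ x, (Φ.α x).1 ∈ Metric.closedBall q (r / 2) := by
  set p : S := e ⟨_, hv⟩ with hp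
  set φ := extChartAt (𝓡∂ 2) p with hφ
  have hqt : q ∈ φ.target := hq ▸ mem_extChartAt_target p
  have hqp : φ.symm q = p := by rw [hq]; exact extChartAt_to_inv p
  let ψ : EuclideanSpace ℝ (Fin 2) → carrier F := fun x => e.symm (φ.symm x)
  have hψ : ContinuousOn ψ φ.target := e.symm.continuous.comp_continuousOn
    (continuousOn_extChartAt_symm p)
  have hψq : ψ q = ⟨_, hv⟩ := by simp only [ψ]; rw [hqp, hp, e.symm_apply_apply]
  have hcv : Continuous fun x : carrier F => x.1 v :=
    (continuous_apply v).comp (continuous_subtype_val.comp continuous_subtype_val)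
  have hU : φ.target ∩ {x | 0 < (ψ x).1 v} ∈ nhdsWithin q (Set.range (𝓡∂ 2)) := by
    have h1 : φ.target ∈ nhdsWithin q (Set.range (𝓡∂ 2)) :=
      hq ▸ extChartAt_target_mem_nhdsWithin p
    have h2 : {x | 0 < (ψ x).1 v} ∈ nhdsWithin q φ.target :=
      (hcv.continuousAt.comp_continuousWithinAt (hψ q hqt)).eventually (lt_mem_nhds (by
        rw [Function.comp_apply, hψq]; simp))
    have h3 : nhdsWithin q φ.target = nhdsWithin q (Set.range (𝓡∂ 2)) :=
      nhdsWithin_extChartAt_target_eq_of_mem hqt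
    exact Filter.inter_mem h1 (h3 ▸ h2)
  obtain ⟨r₁, hr₁, hr₁U⟩ := Metric.mem_nhdsWithin_iff.1 hU
  set r := min r₀ r₁ with hrdef
  have hr : 0 < r := lt_min hr₀ hr₁
  have hrU : Metric.ball q r ∩ Set.range (𝓡∂ 2) ⊆ φ.target ∩ {x | 0 < (ψ x).1 v} :=
    (Set.inter_subset_inter_left _ (Metric.ball_subset_ball (min_le_right _ _))).trans hr₁U
  have hqr : q ∈ Metric.ball q r ∩ Set.range (𝓡∂ 2) :=
    ⟨Metric.mem_ball_self hr, extChartAt_target_subset_range p hqt⟩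
  have hχ : ∀ᶠ x in nhds (⟨_, hv⟩ : carrier F),
      e x ∈ φ.source ∧ φ (e x) ∈ Metric.ball q (r / 2) := by
    have h1 : φ.source ∈ nhds (e ⟨_, hv⟩) := extChartAt_source_mem_nhds p
    have h2 : Filter.Tendsto φ (nhds (e ⟨_, hv⟩)) (nhds q) := hq ▸ continuousAt_extChartAt p
    have h3 := e.continuous.continuousAt (x := ⟨_, hv⟩)
    exact (h3.eventually h1).and ((h2.comp h3).eventually (Metric.ball_mem_nhds q (half_pos hr)))
  obtain ⟨ε, hε, hε'⟩ := Metric.eventually_nhds_iff.1 hχ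
  let c : {u : unitInterval // (u : ℝ) < min ε 1} × carrier (linkFaces F v) → carrier F := fun x =>
    ⟨conePoint v x.1.1 x.2.1, conePoint_mem hF x.2.2 _⟩
  have hc : Continuous c := ((continuous_conePoint v).comp
    ((continuous_subtype_val.comp continuous_fst).prodMk
      (continuous_subtype_val.comp continuous_snd))).subtype_mk _
  have hcε : ∀ x, e (c x) ∈ φ.source ∧ φ (e (c x)) ∈ Metric.ball q (r / 2) := fun x =>
    hε' ((dist_conePoint_vertex_le v x.1.1 x.2.1).trans_lt (x.1.2.trans_le (min_le_left _ _)))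
  refine ⟨r, hr, min_le_left _ _, hqr,
    { g := ⟨fun x => (ψ x.1).1, continuous_subtype_val.comp
        (hψ.comp_continuous continuous_subtype_val fun x => (hrU x.2).1)⟩
      g_mem := fun x => (ψ x.1).2
      g_pos := fun x => (hrU x.2).2
      g_inj := fun x y h => Subtype.ext (φ.symm.injOn (hrU x.2).1 (hrU y.2).1
        (e.symm.injective (Subtype.ext h)))
      g_base := congrArg Subtype.val hψq
      ε := min ε 1
      ε_pos := lt_min hε one_pos
      ε_le := min_le_right _ _
      α := ⟨fun x => ⟨φ (e (c x)), Metric.ball_subset_ball (half_le_self hr.le) (hcε x).2,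
          extChartAt_target_subset_range p (φ.map_source (hcε x).1)⟩,
        ((continuousOn_extChartAt p).comp_continuous (e.continuous.comp hc)
          fun x => (hcε x).1).subtype_mk _⟩
      g_α := fun x => by
        change (e.symm (φ.symm (φ (e (c x))))).1 = (c x).1
        rw [φ.left_inv (hcε x).1, e.symm_apply_apply] }, fun x => ?_⟩
  exact Metric.ball_subset_closedBall (hcε x).2

/-- The links in a triangulated surface whose vertices lie on the boundary, or which has no
boundary. -/
theorem surfaceLinks_of_homeomorph (e : carrier F ≃ₜ S) (hF : DownClosed F)
    (hcard : ∀ s ∈ F, s.card ≤ 3) (hvert : ∀ v, stdSimplex.vertex v ∈ carrier F)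
    (hproper : ((𝓡∂ 2).boundary S).Nonempty → ∀ v, e ⟨_, hvert v⟩ ∈ (𝓡∂ 2).boundary S) :
    SurfaceLinks F := by
  by_cases hbd : ((𝓡∂ 2).boundary S).Nonempty
  · refine Or.inl fun v f hf hf0 => ?_
    have hv : extChartAt (𝓡∂ 2) (e ⟨_, hvert v⟩) (e ⟨_, hvert v⟩) ∈ frontier (Set.range (𝓡∂ 2)) :=
      hproper hbd v
    obtain ⟨r, hr, -, hqr, Φ, -⟩ := exists_coneChart e hF (hvert v) rfl one_pos
    set q := extChartAt (𝓡∂ 2) (e ⟨_, hvert v⟩) (e ⟨_, hvert v⟩) with hq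
    rw [frontier_range_modelWithCornersEuclideanHalfSpace] at hv
    have hq0 : q 0 = 0 := Eq.symm hv
    have hI : Set.range (𝓡∂ 2) = {y : EuclideanSpace ℝ (Fin 2) | 0 ≤ y 0} :=
      range_modelWithCornersEuclideanHalfSpace 2
    -- the half-ball without its center is star-shaped about a point above the center
    let q₁ : EuclideanSpace ℝ (Fin 2) := q + EuclideanSpace.single 0 (r / 2)
    have hq₁ : q₁ 0 = r / 2 := by simp [q₁, hq0]
    have hq₁O : q₁ ∈ Metric.ball q r ∩ Set.range (𝓡∂ 2) := by
      constructor
      · rw [mem_ball_iff_norm, add_sub_cancel_left, PiLp.norm_single,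
          Real.norm_of_nonneg (half_pos hr).le]
        exact half_lt_self hr
      · rw [hI, Set.mem_ofPred_eq, hq₁]
        exact (half_pos hr).le
    have hconv : Convex ℝ (Metric.ball q r ∩ Set.range (𝓡∂ 2)) :=
      (convex_ball q r).inter (𝓡∂ 2).convex_range
    refine Φ.simp_eq_zero_of_starConvex hF hcard (q₁ := q₁) ⟨hq₁O, fun h => ?_⟩ ?_ hf hf0
    · have h1 : q₁ = q := h
      rw [h1, hq0] at hq₁
      linarith
    · intro x hx a b ha hb hab
      refine ⟨hconv hq₁O hx.1 ha hb hab, fun h => ?_⟩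
      have h1 : a • q₁ + b • x = q := h
      have h2 : a * (r / 2) + b * x 0 = 0 := by
        have := congrArg (fun y : EuclideanSpace ℝ (Fin 2) => y 0) h1
        simpa [hq₁, hq0] using this
      have hx0 : 0 ≤ x 0 := by
        have := hx.1.2
        rwa [hI] at this
      have ha0 : a = 0 := by
        by_contra hne
        have := mul_pos (lt_of_le_of_ne ha (Ne.symm hne)) (half_pos hr)
        have := mul_nonneg hb hx0
        linarith
      have hb1 : b = 1 := by linarith
      rw [ha0, hb1, zero_smul, zero_add, one_smul] at h1
      exact hx.2 h1
  · have hint : ∀ v, ∃ ρ > 0, ∃ (O : Set (EuclideanSpace ℝ (Fin 2))) (q₀ : O)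
        (Φ : ConeChart F v O q₀), Metric.closedBall q₀.1 ρ ⊆ O ∧
          ∀ x, (Φ.α x).1 ∈ Metric.closedBall q₀.1 ρ := fun v => by
      have hv : (𝓡∂ 2).IsInteriorPoint (e ⟨_, hvert v⟩) := by
        rw [ModelWithCorners.isInteriorPoint_iff_not_isBoundaryPoint]
        exact fun h => hbd ⟨_, h⟩
      obtain ⟨r₀, hr₀, hball⟩ := Metric.mem_nhds_iff.1 (range_mem_nhds_isInteriorPoint hv)
      obtain ⟨r, hr, hrr, hqr, Φ, hα⟩ := exists_coneChart e hF (hvert v) rfl hr₀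
      refine ⟨r / 2, half_pos hr, _, _, Φ, fun x hx => ?_, hα⟩
      have hx' : x ∈ Metric.ball _ r := Metric.closedBall_subset_ball (half_lt_self hr) hx
      exact ⟨hx', hball (Metric.ball_subset_ball hrr hx')⟩
    refine Or.inr ⟨fun v f hf hf0 hne s hs => ?_, fun v => ?_⟩
    · obtain ⟨ρ, hρ, O, q₀, Φ, hO, hα⟩ := hint v
      exact Φ.exists_subset_of_ne_zero hF hcard hρ hO hα hf hf0 hne hs
    · obtain ⟨ρ, hρ, O, q₀, Φ, hO, -⟩ := hint v
      exact Φ.exists_cycle hF hρ hO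

end

noncomputable section

/-! ### Comparison with the singular homology functor -/

open CategoryTheory Simplicial

/-- The singular chain complex with coefficients in `ℤ/2`. -/
abbrev chainsZ2 (X : TopCat.{0}) : ChainComplex (ModuleCat.{0} (ZMod 2)) ℕ :=
  (TopCat.toSSet.obj X).chainComplex (ModuleCat.of (ZMod 2) (ZMod 2))

/-- A continuous map on a simplex with `p + 1` vertices, as a `p`-simplex of the singular set. -/
def singSimplex (X : TopCat.{0}) {p : ℕ} :
    C(stdSimplex ℝ (Fin (p + 1)), X) ≃ (TopCat.toSSet.obj X) _⦋p⦌ :=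
  (X.toSSetObjEquiv (Opposite.op ⦋p⦌)).symm

/-- The basis element of the chain complex given by a singular simplex. -/
abbrev basisChain (X : TopCat.{0}) {p : ℕ} (x : (TopCat.toSSet.obj X) _⦋p⦌) : (chainsZ2 X).X p :=
  ((TopCat.toSSet.obj X).ιChainComplex (R := ModuleCat.of (ZMod 2) (ZMod 2)) x).hom (1 : ZMod 2)

/-- Chains as elements of the singular chain complex. -/
def toChains (X : TopCat.{0}) (p : ℕ) : Sing X (p + 1) →ₗ[ZMod 2] (chainsZ2 X).X p :=
  Finsupp.linearCombination (ZMod 2) fun σ => basisChain X (singSimplex X σ)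

@[simp] theorem toChains_single (X : TopCat.{0}) {p : ℕ} (σ : C(stdSimplex ℝ (Fin (p + 1)), X)) :
    toChains X p (Finsupp.single σ 1) = basisChain X (singSimplex X σ) := by
  simp [toChains]

/-- The inverse of `toChains`. -/
def ofChains (X : TopCat.{0}) (p : ℕ) :
    (chainsZ2 X).X p ⟶ ModuleCat.of (ZMod 2) (Sing X (p + 1)) :=
  ((TopCat.toSSet.obj X).isColimitChainComplexXCofan (ModuleCat.of (ZMod 2) (ZMod 2)) p).desc
    (Limits.Cofan.mk _ fun x => ModuleCat.ofHom
      (LinearMap.toSpanSingleton (ZMod 2) (Sing X (p + 1))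
        (Finsupp.single ((singSimplex X).symm x) 1)))

theorem ofChains_basisChain (X : TopCat.{0}) {p : ℕ} (x : (TopCat.toSSet.obj X) _⦋p⦌) :
    (ofChains X p).hom (basisChain X x) = Finsupp.single ((singSimplex X).symm x) 1 := by
  have h := ((TopCat.toSSet.obj X).isColimitChainComplexXCofan
    (ModuleCat.of (ZMod 2) (ZMod 2)) p).fac (Limits.Cofan.mk _ fun x => ModuleCat.ofHom
      (LinearMap.toSpanSingleton (ZMod 2) (Sing X (p + 1))
        (Finsupp.single ((singSimplex X).symm x) 1))) ⟨x⟩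
  have h1 := congrArg (fun f => f.hom (1 : ZMod 2)) h
  refine h1.trans ?_
  exact one_smul _ _

theorem ofChains_toChains (X : TopCat.{0}) {p : ℕ} (z : Sing X (p + 1)) :
    (ofChains X p).hom (toChains X p z) = z := by
  suffices h : (ofChains X p).hom ∘ₗ toChains X p = LinearMap.id from LinearMap.congr_fun h z
  refine linearMap_ext_single fun σ => ?_
  rw [LinearMap.comp_apply, toChains_single, ofChains_basisChain, Equiv.symm_apply_apply]
  rfl

theorem chains_hom_ext {X : TopCat.{0}} {p : ℕ} {T : ModuleCat.{0} (ZMod 2)}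
    {f g : (chainsZ2 X).X p ⟶ T} (h : ∀ x, f.hom (basisChain X x) = g.hom (basisChain X x)) :
    f = g :=
  SSet.chainComplex_hom_ext fun x => ModuleCat.hom_ext (LinearMap.ext_ring (h x))

theorem toChains_ofChains (X : TopCat.{0}) {p : ℕ} (c : (chainsZ2 X).X p) :
    toChains X p ((ofChains X p).hom c) = c := by
  suffices h : ofChains X p ≫ ModuleCat.ofHom (toChains X p) = 𝟙 _ from
    congrArg (fun f => f.hom c) h
  refine chains_hom_ext fun x => ?_
  change toChains X p ((ofChains X p).hom (basisChain X x)) = basisChain X x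
  rw [ofChains_basisChain, toChains_single, Equiv.apply_symm_apply]

theorem map_succAbove_eq_face {p : ℕ} (i : Fin (p + 1)) (t : stdSimplex ℝ (Fin p)) :
    stdSimplex.map i.succAbove t = face i t := by
  ext j
  rw [face, aff_apply, stdSimplex.map_coe, FunOnFinite.linearMap_apply_apply]
  simp [Finset.sum_filter, Pi.single_apply, eq_comm]

theorem δ_singSimplex {X : TopCat.{0}} {p : ℕ} (σ : C(stdSimplex ℝ (Fin (p + 2)), X))
    (i : Fin (p + 2)) :
    (TopCat.toSSet.obj X).δ i (singSimplex X σ) = singSimplex X (σ.comp (face i)) := by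
  refine (singSimplex X).symm.injective ?_
  rw [Equiv.symm_apply_apply]
  ext t
  change σ (stdSimplex.map i.succAbove t) = σ (face i t)
  rw [map_succAbove_eq_face]

theorem d_toChains (X : TopCat.{0}) {p : ℕ} (z : Sing X (p + 2)) :
    ((chainsZ2 X).d (p + 1) p).hom (toChains X (p + 1) z) = toChains X p (sbd (p + 1) z) := by
  suffices h : ((chainsZ2 X).d (p + 1) p).hom ∘ₗ toChains X (p + 1) = toChains X p ∘ₗ sbd (p + 1)
    from LinearMap.congr_fun h z
  refine linearMap_ext_single fun σ => ?_
  rw [LinearMap.comp_apply, LinearMap.comp_apply, toChains_single, sbd_single, map_sum]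
  have h := congrArg (fun f => f.hom (1 : ZMod 2)) ((TopCat.toSSet.obj X).ιChainComplex_d
    (R := ModuleCat.of (ZMod 2) (ZMod 2)) (singSimplex X σ))
  refine h.trans ?_
  simp only [ModuleCat.hom_sum, LinearMap.sum_apply]
  refine Finset.sum_congr rfl fun i _ => ?_
  rw [toChains_single, δ_singSimplex]
  rcases neg_one_pow_eq_or ℤ i.val with hi | hi
  · rw [hi, one_smul]
  · rw [hi, neg_smul, one_smul, ModuleCat.hom_neg, LinearMap.neg_apply, neg_eq_iff_add_eq_zero]
    exact add_self_eq_zero_of_zmod2 _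

theorem map_toChains {X Y : TopCat.{0}} (f : X ⟶ Y) {p : ℕ} (z : Sing X (p + 1)) :
    ((SSet.chainComplexMap (TopCat.toSSet.map f) (ModuleCat.of (ZMod 2) (ZMod 2))).f p).hom
      (toChains X p z) = toChains Y p (push f.hom (p + 1) z) := by
  suffices h : ((SSet.chainComplexMap (TopCat.toSSet.map f)
      (ModuleCat.of (ZMod 2) (ZMod 2))).f p).hom ∘ₗ toChains X p =
      toChains Y p ∘ₗ push f.hom (p + 1) from LinearMap.congr_fun h z
  refine linearMap_ext_single fun σ => ?_
  rw [LinearMap.comp_apply, LinearMap.comp_apply, toChains_single, push_single, toChains_single]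
  exact congrArg (fun f => f.hom (1 : ZMod 2)) (SSet.ι_chainComplexMap_f _ _
    (TopCat.toSSet.map f) (ModuleCat.of (ZMod 2) (ZMod 2)) (singSimplex X σ))

theorem exists_toCycles_eq {K : ChainComplex (ModuleCat.{0} (ZMod 2)) ℕ} {p : ℕ}
    {c : K.cycles p} (hc : (K.homologyπ p).hom c = 0) :
    ∃ b, (K.toCycles (p + 1) p).hom b = c := by
  have h := (ShortComplex.mk (K.toCycles (p + 1) p) (K.homologyπ p)
    (by simp)).exact_of_g_is_cokernel (K.homologyIsCokernel (p + 1) p (by simp))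
  exact (ShortComplex.moduleCat_exact_iff _).1 h c hc

/-- Injectivity in singular homology, in terms of chains. -/
theorem homologyZ2_map_injective {X Y : TopCat.{0}} (f : X ⟶ Y) (p : ℕ)
    (h : ∀ z : Sing X (p + 1), (∃ b, sbd (p + 1) b = push f.hom (p + 1) z) →
      ∃ b, sbd (p + 1) b = z) :
    Function.Injective ((homologyZ2 p).map f) := by
  let F := SSet.chainComplexMap (TopCat.toSSet.map f) (ModuleCat.of (ZMod 2) (ZMod 2))
  change Function.Injective (HomologicalComplex.homologyMap F p).hom
  rw [injective_iff_map_eq_zero]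
  intro x hx
  obtain ⟨c, rfl⟩ := (ModuleCat.epi_iff_surjective ((chainsZ2 X).homologyπ p)).1 inferInstance x
  have h1 : ((chainsZ2 Y).homologyπ p).hom ((HomologicalComplex.cyclesMap F p).hom c) = 0 := by
    rw [← hx]
    exact congrArg (fun g => g.hom c) (HomologicalComplex.homologyπ_naturality F p).symm
  obtain ⟨b, hb⟩ := exists_toCycles_eq h1
  set z := ((chainsZ2 X).iCycles p).hom c with hz
  have h2 : ((chainsZ2 Y).d (p + 1) p).hom b = (F.f p).hom z := by
    have e1 := congrArg (fun g => g.hom b) ((chainsZ2 Y).toCycles_i (p + 1) p)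
    have e2 := congrArg (fun g => g.hom c) (HomologicalComplex.cyclesMap_i F p)
    refine e1.symm.trans (Eq.trans ?_ e2)
    exact congrArg ((chainsZ2 Y).iCycles p).hom hb
  obtain ⟨b', hb'⟩ := h ((ofChains X p).hom z) ⟨(ofChains Y (p + 1)).hom b, by
    rw [← ofChains_toChains Y (sbd (p + 1) _), ← d_toChains, toChains_ofChains, h2,
      ← ofChains_toChains Y (push f.hom (p + 1) _), ← map_toChains, toChains_ofChains]⟩
  have h3 : ((chainsZ2 X).d (p + 1) p).hom (toChains X (p + 1) b') = z := by
    rw [d_toChains, hb', toChains_ofChains]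
  have h4 : ((chainsZ2 X).toCycles (p + 1) p).hom (toChains X (p + 1) b') = c := by
    refine (ModuleCat.mono_iff_injective ((chainsZ2 X).iCycles p)).1 inferInstance ?_
    have e1 := congrArg (fun g => g.hom (toChains X (p + 1) b')) ((chainsZ2 X).toCycles_i (p + 1) p)
    exact e1.trans h3
  rw [← h4]
  exact congrArg (fun g => g.hom (toChains X (p + 1) b'))
    ((chainsZ2 X).toCycles_comp_homologyπ (p + 1) p)

end

noncomputable section

/-! ### Embedding the complex in a simplex -/

variable {n : ℕ} {V : Type*} [Fintype V] (b : AffineBasis V ℝ (EuclideanSpace ℝ (Fin n)))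

/-- The point with given barycentric coordinates with respect to the points `b`. -/
def fromBary (x : stdSimplex ℝ V) : EuclideanSpace ℝ (Fin n) := ∑ i, x i • b i

theorem continuous_fromBary : Continuous (fromBary b) :=
  continuous_finsetSum _ fun i _ =>
    ((continuous_apply i).comp continuous_subtype_val).smul continuous_const

theorem coord_fromBary (x : stdSimplex ℝ V) (i : V) : b.coord i (fromBary b x) = x i := by
  have h := b.coord_apply_combination_of_mem (Finset.mem_univ i) (w := x.1) x.2.2
  rwa [Finset.affineCombination_eq_linear_combination _ _ _ x.2.2] at h

theorem fromBary_injective : Function.Injective (fromBary b) := fun x y h => by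
  ext i
  rw [← coord_fromBary b x, h, coord_fromBary]

@[simp] theorem fromBary_vertex [DecidableEq V] (i : V) : fromBary b (stdSimplex.vertex i) = b i := by
  simp [fromBary, Pi.single_apply]

/-- The points supported on `s` are mapped onto the face of the simplex spanned by `s`. -/
theorem image_fromBary (s : Finset V) :
    fromBary b '' {x | supp x.1 ⊆ s} = convexHull ℝ (b '' s) := by
  classical
  refine Set.Subset.antisymm ?_ (convexHull_min ?_ ?_)
  · rintro _ ⟨x, hx, rfl⟩
    have h0 : ∀ i ∉ s, x i = 0 := fun i hi => by
      by_contra h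
      exact hi (hx (mem_supp.2 h))
    rw [fromBary, ← Finset.sum_subset (Finset.subset_univ s) fun i _ hi => by
      rw [h0 i hi, zero_smul]]
    refine (convex_convexHull ℝ _).sum_mem (fun i _ => stdSimplex.zero_le x i) ?_
      fun i hi => subset_convexHull ℝ _ ⟨i, hi, rfl⟩
    rw [Finset.sum_subset (Finset.subset_univ s) fun i _ hi => h0 i hi, stdSimplex.sum_eq_one]
  · rintro _ ⟨i, hi, rfl⟩
    refine ⟨stdSimplex.vertex i, fun j hj => ?_, fromBary_vertex b i⟩
    by_contra hjs
    refine mem_supp.1 hj ?_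
    have : j ≠ i := fun h => hjs (h ▸ hi)
    simp [this]
  · rintro _ ⟨x, hx, rfl⟩ _ ⟨y, hy, rfl⟩ r t hr ht hrt
    refine ⟨⟨r • x.1 + t • y.1, convex_stdSimplex ℝ V x.2 y.2 hr ht hrt⟩, fun i hi => ?_, ?_⟩
    · by_contra his
      refine mem_supp.1 hi ?_
      have h1 : x.1 i = 0 := by by_contra h; exact his (hx (mem_supp.2 h))
      have h2 : y.1 i = 0 := by by_contra h; exact his (hy (mem_supp.2 h))
      simp [h1, h2]
    · rw [fromBary, fromBary, fromBary, Finset.smul_sum, Finset.smul_sum,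
        ← Finset.sum_add_distrib]
      refine Finset.sum_congr rfl fun i _ => ?_
      rw [smul_smul, smul_smul, ← add_smul]
      rfl

theorem inner_fromBary (u : EuclideanSpace ℝ (Fin n)) (x : stdSimplex ℝ V) :
    inner ℝ u (fromBary b x) = ∑ i, x i * inner ℝ u (b i) := by
  rw [fromBary, inner_sum]
  exact Finset.sum_congr rfl fun i _ => real_inner_smul_right _ _ _

/-- The image of a complex in a simplex is a polyhedron. -/
theorem exists_simplicialComplex (K : PreAbstractSimplicialComplex V) :
    ∃ L : Geometry.SimplicialComplex ℝ (EuclideanSpace ℝ (Fin n)),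
      L.faces.Finite ∧ L.space = fromBary b '' carrier K.faces := by
  classical
  let L := Geometry.SimplicialComplex.ofAffineIndependent (𝕜 := ℝ) (K.map b) (by
    refine b.ind.range.mono fun x hx => ?_
    simp only [Set.mem_iUnion, Finset.mem_coe] at hx
    obtain ⟨_, ⟨s, _, rfl⟩, hx⟩ := hx
    obtain ⟨i, -, rfl⟩ := Finset.mem_image.1 hx
    exact ⟨i, rfl⟩)
  have hL : L.faces = (fun s : Finset V => s.image b) '' K.faces := rfl
  refine ⟨L, ?_, ?_⟩
  · rw [hL]
    exact (Set.toFinite _).image _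
  · ext y
    rw [Geometry.SimplicialComplex.mem_space_iff, hL]
    constructor
    · rintro ⟨_, ⟨s, hs, rfl⟩, hy⟩
      rw [Finset.coe_image, ← image_fromBary] at hy
      obtain ⟨x, hx, rfl⟩ := hy
      exact ⟨x, (K.isRelLowerSet_faces hs).2 hx (supp_nonempty x), rfl⟩
    · rintro ⟨x, hx, rfl⟩
      refine ⟨_, ⟨supp x.1, hx, rfl⟩, ?_⟩
      rw [Finset.coe_image, ← image_fromBary]
      exact ⟨x, Finset.Subset.refl _, rfl⟩

/-- A complete surface complex in a simplex is tight: by simplicial approximation this follows from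
the injectivity of the homology of induced subcomplexes. -/
theorem homology_injective_halfSpace {V : Type} [Fintype V] [LinearOrder V]
    (b : AffineBasis V ℝ (EuclideanSpace ℝ (Fin n))) {F : Set (Finset V)}
    (hF : DownClosed F) (hcard : ∀ s ∈ F, s.card ≤ 3) (hcomplete : ∀ i j : V, i ≠ j → {i, j} ∈ F)
    (hlinks : SurfaceLinks F) {M : Set (EuclideanSpace ℝ (Fin n))}
    (hM : M = fromBary b '' carrier F) (u : EuclideanSpace ℝ (Fin n)) (c : ℝ) (p : ℕ) :
    Function.Injective ((homologyZ2 p).map (inclusionHom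
      (Set.inter_subset_left : M ∩ {x | c < inner ℝ u x} ⊆ M))) := by
  refine homologyZ2_map_injective _ p fun z ⟨d, hd⟩ => ?_
  let l : V → ℝ := fun i => inner ℝ u (b i)
  have hbary : ∀ y ∈ M, (fun i => b.coord i y) ∈ stdSimplex ℝ V := fun y hy => by
    rw [hM] at hy
    obtain ⟨x, -, rfl⟩ := hy
    simp only [coord_fromBary]
    exact x.2
  have hcoord : Continuous fun y : EuclideanSpace ℝ (Fin n) => fun i => b.coord i y :=
    continuous_pi fun i => (b.coord i).continuous_of_finiteDimensional
  let θ : C(M, stdSimplex ℝ V) :=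
    ⟨fun y => ⟨_, hbary y.1 y.2⟩, (hcoord.comp continuous_subtype_val).subtype_mk _⟩
  have hθ : ∀ y, θ y ∈ carrier F ∧ fromBary b (θ y) = y.1 := fun ⟨y, hy⟩ => by
    obtain ⟨x, hx, rfl⟩ := hM ▸ hy
    have : θ ⟨fromBary b x, hy⟩ = x := Subtype.ext (funext fun i => coord_fromBary b x i)
    rw [this]
    exact ⟨hx, rfl⟩
  let θ' : C((M ∩ {x | c < inner ℝ u x} : Set _), carrierAbove F l c) :=
    ⟨fun y => ⟨θ ⟨y.1, y.2.1⟩, (hθ _).1, by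
      have h1 := inner_fromBary b u (θ ⟨y.1, y.2.1⟩)
      rw [(hθ _).2] at h1
      rw [← h1]
      exact y.2.2⟩,
      (θ.continuous.comp (continuous_subtype_val.subtype_mk _)).subtype_mk _⟩
  let Ψ : C(carrierAbove F l c, (M ∩ {x | c < inner ℝ u x} : Set _)) :=
    ⟨fun x => ⟨fromBary b x.1, hM ▸ ⟨x.1, x.2.1, rfl⟩, by
      rw [Set.mem_ofPred_eq, inner_fromBary]
      exact x.2.2⟩,
      ((continuous_fromBary b).comp continuous_subtype_val).subtype_mk _⟩
  have hΨ : Ψ.comp θ' = ContinuousMap.id _ :=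
    ContinuousMap.ext fun y => Subtype.ext (hθ _).2
  obtain ⟨d', hd', hdz⟩ := exists_sbd_eq_of_carrierAbove hF l c
    (fun f hf g hg hgf => simp_injective hF hcard hcomplete hlinks l c p f hf g hg hgf)
    (z := push (inclMap (carrierAbove F l c)) (p + 1) (push θ' (p + 1) z))
    (push_mem_of_forall (fun a => a.2) _)
    (b := push θ (p + 2) d) (push_mem_of_forall (fun y => (hθ y).1) _) (by
      rw [sbd_push, hd, push_push, push_push]
      rfl)
  obtain ⟨d'', hd''⟩ := exists_sbd_eq_push_comp Ψ (exists_sbd_eq_of_mem hd' hdz)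
  rw [push_push, hΨ, push_id] at hd''
  exact ⟨d'', hd''⟩

/-- The realization of a complex as a set of points of the standard simplex. -/
def carrierHomeo {V : Type*} [Fintype V] (K : AbstractSimplicialComplex V) :
    carrier K.faces ≃ₜ realization K where
  toFun x := ⟨x.1.1, x.1.2, x.2⟩
  invFun x := ⟨⟨x.1, x.2.1⟩, x.2.2⟩
  left_inv _ := rfl
  right_inv _ := rfl
  continuous_toFun := (continuous_subtype_val.comp continuous_subtype_val).subtype_mk _
  continuous_invFun := (continuous_subtype_val.subtype_mk _).subtype_mk _

end

end TightSurface

theorem mainTheorem3 (n : ℕ) (S : Type*) [TopologicalSpace S] [T2Space S] [CompactSpace S]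
    [ChartedSpace (EuclideanHalfSpace 2) S]
    (T : TightSurface.Triangulation (Fin (n + 1)) S)
    (hcomplete : TightSurface.oneSkeleton T.complex = ⊤)
    (hproper : ((𝓡∂ 2).boundary S).Nonempty → ∀ i, T.vertex i ∈ (𝓡∂ 2).boundary S) :
    ∃ φ : S → EuclideanSpace ℝ (Fin n),
      Topology.IsEmbedding φ ∧
      TightSurface.IsSubstantial φ ∧
      TightSurface.IsPolyhedral φ ∧
      TightSurface.IsTight φ ∧
      ∃ Δ : Affine.Simplex ℝ (EuclideanSpace ℝ (Fin n)) n,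
        ∀ s ∈ T.complex.faces, φ '' T.cell s = convexHull ℝ (Δ.points '' (s : Set (Fin (n + 1)))) := by
  obtain ⟨b⟩ := AffineBasis.exists_affineBasis_of_finiteDimensional (ι := Fin (n + 1)) (k := ℝ)
    (P := EuclideanSpace ℝ (Fin n)) (by simp)
  let F := T.complex.faces
  have hF : TightSurface.DownClosed F := fun s hs t hts hne =>
    (T.complex.isRelLowerSet_faces hs).2 hts hne
  have hvert : ∀ v, stdSimplex.vertex v ∈ TightSurface.carrier F := fun v =>
    (TightSurface.realizationVertex T.complex v).2.2
  let e := (TightSurface.carrierHomeo T.complex).trans T.homeo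
  have hpair : ∀ i j : Fin (n + 1), i ≠ j → {i, j} ∈ F := fun i j hij => by
    have h : (TightSurface.oneSkeleton T.complex).Adj i j := by rw [hcomplete]; exact hij
    exact h.2
  have hlinks : TightSurface.SurfaceLinks F :=
    TightSurface.surfaceLinks_of_homeomorph e hF T.card_le_three hvert hproper
  let φ : S → EuclideanSpace ℝ (Fin n) := fun x => TightSurface.fromBary b (e.symm x).1
  have hrange : Set.range φ = TightSurface.fromBary b '' TightSurface.carrier F := by
    ext y
    constructor
    · rintro ⟨x, rfl⟩
      exact ⟨(e.symm x).1, (e.symm x).2, rfl⟩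
    · rintro ⟨x, hx, rfl⟩
      exact ⟨e ⟨x, hx⟩, by simp only [φ]; rw [e.symm_apply_apply]⟩
  have hφ : Continuous φ := (TightSurface.continuous_fromBary b).comp
    (continuous_subtype_val.comp e.symm.continuous)
  refine ⟨φ, (hφ.isClosedEmbedding fun x y h => ?_).isEmbedding, ?_, ?_, ?_, ⟨b, b.ind⟩, ?_⟩
  · exact e.symm.injective (Subtype.ext (TightSurface.fromBary_injective b h))
  · rw [TightSurface.IsSubstantial, eq_top_iff, ← b.tot]
    refine affineSpan_mono ℝ ?_
    rintro _ ⟨i, rfl⟩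
    rw [hrange]
    exact ⟨_, hvert i, TightSurface.fromBary_vertex b i⟩
  · obtain ⟨L, hL, hL'⟩ := TightSurface.exists_simplicialComplex b
      T.complex.toPreAbstractSimplicialComplex
    exact ⟨L, hL, hrange.trans hL'.symm⟩
  · rintro p _ ⟨u, c, -, rfl⟩
    exact TightSurface.homology_injective_halfSpace b hF T.card_le_three hpair hlinks hrange u c p
  · intro s hs
    change φ '' T.cell s = convexHull ℝ (b '' s)
    rw [← TightSurface.image_fromBary]
    ext y
    constructor
    · rintro ⟨_, ⟨x, hx, rfl⟩, rfl⟩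
      refine ⟨⟨x.1, x.2.1⟩, hx, ?_⟩
      change _ = TightSurface.fromBary b (e.symm (e ⟨⟨x.1, x.2.1⟩, x.2.2⟩)).1
      rw [e.symm_apply_apply]
    · rintro ⟨x, hx, rfl⟩
      have hxF : x ∈ TightSurface.carrier F := hF s hs _ hx (TightSurface.supp_nonempty x)
      refine ⟨_, ⟨⟨x.1, x.2, hxF⟩, hx, rfl⟩, ?_⟩
      change TightSurface.fromBary b (e.symm (e ⟨x, hxF⟩)).1 = _
      rw [e.symm_apply_apply]
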